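/- **Setting.** Let $d\in\{2,3\}$ and let $\widehat D$ be one of the reference elements: the quadrilateral $[-1,1]^2$; the triangle $\{\widehat x,\widehat y\ge -1,\ \widehat x+\widehat y\le 0\}$; the tetrahedron $\{\widehat x,\widehat y,\widehat z\ge -1,\ \widehat x+\widehat y+\widehat z\le -1\}$ (only the interiors matter below, and the maps need only be given there). Let $N\ge 0$, and let $V_N$ be the space of polynomials of degree at most $N$ in each variable ($Q^N$) on the quadrilateral, and of total degree at most $N$ ($P^N$) on the triangle and the tetrahedron. Let $\Pi_N$ be the $L^2(\widehat D)$-orthogonal projection onto $V_N$. A mapped element is $D^k=\Phi(\widehat D)$, where $\Phi$ is a smooth injective map with Jacobian determinant $J=\det D\Phi>0$; put $h=\operatorname{diam}(D^k)$. Functions on $D^k$ and on $\widehat D$ are identified through $\Phi$. The element is *quasi-regular* of order $N+1$ with constant $\gamma$ if $$\sup_{\widehat D}|D^\alpha\Phi|\le\gamma\,h^{|\alpha|}\quad(1\le|\alpha|\le N+1),\qquad \sup_{\widehat D}J\le\gamma\,\inf_{\widehat D}J,$$ where on the quadrilateral the first bound is required only for the pure derivatives $D^\alpha=\partial_i^m$.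 For a function $u$ on $D^k$ the weight-adjusted pseudo-projection is $$P_Nu=\Pi_N\Big(\frac1J\,\Pi_N(uJ)\Big),$$ with both projections taken on $\widehat D$. Sobolev spaces are defined through weak derivatives with respect to the physical coordinates on the interior of $D^k$, with $$\|u\|_{W^{s,2}(D^k)}=\Big(\sum_{|\alpha|\le s}\|D^\alpha u\|_{L^2(D^k)}^2\Big)^{1/2},\qquad \|u\|_{W^{s,\infty}(D^k)}=\max_{|\alpha|\le s}\|D^\alpha u\|_{L^\infty(D^k)}.$$ **Theorem.** For each of the three reference elements, each $N\ge0$ and each $\gamma$ there is a constant $C<\infty$, depending only on these data, such that for every mapped element $D^k$ that is quasi-regular of order $N+1$ with constant $\gamma$ and every $u\in W^{N+1,2}(D^k)$, $$\|u-P_Nu\|_{L^2(D^k)}\le C\,C_J\,h^{N+1}\,\|u\|_{W^{N+1,2}(D^k)},$$ where $$C_J=\max\Big\{\Big\|\tfrac1{\sqrt J}\Big\|_{L^\infty(D^k)}\|\sqrt J\|_{L^\infty(D^k)},\ \Big\|\tfrac1J\Big\|_{L^\infty(D^k)}\|J\|_{W^{N+1,\infty}(D^k)}\Big\}$$ (with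 $\|J\|_{W^{N+1,\infty}(D^k)}=\infty$ if $J\notin W^{N+1,\infty}(D^k)$). -/

import Mathlib

open MeasureTheory Set
open scoped ENNReal NNReal ContDiff

noncomputable section

namespace WADG

/-- Physical or reference space `ℝ^d` with its Euclidean norm. -/
abbrev Sp (d : ℕ) := EuclideanSpace ℝ (Fin d)

/-! ### Partial derivatives, weak derivatives, Sobolev norms -/

/-- The `i`-th classical partial derivative. -/
def partialDeriv {d : ℕ} {F : Type*} [NormedAddCommGroup F] [NormedSpace ℝ F]
    (i : Fin d) (f : Sp d → F) : Sp d → F :=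
  fun x => fderiv ℝ f x (EuclideanSpace.single i 1)

/-- The classical derivative `D^α f` for a multi-index `α`. -/
def multiDeriv {d : ℕ} {F : Type*} [NormedAddCommGroup F] [NormedSpace ℝ F]
    (α : Fin d → ℕ) (f : Sp d → F) : Sp d → F :=
  (List.finRange d).foldr (fun i g => (partialDeriv i)^[α i] g) f

/-- `g` is a weak derivative `D^α u` on the open set `Ω`. -/
structure HasWeakDeriv {d : ℕ} (Ω : Set (Sp d)) (α : Fin d → ℕ) (u g : Sp d → ℝ) : Prop where
  locallyIntegrableOn : LocallyIntegrableOn u Ω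
  locallyIntegrableOn_deriv : LocallyIntegrableOn g Ω
  integral_eq : ∀ φ : Sp d → ℝ, ContDiff ℝ ∞ φ → HasCompactSupport φ → tsupport φ ⊆ Ω →
    ∫ x in Ω, u x * multiDeriv α φ x = (-1 : ℝ) ^ (∑ i, α i) * ∫ x in Ω, g x * φ x

open Classical in
/-- The weak derivative `D^α u` on `Ω` (unique almost everywhere), `0` if there is none. -/
def weakDeriv {d : ℕ} (Ω : Set (Sp d)) (α : Fin d → ℕ) (u : Sp d → ℝ) : Sp d → ℝ :=
  if h : ∃ g, HasWeakDeriv Ω α u g then h.choose else 0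

/-- The multi-indices `α` with `|α| ≤ s`. -/
def multiIndices (d s : ℕ) : Finset (Fin d → ℕ) :=
  (Fintype.piFinset fun _ : Fin d => Finset.range (s + 1)).filter fun α => ∑ i, α i ≤ s

/-- `u ∈ W^{s,p}(Ω)`. -/
def MemSobolev {d : ℕ} (Ω : Set (Sp d)) (s : ℕ) (p : ℝ≥0∞) (u : Sp d → ℝ) : Prop :=
  MemLp u p (volume.restrict Ω) ∧
    ∀ α ∈ multiIndices d s, ∃ g, HasWeakDeriv Ω α u g ∧ MemLp g p (volume.restrict Ω)

open Classical in
/-- The norm of `W^{s,p}(Ω)`: the `ℓ^p` sum (the maximum for `p = ∞`) of `‖D^α u‖_{L^p(Ω)}` over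
`|α| ≤ s`; it is `∞` outside `W^{s,p}(Ω)`. -/
def sobolevENorm {d : ℕ} (Ω : Set (Sp d)) (s : ℕ) (p : ℝ≥0∞) (u : Sp d → ℝ) : ℝ≥0∞ :=
  if MemSobolev Ω s p u then
    if p = ⊤ then
      (multiIndices d s).sup fun α => eLpNorm (weakDeriv Ω α u) ⊤ (volume.restrict Ω)
    else
      (∑ α ∈ multiIndices d s,
        eLpNorm (weakDeriv Ω α u) p (volume.restrict Ω) ^ p.toReal) ^ (1 / p.toReal)
  else ∞

/-! ### Reference elements, polynomial spaces, `L²` projection -/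

/-- The reference elements: bi-unit quadrilateral, bi-unit right triangle, bi-unit right
tetrahedron. -/
inductive RefElement : ℕ → Type
  | quad : RefElement 2
  | tri : RefElement 2
  | tet : RefElement 3

/-- The interior of the reference element (its boundary is a null set). -/
def RefElement.domain : {d : ℕ} → RefElement d → Set (Sp d)
  | _, .quad => {x | (∀ i, -1 < x i) ∧ ∀ i, x i < 1}
  | _, .tri => {x | (∀ i, -1 < x i) ∧ ∑ i, x i < 0}
  | _, .tet => {x | (∀ i, -1 < x i) ∧ ∑ i, x i < -1}

/-- The approximation space: `Q^N` (degree at most `N` in each variable) on the quadrilateral,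
`P^N` (total degree at most `N`) on the triangle and the tetrahedron. -/
def RefElement.polySpace : {d : ℕ} → RefElement d → ℕ → Submodule ℝ (MvPolynomial (Fin d) ℝ)
  | _, .quad, N => MvPolynomial.restrictDegree (Fin 2) ℝ N
  | _, .tri, N => MvPolynomial.restrictTotalDegree (Fin 2) ℝ N
  | _, .tet, N => MvPolynomial.restrictTotalDegree (Fin 3) ℝ N

/-- The value of a polynomial at a point. -/
def polyEval {d : ℕ} (p : MvPolynomial (Fin d) ℝ) (x : Sp d) : ℝ :=
  MvPolynomial.eval (fun i => x i) p

/-- `p` is the `L²` projection of `f` onto the approximation space of the reference element. -/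
def IsL2Proj {d : ℕ} (K : RefElement d) (N : ℕ) (f : Sp d → ℝ)
    (p : MvPolynomial (Fin d) ℝ) : Prop :=
  p ∈ K.polySpace N ∧ ∀ q ∈ K.polySpace N,
    ∫ x in K.domain, polyEval p x * polyEval q x = ∫ x in K.domain, f x * polyEval q x

open Classical in
/-- The `L²` projection `Π_N f` on the reference element. -/
def l2Proj {d : ℕ} (K : RefElement d) (N : ℕ) (f : Sp d → ℝ) : Sp d → ℝ :=
  if h : ∃ p, IsL2Proj K N f p then polyEval h.choose else 0

/-! ### Mapped elements -/

/-- The Jacobian `J` of `Φ` as a function on the reference element. -/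
def refJac {d : ℕ} (Φ : Sp d → Sp d) (y : Sp d) : ℝ := (fderiv ℝ Φ y).det

/-- The mapped element `D = Φ(D̂)` (without its boundary). -/
def element {d : ℕ} (K : RefElement d) (Φ : Sp d → Sp d) : Set (Sp d) := Φ '' K.domain

/-- The inverse of the element mapping, from `D` to the reference element. -/
def elementInv {d : ℕ} (K : RefElement d) (Φ : Sp d → Sp d) : Sp d → Sp d :=
  Function.invFunOn Φ K.domain

/-- The Jacobian `J` as a function on the mapped element `D`. -/
def jac {d : ℕ} (K : RefElement d) (Φ : Sp d → Sp d) (x : Sp d) : ℝ :=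
  refJac Φ (elementInv K Φ x)

/-- `Φ` is a smooth, injective element mapping with positive Jacobian. -/
structure IsElementMap {d : ℕ} (K : RefElement d) (Φ : Sp d → Sp d) : Prop where
  contDiffOn : ContDiffOn ℝ ∞ Φ K.domain
  injOn : InjOn Φ K.domain
  jac_pos : ∀ y ∈ K.domain, 0 < refJac Φ y

/-- The multi-indices of the derivatives of the mapping that regularity of an element controls:
all of them for the total degree spaces `P^N`, and only the pure derivatives `∂ᵢ^m` for the tensor
product space `Q^N` (so that shape-regular bilinear quadrilaterals are not excluded). -/
def RefElement.IsControlled : {d : ℕ} → RefElement d → (Fin d → ℕ) → Prop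
  | _, .quad, α => ∃ i m, α = Pi.single i m
  | _, .tri, _ => True
  | _, .tet, _ => True

/-- Quasi-regularity of order `m` with constant `γ` of the element `D = Φ(D̂)` of diameter `h`:
`|D^α Φ| ≤ γ h^|α|` on `D̂` for `1 ≤ |α| ≤ m`, and the values of the Jacobian are comparable. -/
structure IsQuasiRegular {d : ℕ} (K : RefElement d) (m : ℕ) (γ : ℝ) (Φ : Sp d → Sp d) :
    Prop where
  norm_multiDeriv_le : ∀ α : Fin d → ℕ, K.IsControlled α → 1 ≤ ∑ i, α i → ∑ i, α i ≤ m →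
    ∀ y ∈ K.domain, ‖multiDeriv α Φ y‖ ≤ γ * Metric.diam (element K Φ) ^ (∑ i, α i)
  jac_le : ∀ y ∈ K.domain, ∀ z ∈ K.domain, refJac Φ y ≤ γ * refJac Φ z

/-- The weight-adjusted pseudo-projection `P_N u = Π_N (J⁻¹ Π_N (u J))`: the projections are taken
on the reference element, and the result is transported back to `D`. -/
def pseudoProj {d : ℕ} (K : RefElement d) (N : ℕ) (Φ : Sp d → Sp d) (u : Sp d → ℝ) :
    Sp d → ℝ :=
  fun x => l2Proj K N
    (fun y => 1 / refJac Φ y * l2Proj K N (fun z => u (Φ z) * refJac Φ z) y) (elementInv K Φ x)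

/-- The constant `C_J`, the larger of `‖1/√J‖_∞ ‖√J‖_∞` and `‖1/J‖_∞ ‖J‖_{W^{N+1,∞}(D)}`. -/
def jacConst {d : ℕ} (K : RefElement d) (N : ℕ) (Φ : Sp d → Sp d) : ℝ≥0∞ :=
  max
    (eLpNorm (fun x => 1 / √(jac K Φ x)) ⊤ (volume.restrict (element K Φ)) *
      eLpNorm (fun x => √(jac K Φ x)) ⊤ (volume.restrict (element K Φ)))
    (eLpNorm (fun x => 1 / jac K Φ x) ⊤ (volume.restrict (element K Φ)) *
      sobolevENorm (element K Φ) (N + 1) ⊤ (jac K Φ))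

end WADG

end

noncomputable section

namespace WADG

section

/-! ### Polynomials and the reference elements -/

variable {d : ℕ}

/-! The estimate splits into quasi-optimality of the pseudo-projection and an approximation result
for functions composed with `Φ`.

Quasi-optimality (`eLpNorm_sub_l2Proj_div_le`): on the reference element, the error of `Π_N(J⁻¹
Π_N(fJ))` is at most `2‖f - p‖ + sup(1/J) ‖fJ - q‖` for any `p`, `q` in `V_N`, because `Π_N` is a
contraction, fixes `p`, and gives the best approximation of `fJ`. It remains to approximate the
pullbacks of `u` and of `uJ`.

Approximation (`exists_approx`): for smooth `w`, a derivative of order `N+1` of `w ∘ Φ` is bounded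
by `h^(N+1)` times derivatives of `w` of order at most `N+1` (`norm_iterate_dirDeriv_comp_le`, Faà
di Bruno). On the simplices a Taylor polynomial at a well-chosen point does the rest
(`exists_lintegral_sub_taylorAt_le`). On the square the mixed derivatives of `Φ` are not controlled.
There, one-variable operators that reproduce polynomials of degree `N` are applied in each
coordinate in turn, so that only pure derivatives enter (`IsDualFamily.exists_tensor_approx`).

From smooth functions to Sobolev functions: `u` and `J` are mollified on `D`. On compact subsets of
`D`, derivatives commute with mollification (`multiDeriv_mollify`), so the smooth approximants
inherit the Sobolev bounds there. The pullback of `uJ` is treated through the product of the two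
mollifications, so Leibniz' rule is only needed for smooth functions.
`exists_eLpNorm_sub_le_of_tendsto` then passes to the limit along reference elements shrunk away
from their faces: the polynomials live in a finite-dimensional space, so a subsequence converges,
and Fatou's lemma preserves the error bound.

Constants (`constants_le`): comparability gives `a ≤ J ≤ b` with `b/a = γ²`, so the two changes of
variables together cost `√(b/a) = γ`. The term with `u` is absorbed by `1 ≤ C_J`. The term with `uJ`
carries `(1/a)‖J‖_{W^{N+1,∞}}`, which is at most `γ² C_J` since `1/b ≤ ‖1/J‖_∞`. If `J` is not in
`W^{N+1,∞}`, then `C_J = ∞` and only the case `‖u‖ = 0` has content. -/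

theorem continuous_polyEval (p : MvPolynomial (Fin d) ℝ) : Continuous (polyEval p) := by
  unfold polyEval
  have : Continuous fun y : Fin d → ℝ => MvPolynomial.eval y p := MvPolynomial.continuous_eval p
  exact this.comp (by fun_prop)

theorem polyEval_add (p q : MvPolynomial (Fin d) ℝ) (x : Sp d) :
    polyEval (p + q) x = polyEval p x + polyEval q x := by simp [polyEval]

theorem polyEval_sub (p q : MvPolynomial (Fin d) ℝ) (x : Sp d) :
    polyEval (p - q) x = polyEval p x - polyEval q x := by simp [polyEval]

theorem polyEval_smul (c : ℝ) (p : MvPolynomial (Fin d) ℝ) (x : Sp d) :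
    polyEval (c • p) x = c * polyEval p x := by simp [polyEval, MvPolynomial.smul_eval]

/-- A polynomial vanishing on a nonempty open set is zero. -/
theorem eq_zero_of_polyEval_eqOn {U : Set (Sp d)} (hU : IsOpen U) (hne : U.Nonempty)
    {p : MvPolynomial (Fin d) ℝ} (h : ∀ x ∈ U, polyEval p x = 0) : p = 0 := by
  obtain ⟨c, hc⟩ := hne
  have hV : IsOpen ((WithLp.toLp 2 : (Fin d → ℝ) → Sp d) ⁻¹' U) :=
    hU.preimage (PiLp.continuous_toLp 2 _)
  obtain ⟨ε, hε, hb⟩ := Metric.isOpen_iff.1 hV c.ofLp hc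
  -- In the sup norm a ball is a product of intervals, hence of infinite sets, and a polynomial
  -- vanishing on such a product is zero.
  refine MvPolynomial.funext_set (fun i => Ioo (c i - ε) (c i + ε))
    (fun i => Ioo_infinite (by linarith)) fun x hx => ?_
  have hx' : x ∈ Metric.ball c.ofLp ε := by
    rw [Metric.mem_ball, dist_pi_lt_iff hε]
    intro i
    have := hx i (mem_univ i)
    rw [Real.dist_eq, abs_lt]
    constructor <;> linarith [this.1, this.2]
  simpa [polyEval] using h _ (hb hx')

theorem eq_zero_of_polyEval_ae_eq {U : Set (Sp d)} (hU : IsOpen U) (hne : U.Nonempty)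
    {p : MvPolynomial (Fin d) ℝ} (h : polyEval p =ᵐ[volume.restrict U] 0) : p = 0 :=
  eq_zero_of_polyEval_eqOn hU hne
    (Measure.eqOn_open_of_ae_eq h hU (continuous_polyEval p).continuousOn continuousOn_const)

/-- The part of the reference element at distance more than `δ` from its faces (up to constants). -/
def RefElement.shrink : {d : ℕ} → RefElement d → ℝ → Set (Sp d)
  | _, .quad, δ => {x | (∀ i, -1 + δ < x i) ∧ ∀ i, x i < 1 - δ}
  | _, .tri, δ => {x | (∀ i, -1 + δ < x i) ∧ ∑ i, x i < 0 - δ}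
  | _, .tet, δ => {x | (∀ i, -1 + δ < x i) ∧ ∑ i, x i < -1 - δ}

/-- The closed version of `RefElement.shrink`. -/
def RefElement.closedShrink : {d : ℕ} → RefElement d → ℝ → Set (Sp d)
  | _, .quad, δ => {x | (∀ i, -1 + δ ≤ x i) ∧ ∀ i, x i ≤ 1 - δ}
  | _, .tri, δ => {x | (∀ i, -1 + δ ≤ x i) ∧ ∑ i, x i ≤ 0 - δ}
  | _, .tet, δ => {x | (∀ i, -1 + δ ≤ x i) ∧ ∑ i, x i ≤ -1 - δ}

theorem RefElement.shrink_zero (K : RefElement d) : K.shrink 0 = K.domain := by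
  cases K <;> simp [RefElement.shrink, RefElement.domain]

theorem isOpen_setOf_forall_lt (a : ℝ) : IsOpen {x : Sp d | ∀ i, a < x i} := by
  simp only [ofPred_forall]
  exact isOpen_iInter_of_finite fun i => isOpen_lt continuous_const (by fun_prop)

theorem isOpen_setOf_forall_gt (a : ℝ) : IsOpen {x : Sp d | ∀ i, x i < a} := by
  simp only [ofPred_forall]
  exact isOpen_iInter_of_finite fun i => isOpen_lt (by fun_prop) continuous_const

theorem isClosed_setOf_forall_le (a : ℝ) : IsClosed {x : Sp d | ∀ i, a ≤ x i} := by
  simp only [ofPred_forall]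
  exact isClosed_iInter fun i => isClosed_le continuous_const (by fun_prop)

theorem isClosed_setOf_forall_ge (a : ℝ) : IsClosed {x : Sp d | ∀ i, x i ≤ a} := by
  simp only [ofPred_forall]
  exact isClosed_iInter fun i => isClosed_le (by fun_prop) continuous_const

theorem isOpen_setOf_sum_lt (a : ℝ) : IsOpen {x : Sp d | ∑ i, x i < a} :=
  isOpen_lt (by fun_prop) continuous_const

theorem isClosed_setOf_sum_le (a : ℝ) : IsClosed {x : Sp d | ∑ i, x i ≤ a} :=
  isClosed_le (by fun_prop) continuous_const

theorem RefElement.isOpen_shrink (K : RefElement d) (δ : ℝ) : IsOpen (K.shrink δ) := by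
  cases K
  · exact (isOpen_setOf_forall_lt _).inter (isOpen_setOf_forall_gt _)
  · exact (isOpen_setOf_forall_lt _).inter (isOpen_setOf_sum_lt _)
  · exact (isOpen_setOf_forall_lt _).inter (isOpen_setOf_sum_lt _)

theorem RefElement.isClosed_closedShrink (K : RefElement d) (δ : ℝ) :
    IsClosed (K.closedShrink δ) := by
  cases K
  · exact (isClosed_setOf_forall_le _).inter (isClosed_setOf_forall_ge _)
  · exact (isClosed_setOf_forall_le _).inter (isClosed_setOf_sum_le _)
  · exact (isClosed_setOf_forall_le _).inter (isClosed_setOf_sum_le _)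

theorem RefElement.shrink_subset_closedShrink (K : RefElement d) (δ : ℝ) :
    K.shrink δ ⊆ K.closedShrink δ := by
  cases K
  · exact fun x hx => ⟨fun i => (hx.1 i).le, fun i => (hx.2 i).le⟩
  · exact fun x hx => ⟨fun i => (hx.1 i).le, hx.2.le⟩
  · exact fun x hx => ⟨fun i => (hx.1 i).le, hx.2.le⟩

theorem RefElement.closedShrink_subset_shrink (K : RefElement d) {δ δ' : ℝ} (h : δ' < δ) :
    K.closedShrink δ ⊆ K.shrink δ' := by
  cases K
  · exact fun x hx => ⟨fun i => by linarith [hx.1 i], fun i => by linarith [hx.2 i]⟩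
  · exact fun x hx => ⟨fun i => by linarith [hx.1 i], by linarith [hx.2]⟩
  · exact fun x hx => ⟨fun i => by linarith [hx.1 i], by linarith [hx.2]⟩

theorem RefElement.closedShrink_subset_domain (K : RefElement d) {δ : ℝ} (h : 0 < δ) :
    K.closedShrink δ ⊆ K.domain :=
  K.shrink_zero ▸ K.closedShrink_subset_shrink h

theorem RefElement.shrink_subset_domain (K : RefElement d) {δ : ℝ} (h : 0 < δ) :
    K.shrink δ ⊆ K.domain :=
  (K.shrink_subset_closedShrink δ).trans (K.closedShrink_subset_domain h)

theorem RefElement.shrink_anti (K : RefElement d) {δ δ' : ℝ} (h : δ' ≤ δ) :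
    K.shrink δ ⊆ K.shrink δ' := by
  rcases h.eq_or_lt with rfl | h
  · exact subset_rfl
  · exact (K.shrink_subset_closedShrink δ).trans (K.closedShrink_subset_shrink h)

theorem RefElement.abs_apply_le (K : RefElement d) {x : Sp d} (hx : x ∈ K.closedShrink 0)
    (i : Fin d) : |x i| ≤ 1 := by
  cases K
  · exact abs_le.2 ⟨by linarith [hx.1 i], by linarith [hx.2 i]⟩
  · have h1 := hx.1 0
    have h2 := hx.1 1
    have h3 := hx.2
    rw [Fin.sum_univ_two] at h3
    fin_cases i <;> exact abs_le.2 ⟨by simp; linarith, by simp; linarith⟩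
  · have h0 := hx.1 0
    have h1 := hx.1 1
    have h2 := hx.1 2
    have h3 := hx.2
    rw [Fin.sum_univ_three] at h3
    fin_cases i <;> exact abs_le.2 ⟨by simp; linarith, by simp; linarith⟩

theorem RefElement.closedShrink_subset_zero (K : RefElement d) {δ : ℝ} (h : 0 ≤ δ) :
    K.closedShrink δ ⊆ K.closedShrink 0 := by
  rcases h.eq_or_lt with rfl | h
  · exact subset_rfl
  · exact (K.closedShrink_subset_shrink h).trans (K.shrink_subset_closedShrink 0)

theorem RefElement.closedShrink_zero_subset_closedBall (K : RefElement d) :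
    K.closedShrink 0 ⊆ Metric.closedBall 0 d := by
  intro x hx
  rw [mem_closedBall_zero_iff, EuclideanSpace.norm_eq]
  refine Real.sqrt_le_iff.2 ⟨by positivity, ?_⟩
  calc ∑ i, ‖x i‖ ^ 2 ≤ ∑ _i : Fin d, (1 : ℝ) := Finset.sum_le_sum fun i _ => by
        have := K.abs_apply_le hx i
        rw [Real.norm_eq_abs]
        nlinarith [abs_nonneg (x i)]
    _ = d := by simp
    _ ≤ (d : ℝ) ^ 2 := by
        have : (1 : ℝ) ≤ d := by
          cases K <;> norm_num
        nlinarith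

/-- For `δ > 0` these are compact subsets of the open domain. Their images under `Φ` are compact in
`D`, so mollification with a small radius does not leave `D` there. -/
theorem RefElement.isCompact_closedShrink (K : RefElement d) {δ : ℝ} (h : 0 ≤ δ) :
    IsCompact (K.closedShrink δ) :=
  (isCompact_closedBall 0 (d : ℝ)).of_isClosed_subset (K.isClosed_closedShrink δ)
    ((K.closedShrink_subset_zero h).trans K.closedShrink_zero_subset_closedBall)

theorem RefElement.domain_subset_closedShrink (K : RefElement d) :
    K.domain ⊆ K.closedShrink 0 :=
  K.shrink_zero ▸ K.shrink_subset_closedShrink 0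

theorem RefElement.domain_subset_closedBall (K : RefElement d) :
    K.domain ⊆ Metric.closedBall 0 d :=
  K.domain_subset_closedShrink.trans K.closedShrink_zero_subset_closedBall

theorem RefElement.isOpen_domain (K : RefElement d) : IsOpen K.domain :=
  K.shrink_zero ▸ K.isOpen_shrink 0

theorem RefElement.measurableSet_domain (K : RefElement d) : MeasurableSet K.domain :=
  K.isOpen_domain.measurableSet

theorem convex_setOf_forall_lt (a : ℝ) : Convex ℝ {x : Sp d | ∀ i, a < x i} := by
  intro x hx y hy s t hs ht hst i
  have := (convex_Ioi a) (hx i) (hy i) hs ht hst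
  simpa using this

theorem convex_setOf_forall_gt (a : ℝ) : Convex ℝ {x : Sp d | ∀ i, x i < a} := by
  intro x hx y hy s t hs ht hst i
  have := (convex_Iio a) (hx i) (hy i) hs ht hst
  simpa using this

theorem convex_setOf_sum_lt (a : ℝ) : Convex ℝ {x : Sp d | ∑ i, x i < a} := by
  intro x hx y hy s t hs ht hst
  have := (convex_Iio a) hx hy hs ht hst
  simpa [Finset.sum_add_distrib, Finset.mul_sum] using this

theorem RefElement.convex_shrink (K : RefElement d) (δ : ℝ) : Convex ℝ (K.shrink δ) := by
  cases K
  · exact (convex_setOf_forall_lt _).inter (convex_setOf_forall_gt _)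
  · exact (convex_setOf_forall_lt _).inter (convex_setOf_sum_lt _)
  · exact (convex_setOf_forall_lt _).inter (convex_setOf_sum_lt _)

theorem RefElement.shrink_nonempty (K : RefElement d) {δ : ℝ} (h : δ ≤ 1 / 8) :
    (K.shrink δ).Nonempty := by
  cases K
  · exact ⟨0, fun i => by simp; linarith, fun i => by simp; linarith⟩
  · refine ⟨WithLp.toLp 2 fun _ => -1 / 3, fun i => by simp; linarith, ?_⟩
    simp; linarith
  · refine ⟨WithLp.toLp 2 fun _ => -1 / 2, fun i => by simp; linarith, ?_⟩
    simp; linarith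

theorem RefElement.domain_nonempty (K : RefElement d) : K.domain.Nonempty :=
  K.shrink_zero ▸ K.shrink_nonempty (by norm_num)

/-- Finitely many strict affine inequalities hold at `x`, hence with a common margin. The shrunken
elements thus exhaust the domain, which gives pointwise convergence in the application of Fatou's
lemma. -/
theorem RefElement.exists_mem_shrink (K : RefElement d) {x : Sp d} (hx : x ∈ K.domain) :
    ∃ δ > 0, x ∈ K.shrink δ := by
  have key : ∀ l : List (Sp d → ℝ), (∀ f ∈ l, 0 < f x) → ∃ δ > 0, ∀ f ∈ l, δ < f x := by
    intro l
    induction l with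
    | nil => exact fun _ => ⟨1, one_pos, by simp⟩
    | cons f l ih =>
      intro h
      obtain ⟨δ, hδ, hl⟩ := ih fun g hg => h g (List.mem_cons_of_mem _ hg)
      have hf := h f List.mem_cons_self
      refine ⟨min δ (f x / 2), lt_min hδ (by linarith), fun g hg => ?_⟩
      rcases List.mem_cons.1 hg with rfl | hg
      · exact (min_le_right _ _).trans_lt (by linarith)
      · exact (min_le_left _ _).trans_lt (hl g hg)
  cases K
  · obtain ⟨δ, h, hl⟩ := key [fun x => 1 + x 0, fun x => 1 + x 1, fun x => 1 - x 0,
      fun x => 1 - x 1] (by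
        simp only [List.forall_mem_cons]
        refine ⟨?_, ?_, ?_, ?_, by simp⟩ <;> linarith [hx.1 0, hx.1 1, hx.2 0, hx.2 1])
    simp only [List.forall_mem_cons] at hl
    refine ⟨δ, h, fun i => ?_, fun i => ?_⟩ <;> fin_cases i <;> simp <;> linarith
  · obtain ⟨δ, h, hl⟩ := key [fun x => 1 + x 0, fun x => 1 + x 1, fun x => - ∑ i, x i] (by
        simp only [List.forall_mem_cons]
        refine ⟨?_, ?_, ?_, by simp⟩ <;> linarith [hx.1 0, hx.1 1, hx.2])
    simp only [List.forall_mem_cons] at hl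
    refine ⟨δ, h, fun i => ?_, by linarith⟩
    fin_cases i <;> simp <;> linarith
  · obtain ⟨δ, h, hl⟩ := key [fun x => 1 + x 0, fun x => 1 + x 1, fun x => 1 + x 2,
      fun x => -1 - ∑ i, x i] (by
        simp only [List.forall_mem_cons]
        refine ⟨?_, ?_, ?_, ?_, by simp⟩ <;> linarith [hx.1 0, hx.1 1, hx.1 2, hx.2])
    simp only [List.forall_mem_cons] at hl
    refine ⟨δ, h, fun i => ?_, by linarith⟩
    fin_cases i <;> simp <;> linarith

instance RefElement.isFiniteMeasure (K : RefElement d) :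
    IsFiniteMeasure (volume.restrict K.domain) :=
  ⟨by
    rw [Measure.restrict_apply_univ]
    exact (measure_mono K.domain_subset_closedBall).trans_lt measure_closedBall_lt_top⟩

theorem memLp_polyEval (K : RefElement d) (p : MvPolynomial (Fin d) ℝ) (q : ℝ≥0∞) :
    MemLp (polyEval p) q (volume.restrict K.domain) := by
  obtain ⟨C, hC⟩ := (isCompact_closedBall (0 : Sp d) (d : ℝ)).exists_bound_of_continuousOn
    (continuous_polyEval p).continuousOn
  refine MemLp.of_bound (continuous_polyEval p).aestronglyMeasurable C ?_
  filter_upwards [ae_restrict_mem K.measurableSet_domain] with x hx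
  exact hC x (K.domain_subset_closedBall hx)

theorem finite_setOf_forall_le (N : ℕ) : {n : Fin d →₀ ℕ | ∀ i, n i ≤ N}.Finite := by
  refine (Set.finite_Iic (Finsupp.equivFunOnFinite.symm fun _ : Fin d => N)).subset fun n hn => ?_
  exact fun i => hn i

theorem restrictTotalDegree_le_restrictDegree (N : ℕ) :
    MvPolynomial.restrictTotalDegree (Fin d) ℝ N ≤ MvPolynomial.restrictDegree (Fin d) ℝ N := by
  refine MvPolynomial.restrictSupport_mono _ fun n hn i => ?_
  refine le_trans ?_ (show (n.sum fun _ e => e) ≤ N from hn)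
  rw [Finsupp.sum_fintype _ _ (by simp)]
  exact Finset.single_le_sum (f := fun i => n i) (fun _ _ => Nat.zero_le _) (Finset.mem_univ i)

theorem RefElement.polySpace_le (K : RefElement d) (N : ℕ) :
    K.polySpace N ≤ MvPolynomial.restrictDegree (Fin d) ℝ N := by
  cases K
  · exact le_rfl
  · exact restrictTotalDegree_le_restrictDegree N
  · exact restrictTotalDegree_le_restrictDegree N

theorem RefElement.restrictTotalDegree_le (K : RefElement d) (N : ℕ) :
    MvPolynomial.restrictTotalDegree (Fin d) ℝ N ≤ K.polySpace N := by
  cases K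
  · exact restrictTotalDegree_le_restrictDegree N
  · exact le_rfl
  · exact le_rfl

instance RefElement.finiteDimensional_polySpace (K : RefElement d) (N : ℕ) :
    FiniteDimensional ℝ (K.polySpace N) := by
  have : FiniteDimensional ℝ (MvPolynomial.restrictDegree (Fin d) ℝ N) := by
    have := (finite_setOf_forall_le (d := d) N).to_subtype
    exact Module.Finite.of_basis
      (MvPolynomial.basisRestrictSupport ℝ {n : Fin d →₀ ℕ | ∀ i, n i ≤ N})
  exact Submodule.finiteDimensional_of_le (K.polySpace_le N)

/-! ### The `L²` projection -/

theorem eLpNorm_two_le_of_integral_sq_le {α : Type*} [MeasurableSpace α] {μ : Measure α}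
    {f g : α → ℝ} (hf : MemLp f 2 μ) (hg : MemLp g 2 μ)
    (h : ∫ x, f x ^ 2 ∂μ ≤ ∫ x, g x ^ 2 ∂μ) : eLpNorm f 2 μ ≤ eLpNorm g 2 μ := by
  rw [hf.eLpNorm_eq_integral_rpow_norm (by norm_num) (by norm_num),
    hg.eLpNorm_eq_integral_rpow_norm (by norm_num) (by norm_num)]
  refine ENNReal.ofReal_le_ofReal (Real.rpow_le_rpow (by positivity) ?_ (by positivity))
  simpa using h

section Projection

variable (K : RefElement d) (N : ℕ)

theorem integrable_mul_polyEval {f : Sp d → ℝ} (hf : MemLp f 2 (volume.restrict K.domain))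
    (p : MvPolynomial (Fin d) ℝ) :
    Integrable (fun x => f x * polyEval p x) (volume.restrict K.domain) :=
  hf.integrable_mul (memLp_polyEval K p 2)

/-- The `L²` inner product on the polynomial space, as a map to the dual. -/
def polyGram : K.polySpace N →ₗ[ℝ] Module.Dual ℝ (K.polySpace N) :=
  LinearMap.mk₂ ℝ (fun p q => ∫ x in K.domain, polyEval p x * polyEval q x)
    (fun p p' q => by
      simp only [Submodule.coe_add, polyEval_add, add_mul]
      exact integral_add (integrable_mul_polyEval K (memLp_polyEval K _ 2) _)
        (integrable_mul_polyEval K (memLp_polyEval K _ 2) _))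
    (fun c p q => by
      simp only [Submodule.coe_smul, polyEval_smul, mul_assoc, integral_const_mul, smul_eq_mul])
    (fun p q q' => by
      simp only [Submodule.coe_add, polyEval_add, mul_add]
      exact integral_add (integrable_mul_polyEval K (memLp_polyEval K _ 2) _)
        (integrable_mul_polyEval K (memLp_polyEval K _ 2) _))
    (fun c p q => by
      simp only [Submodule.coe_smul, polyEval_smul, mul_left_comm _ c, integral_const_mul,
        smul_eq_mul])

/-- The form is definite, since a polynomial that is zero almost everywhere on a nonempty open set
is zero. An injective map to a dual of the same finite dimension is onto. -/
theorem polyGram_surjective : Function.Surjective (polyGram K N) := by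
  refine (LinearMap.injective_iff_surjective_of_finrank_eq_finrank
    (Subspace.dual_finrank_eq).symm).1 ?_
  refine (injective_iff_map_eq_zero _).2 fun p hp => ?_
  have h0 : ∫ x in K.domain, polyEval p.1 x * polyEval p.1 x = 0 :=
    congrArg (fun l => l p) hp
  rw [integral_eq_zero_iff_of_nonneg (fun x => mul_self_nonneg _)
    (integrable_mul_polyEval K (memLp_polyEval K _ 2) _)] at h0
  have : polyEval p.1 =ᵐ[volume.restrict K.domain] 0 := by
    filter_upwards [h0] with x hx
    simpa using hx
  exact Subtype.ext (eq_zero_of_polyEval_ae_eq K.isOpen_domain K.domain_nonempty this)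

theorem exists_isL2Proj {f : Sp d → ℝ} (hf : MemLp f 2 (volume.restrict K.domain)) :
    ∃ p, IsL2Proj K N f p := by
  let l : Module.Dual ℝ (K.polySpace N) :=
    { toFun := fun q => ∫ x in K.domain, f x * polyEval q x
      map_add' := fun p q => by
        simp only [Submodule.coe_add, polyEval_add, mul_add]
        exact integral_add (integrable_mul_polyEval K hf _) (integrable_mul_polyEval K hf _)
      map_smul' := fun c p => by
        simp only [Submodule.coe_smul, polyEval_smul, mul_left_comm _ c, integral_const_mul,
          smul_eq_mul, RingHom.id_apply] }
  obtain ⟨p, hp⟩ := polyGram_surjective K N l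
  exact ⟨p, p.2, fun q hq => congrArg (fun l => l ⟨q, hq⟩) hp⟩

variable {K N}

theorem exists_l2Proj_eq {f : Sp d → ℝ} (hf : MemLp f 2 (volume.restrict K.domain)) :
    ∃ p, IsL2Proj K N f p ∧ l2Proj K N f = polyEval p := by
  have h := exists_isL2Proj K N hf
  exact ⟨h.choose, h.choose_spec, by rw [l2Proj, dif_pos h]⟩

/-- The projection is linear and fixes `V_N`. This reduces both best approximation and
quasi-optimality to the contraction property. -/
theorem IsL2Proj.sub_poly {f : Sp d → ℝ} (hf : MemLp f 2 (volume.restrict K.domain))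
    {p q : MvPolynomial (Fin d) ℝ} (h : IsL2Proj K N f p) (hq : q ∈ K.polySpace N) :
    IsL2Proj K N (fun x => f x - polyEval q x) (p - q) := by
  refine ⟨Submodule.sub_mem _ h.1 hq, fun s hs => ?_⟩
  simp only [polyEval_sub, sub_mul]
  rw [integral_sub (integrable_mul_polyEval K (memLp_polyEval K _ 2) _)
    (integrable_mul_polyEval K (memLp_polyEval K _ 2) _), h.2 s hs,
    integral_sub (integrable_mul_polyEval K hf _)
    (integrable_mul_polyEval K (memLp_polyEval K _ 2) _)]

/-- The `L²` norm of a projection is at most that of the function. -/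
theorem IsL2Proj.integral_sq_add {f : Sp d → ℝ} (hf : MemLp f 2 (volume.restrict K.domain))
    {p : MvPolynomial (Fin d) ℝ} (h : IsL2Proj K N f p) :
    (∫ x in K.domain, polyEval p x ^ 2) + ∫ x in K.domain, (f x - polyEval p x) ^ 2 =
      ∫ x in K.domain, f x ^ 2 := by
  have h1 := h.2 p h.1
  have hp := memLp_polyEval K p 2
  have e : ∀ x, (f x - polyEval p x) ^ 2 =
      f x ^ 2 - 2 * (f x * polyEval p x) + polyEval p x * polyEval p x := fun x => by ring
  simp only [e]
  have hi := (integrable_mul_polyEval K hf p).const_mul 2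
  have hsub : Integrable (fun x => f x ^ 2 - 2 * (f x * polyEval p x))
      (volume.restrict K.domain) := hf.integrable_sq.sub hi
  rw [integral_add hsub (integrable_mul_polyEval K hp p), integral_sub hf.integrable_sq hi,
    integral_const_mul, ← h1]
  simp only [← pow_two]
  ring

theorem IsL2Proj.eLpNorm_le {f : Sp d → ℝ} (hf : MemLp f 2 (volume.restrict K.domain))
    {p : MvPolynomial (Fin d) ℝ} (h : IsL2Proj K N f p) :
    eLpNorm (polyEval p) 2 (volume.restrict K.domain) ≤
      eLpNorm f 2 (volume.restrict K.domain) := by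
  refine eLpNorm_two_le_of_integral_sq_le (memLp_polyEval K p 2) hf ?_
  have := h.integral_sq_add hf
  have h2 : 0 ≤ ∫ x in K.domain, (f x - polyEval p x) ^ 2 :=
    integral_nonneg fun x => sq_nonneg _
  linarith

/-- A projection is a best approximation. -/
theorem IsL2Proj.eLpNorm_sub_le {f : Sp d → ℝ} (hf : MemLp f 2 (volume.restrict K.domain))
    {p q : MvPolynomial (Fin d) ℝ} (h : IsL2Proj K N f p) (hq : q ∈ K.polySpace N) :
    eLpNorm (fun x => f x - polyEval p x) 2 (volume.restrict K.domain) ≤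
      eLpNorm (fun x => f x - polyEval q x) 2 (volume.restrict K.domain) := by
  have hfq : MemLp (fun x => f x - polyEval q x) 2 (volume.restrict K.domain) :=
    hf.sub (memLp_polyEval K q 2)
  refine eLpNorm_two_le_of_integral_sq_le (hf.sub (memLp_polyEval K p 2)) hfq ?_
  have := (h.sub_poly hf hq).integral_sq_add hfq
  simp only [polyEval_sub, sub_sub_sub_cancel_right] at this
  have h2 : 0 ≤ ∫ x in K.domain, (polyEval p x - polyEval q x) ^ 2 :=
    integral_nonneg fun x => sq_nonneg _
  linarith

/-- Quasi-optimality of the weight-adjusted projection. -/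
theorem eLpNorm_sub_l2Proj_div_le {f j : Sp d → ℝ} {b : ℝ}
    (hf : MemLp f 2 (volume.restrict K.domain))
    (hfj : MemLp (fun x => f x * j x) 2 (volume.restrict K.domain))
    (hj : AEStronglyMeasurable j (volume.restrict K.domain))
    (hj0 : ∀ x ∈ K.domain, 0 < j x) (hb : ∀ x ∈ K.domain, 1 / j x ≤ b)
    {p q : MvPolynomial (Fin d) ℝ} (hp : p ∈ K.polySpace N) (hq : q ∈ K.polySpace N) :
    eLpNorm (fun x => f x - l2Proj K N (fun y => 1 / j y * l2Proj K N (fun z => f z * j z) y) x) 2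
        (volume.restrict K.domain) ≤
      2 * eLpNorm (fun x => f x - polyEval p x) 2 (volume.restrict K.domain) +
        ENNReal.ofReal b *
          eLpNorm (fun x => f x * j x - polyEval q x) 2 (volume.restrict K.domain) := by
  set μ := volume.restrict K.domain
  obtain ⟨r, hr, er⟩ := exists_l2Proj_eq (N := N) hfj
  rw [er]
  have hmem := ae_restrict_mem (μ := volume) K.measurableSet_domain
  have hjinv : AEStronglyMeasurable (fun x => 1 / j x) μ := by
    simp only [one_div]
    exact hj.aemeasurable.inv.aestronglyMeasurable
  have hw : MemLp (fun y => 1 / j y * polyEval r y) 2 μ := by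
    refine MemLp.of_le_mul (c := b) (memLp_polyEval K r 2)
      (hjinv.mul (continuous_polyEval r).aestronglyMeasurable) ?_
    filter_upwards [hmem] with x hx
    rw [norm_mul, Real.norm_of_nonneg (one_div_pos.2 (hj0 x hx)).le]
    exact mul_le_mul_of_nonneg_right (hb x hx) (norm_nonneg _)
  obtain ⟨s, hs, es⟩ := exists_l2Proj_eq (N := N) hw
  rw [es]
  have hfp := hf.sub (memLp_polyEval K p 2)
  have hwf : MemLp (fun y => 1 / j y * polyEval r y - f y) 2 μ := hw.sub hf
  -- `s` projects `r / j`, so `s - p` projects `r / j - p` and is no larger. The remaining distance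
  -- `r / j - f` equals `-(f j - r) / j`, where `r` is the best approximation of `f j`.
  have h1 : eLpNorm (polyEval (s - p)) 2 μ ≤
      eLpNorm (fun y => 1 / j y * polyEval r y - polyEval p y) 2 μ :=
    (hs.sub_poly hw hp).eLpNorm_le (hw.sub (memLp_polyEval K p 2))
  have h2 : eLpNorm (fun y => 1 / j y * polyEval r y - polyEval p y) 2 μ ≤
      eLpNorm (fun y => 1 / j y * polyEval r y - f y) 2 μ +
        eLpNorm (fun x => f x - polyEval p x) 2 μ := by
    refine le_trans (le_of_eq ?_) (eLpNorm_add_le hwf.1 hfp.1 (by norm_num))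
    congr 1
    ext y
    simp
  have h3 : eLpNorm (fun y => 1 / j y * polyEval r y - f y) 2 μ ≤
      ENNReal.ofReal b * eLpNorm (fun x => f x * j x - polyEval r x) 2 μ := by
    refine eLpNorm_le_mul_eLpNorm_of_ae_le_mul ?_ 2
    filter_upwards [hmem] with x hx
    have e : 1 / j x * polyEval r x - f x = (1 / j x) * (-(f x * j x - polyEval r x)) := by
      have := (hj0 x hx).ne'
      field_simp
      ring
    rw [e, norm_mul, norm_neg, Real.norm_of_nonneg (one_div_pos.2 (hj0 x hx)).le]
    exact mul_le_mul_of_nonneg_right (hb x hx) (norm_nonneg _)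
  have h4 := hr.eLpNorm_sub_le hfj hq
  have h5 : eLpNorm (fun x => f x - polyEval s x) 2 μ ≤
      eLpNorm (fun x => f x - polyEval p x) 2 μ + eLpNorm (polyEval (s - p)) 2 μ := by
    refine le_trans (le_of_eq ?_) (eLpNorm_sub_le hfp.1 (memLp_polyEval K (s - p) 2).1
      (by norm_num))
    congr 1
    ext y
    simp [polyEval_sub]
  calc eLpNorm (fun x => f x - polyEval s x) 2 μ
      ≤ eLpNorm (fun x => f x - polyEval p x) 2 μ +
        (ENNReal.ofReal b * eLpNorm (fun x => f x * j x - polyEval q x) 2 μ +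
          eLpNorm (fun x => f x - polyEval p x) 2 μ) := by
        refine h5.trans (add_le_add le_rfl (h1.trans (h2.trans (add_le_add (h3.trans ?_) le_rfl))))
        gcongr
    _ = _ := by ring

end Projection

end

section

/-! ### Averaged Taylor polynomials -/

/-- Cauchy–Schwarz against the constant function `1`. -/
theorem sq_lintegral_le {α : Type*} [MeasurableSpace α] (μ : Measure α) {g : α → ℝ≥0∞}
    (hg : AEMeasurable g μ) : (∫⁻ x, g x ∂μ) ^ 2 ≤ μ univ * ∫⁻ x, g x ^ 2 ∂μ := by
  have h := ENNReal.lintegral_mul_le_Lp_mul_Lq μ Real.HolderConjugate.two_two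
    (aemeasurable_const (b := (1 : ℝ≥0∞))) hg
  simp only [Pi.mul_apply, one_mul, ENNReal.one_rpow, lintegral_const] at h
  calc (∫⁻ x, g x ∂μ) ^ 2
      ≤ (μ univ ^ (1 / 2 : ℝ) * (∫⁻ x, g x ^ (2 : ℝ) ∂μ) ^ (1 / 2 : ℝ)) ^ 2 := by gcongr
    _ = _ := by
      rw [mul_pow, ← ENNReal.rpow_natCast, ← ENNReal.rpow_natCast, ← ENNReal.rpow_mul,
        ← ENNReal.rpow_mul]
      norm_num

/-! ### Directional derivatives and the Taylor remainder along segments. -/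

section DirDeriv

variable {E F : Type*} [NormedAddCommGroup E] [NormedSpace ℝ E] [NormedAddCommGroup F]
  [NormedSpace ℝ F]

/-- The derivative in the direction `z`. -/
def dirDeriv (z : E) (g : E → F) : E → F := fun x => fderiv ℝ g x z

theorem ContDiffOn.dirDeriv {U : Set E} (hU : IsOpen U) {g : E → F} (hg : ContDiffOn ℝ ∞ g U)
    (z : E) : ContDiffOn ℝ ∞ (dirDeriv z g) U :=
  (hg.fderiv_of_isOpen hU (m := ∞) (by simp)).clm_apply contDiffOn_const

theorem ContDiffOn.iterate_dirDeriv {U : Set E} (hU : IsOpen U) {g : E → F}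
    (hg : ContDiffOn ℝ ∞ g U) (z : E) (k : ℕ) : ContDiffOn ℝ ∞ ((WADG.dirDeriv z)^[k] g) U := by
  induction k with
  | zero => exact hg
  | succ k ih =>
    rw [Function.iterate_succ_apply']
    exact ContDiffOn.dirDeriv hU ih z

/-- Restriction to a line reduces Taylor's formula, the formula of Faà di Bruno and the slices of
the square to one variable. -/
theorem iteratedDeriv_comp_line {U : Set E} (hU : IsOpen U) {f : E → F}
    (hf : ContDiffOn ℝ ∞ f U) (y z : E) (k : ℕ) :
    ∀ t : ℝ, y + t • z ∈ U →
      iteratedDeriv k (fun t : ℝ => f (y + t • z)) t = (dirDeriv z)^[k] f (y + t • z) := by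
  have hV : IsOpen ((fun t : ℝ => y + t • z) ⁻¹' U) := hU.preimage (by fun_prop)
  induction k with
  | zero => simp
  | succ k ih =>
    intro t ht
    have e : iteratedDeriv k (fun t : ℝ => f (y + t • z)) =ᶠ[nhds t]
        fun t => (dirDeriv z)^[k] f (y + t • z) := by
      filter_upwards [hV.mem_nhds ht] with s hs
      exact ih s hs
    rw [iteratedDeriv_succ, e.deriv_eq, Function.iterate_succ_apply']
    have hd : DifferentiableAt ℝ ((dirDeriv z)^[k] f) (y + t • z) :=
      ((ContDiffOn.iterate_dirDeriv hU hf z k).contDiffAt (hU.mem_nhds ht)).differentiableAt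
        (by simp)
    have hl : HasDerivAt (fun t : ℝ => y + t • z) z t := by
      simpa using ((hasDerivAt_id t).smul_const z).const_add y
    exact (hd.hasFDerivAt.comp_hasDerivAt t hl).deriv

/-- The Taylor polynomial of order `N` of `f` at `y`. -/
def taylorAt (N : ℕ) (f : E → F) (y x : E) : F :=
  ∑ k ∈ Finset.range (N + 1), (k.factorial : ℝ)⁻¹ • (dirDeriv (x - y))^[k] f y

/-- Integral form of the remainder on the segment from `y` to `x`: the weight `(1 - t)^N / N!` is at
most `1`, and Cauchy–Schwarz on an interval of length one moves the square inside. -/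
theorem enorm_sub_taylorAt_sq_le [CompleteSpace F] {U : Set E} (hU : IsOpen U)
    (hc : Convex ℝ U) {f : E → F}
    (hf : ContDiffOn ℝ ∞ f U) (N : ℕ) {x y : E} (hx : x ∈ U) (hy : y ∈ U) {G : ℝ → ℝ≥0∞}
    (hG : Measurable G)
    (h : ∀ t ∈ Ioc (0 : ℝ) 1, ‖(dirDeriv (x - y))^[N + 1] f (y + t • (x - y))‖ₑ ≤ G t) :
    ‖f x - taylorAt N f y x‖ₑ ^ 2 ≤ ∫⁻ t in Ioc (0 : ℝ) 1, G t ^ 2 := by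
  set g : ℝ → F := fun t => f (y + t • (x - y)) with hg
  have hV : IsOpen ((fun t : ℝ => y + t • (x - y)) ⁻¹' U) := hU.preimage (by fun_prop)
  have hmem : ∀ t ∈ Icc (0 : ℝ) 1, y + t • (x - y) ∈ U := fun t ht =>
    hc.add_smul_sub_mem hy hx ht
  have hgc : ∀ t ∈ Icc (0 : ℝ) 1, ContDiffAt ℝ ∞ g t := fun t ht =>
    (hf.contDiffAt (hU.mem_nhds (hmem t ht))).comp t (by fun_prop)
  have hgd : ContDiffOn ℝ ∞ g (Icc 0 1) := fun t ht => (hgc t ht).contDiffWithinAt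
  have hder : ∀ k, ∀ t ∈ Icc (0 : ℝ) 1, iteratedDerivWithin k g (Icc 0 1) t =
      (dirDeriv (x - y))^[k] f (y + t • (x - y)) := fun k t ht => by
    rw [iteratedDerivWithin_eq_iteratedDeriv (uniqueDiffOn_Icc one_pos)
      ((hgc t ht).of_le (by exact_mod_cast le_top)) ht]
    exact iteratedDeriv_comp_line hU hf y (x - y) k t (hmem t ht)
  have hT := taylor_integral_remainder (f := g) (x₀ := 0) (x := 1) (n := N)
    (by rw [uIcc_of_le zero_le_one]; exact hgd.of_le (by exact_mod_cast le_top))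
  rw [uIcc_of_le zero_le_one, taylor_within_apply] at hT
  have e1 : f x - taylorAt N f y x =
      ∫ t in (0 : ℝ)..1, ((1 - t) ^ N / (N.factorial : ℝ)) •
        iteratedDerivWithin (N + 1) g (Icc 0 1) t := by
    rw [← hT, taylorAt]
    congr 1
    · simp [hg]
    · refine Finset.sum_congr rfl fun k _ => ?_
      rw [hder k 0 (by simp)]
      simp
  rw [e1, intervalIntegral.integral_of_le zero_le_one]
  calc _ ≤ (∫⁻ t in Ioc (0 : ℝ) 1, G t) ^ 2 := by
        gcongr
        refine (enorm_integral_le_lintegral_enorm _).trans ?_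
        refine setLIntegral_mono hG fun t ht => ?_
        rw [hder _ t ⟨ht.1.le, ht.2⟩, enorm_smul]
        have : ‖(1 - t) ^ N / (N.factorial : ℝ)‖ₑ ≤ 1 := by
          rw [Real.enorm_eq_ofReal_abs, ENNReal.ofReal_le_one, abs_div, abs_pow,
            abs_of_nonneg (by linarith [ht.2] : (0 : ℝ) ≤ 1 - t), Nat.abs_cast]
          refine div_le_one_of_le₀ ?_ (by positivity)
          refine (pow_le_one₀ (by linarith [ht.2]) (by linarith [ht.1])).trans ?_
          exact_mod_cast Nat.factorial_pos N
        calc _ ≤ 1 * G t := mul_le_mul' this (h t ht)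
          _ = G t := one_mul _
    _ ≤ volume.restrict (Ioc (0 : ℝ) 1) univ * ∫⁻ t in Ioc (0 : ℝ) 1, G t ^ 2 :=
        sq_lintegral_le _ hG.aemeasurable
    _ = _ := by simp

end DirDeriv

/-! ### Averaging the Taylor remainder over the base point. -/

section Averaging

variable {E : Type*} [NormedAddCommGroup E] [NormedSpace ℝ E] [FiniteDimensional ℝ E]
  [MeasurableSpace E] [BorelSpace E] (μ : Measure E) [μ.IsAddHaarMeasure]

theorem lintegral_comp_smul_add {G : E → ℝ≥0∞} (hG : Measurable G) {t : ℝ} (ht : t ≠ 0) (a : E) :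
    ∫⁻ x, G (t • x + a) ∂μ = ENNReal.ofReal |(t ^ Module.finrank ℝ E)⁻¹| * ∫⁻ x, G x ∂μ := by
  have h1 : ∫⁻ x, G (t • x + a) ∂μ = ∫⁻ x, G (x + a) ∂(μ.map fun x => t • x) := by
    exact (lintegral_map (hG.comp (by fun_prop : Measurable fun x => x + a))
      (measurable_const_smul t)).symm
  rw [h1, Measure.map_addHaar_smul μ ht, lintegral_smul_measure, lintegral_add_right_eq_self,
    smul_eq_mul]

/-- By convexity the contraction `x ↦ y + t(x - y)` maps `U` into itself. Its inverse Jacobian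
`t^(-n)` is at most `2^n` because `t ≥ 1/2`. -/
theorem lintegral_comp_segment_le {U : Set E} (hU : MeasurableSet U) (hc : Convex ℝ U)
    {G : E → ℝ≥0∞} (hG : Measurable G) {t : ℝ} (ht : t ∈ Icc (1 / 2 : ℝ) 1) {y : E} (hy : y ∈ U) :
    ∫⁻ x in U, G (y + t • (x - y)) ∂μ ≤ 2 ^ Module.finrank ℝ E * ∫⁻ x in U, G x ∂μ := by
  have h0 : 0 < t := by linarith [ht.1]
  have hGU : Measurable (U.indicator G) := hG.indicator hU
  calc ∫⁻ x in U, G (y + t • (x - y)) ∂μ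
      ≤ ∫⁻ x in U, U.indicator G (t • x + (y - t • y)) ∂μ := by
        refine setLIntegral_mono (hGU.comp (by fun_prop)) fun x hx => ?_
        have e : t • x + (y - t • y) = y + t • (x - y) := by
          rw [smul_sub]; abel
        rw [e, indicator_of_mem (hc.add_smul_sub_mem hy hx ⟨h0.le, ht.2⟩)]
    _ ≤ ∫⁻ x, U.indicator G (t • x + (y - t • y)) ∂μ := setLIntegral_le_lintegral _ _
    _ = ENNReal.ofReal |(t ^ Module.finrank ℝ E)⁻¹| * ∫⁻ x in U, G x ∂μ := by
        rw [lintegral_comp_smul_add μ hGU h0.ne', lintegral_indicator hU]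
    _ ≤ _ := by
        gcongr
        rw [abs_of_pos (by positivity)]
        calc ENNReal.ofReal (t ^ Module.finrank ℝ E)⁻¹
            ≤ ENNReal.ofReal (2 ^ Module.finrank ℝ E) := by
              refine ENNReal.ofReal_le_ofReal ?_
              rw [← inv_pow]
              refine pow_le_pow_left₀ (by positivity) ?_ _
              exact inv_le_of_inv_le₀ (by norm_num) (by linarith [ht.1])
          _ = _ := by
              rw [ENNReal.ofReal_pow (by norm_num)]
              norm_num

/-- Substituting in `x` alone would cost `t^(-n)`, which blows up at `t = 0`. For `t ≤ 1/2` the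
substitution is made in `y` instead, with factor `1 - t ≥ 1/2`; this is where integrating over both
endpoints pays. -/
theorem lintegral_lintegral_segment_le {U : Set E} (hU : MeasurableSet U) (hc : Convex ℝ U)
    {G : E → ℝ≥0∞} (hG : Measurable G) :
    ∫⁻ y in U, ∫⁻ x in U, (∫⁻ t in Ioc (0 : ℝ) 1, G (y + t • (x - y))) ∂μ ∂μ ≤
      μ U * (2 ^ Module.finrank ℝ E * ∫⁻ x in U, G x ∂μ) := by
  have hm : Measurable fun p : (E × E) × ℝ => G (p.1.1 + p.2 • (p.1.2 - p.1.1)) :=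
    hG.comp (by fun_prop)
  have key : ∀ t ∈ Ioc (0 : ℝ) 1, ∫⁻ y in U, ∫⁻ x in U, G (y + t • (x - y)) ∂μ ∂μ ≤
      μ U * (2 ^ Module.finrank ℝ E * ∫⁻ x in U, G x ∂μ) := by
    intro t ht
    have hconst : ∀ c : ℝ≥0∞, ∫⁻ _ in U, c ∂μ = μ U * c := fun c => by
      rw [setLIntegral_const, mul_comm]
    rw [← hconst]
    rcases le_total (1 / 2) t with h | h
    · exact setLIntegral_mono measurable_const fun y hy =>
        lintegral_comp_segment_le μ hU hc hG ⟨h, ht.2⟩ hy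
    · rw [lintegral_lintegral_swap]
      · refine setLIntegral_mono measurable_const fun x hx => ?_
        refine le_trans (le_of_eq ?_) (lintegral_comp_segment_le μ hU hc hG (t := 1 - t)
          ⟨by linarith, by linarith [ht.1]⟩ hx)
        refine lintegral_congr fun y => ?_
        congr 1
        simp only [sub_smul, smul_sub, one_smul]
        abel
      · exact (hG.comp (by fun_prop : Measurable fun p : E × E =>
          p.1 + t • (p.2 - p.1))).aemeasurable
  calc ∫⁻ y in U, ∫⁻ x in U, (∫⁻ t in Ioc (0 : ℝ) 1, G (y + t • (x - y))) ∂μ ∂μ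
      = ∫⁻ y in U, (∫⁻ t in Ioc (0 : ℝ) 1, ∫⁻ x in U, G (y + t • (x - y)) ∂μ) ∂μ := by
        refine lintegral_congr fun y => ?_
        rw [lintegral_lintegral_swap]
        exact (hG.comp (by fun_prop : Measurable fun p : E × ℝ =>
          y + p.2 • (p.1 - y))).aemeasurable
    _ = ∫⁻ t in Ioc (0 : ℝ) 1, (∫⁻ y in U, ∫⁻ x in U, G (y + t • (x - y)) ∂μ ∂μ) := by
        rw [lintegral_lintegral_swap]
        refine Measurable.aemeasurable ?_
        refine Measurable.lintegral_prod_right' (f := fun p : (E × ℝ) × E =>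
          G (p.1.1 + p.1.2 • (p.2 - p.1.1))) (hG.comp (by fun_prop))
    _ ≤ ∫⁻ t in Ioc (0 : ℝ) 1, μ U * (2 ^ Module.finrank ℝ E * ∫⁻ x in U, G x ∂μ) :=
        setLIntegral_mono measurable_const key
    _ = _ := by simp

/-- **Bramble–Hilbert** on a convex open set: some Taylor polynomial is a good approximation. -/
theorem exists_lintegral_sub_taylorAt_le {F : Type*} [NormedAddCommGroup F] [NormedSpace ℝ F]
    [CompleteSpace F] {U : Set E} (hU : IsOpen U) (hc : Convex ℝ U) (hne : U.Nonempty)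
    (hfin : μ U ≠ ⊤) {f : E → F} (hf : ContDiffOn ℝ ∞ f U) (N : ℕ) {G : E → ℝ≥0∞}
    (hG : Measurable G)
    (h : ∀ x ∈ U, ∀ y ∈ U, ∀ p ∈ U, ‖(dirDeriv (x - y))^[N + 1] f p‖ₑ ≤ G p) :
    ∃ y ∈ U, ∫⁻ x in U, ‖f x - taylorAt N f y x‖ₑ ^ 2 ∂μ ≤
      2 ^ Module.finrank ℝ E * ∫⁻ x in U, G x ^ 2 ∂μ := by
  have hpos : μ U ≠ 0 := (hU.measure_pos μ hne).ne'
  have hG2 : Measurable fun x => G x ^ 2 := hG.pow_const 2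
  have hm : AEMeasurable (fun y => ∫⁻ x in U, (∫⁻ t in Ioc (0 : ℝ) 1,
      G (y + t • (x - y)) ^ 2) ∂μ) (μ.restrict U) := by
    refine Measurable.aemeasurable ?_
    refine Measurable.lintegral_prod_right' (f := fun p : E × E => ∫⁻ t in Ioc (0 : ℝ) 1,
      G (p.1 + t • (p.2 - p.1)) ^ 2) ?_
    exact Measurable.lintegral_prod_right' (f := fun p : (E × E) × ℝ =>
      G (p.1.1 + p.2 • (p.1.2 - p.1.1)) ^ 2) (hG2.comp (by fun_prop))
  -- Instead of averaging Taylor polynomials, choose a base point at which the remainder bound does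
  -- not exceed its mean over `U`.
  obtain ⟨y, hy, hle⟩ := exists_le_setLAverage hpos hfin hm
  refine ⟨y, hy, ?_⟩
  calc ∫⁻ x in U, ‖f x - taylorAt N f y x‖ₑ ^ 2 ∂μ
      ≤ ∫⁻ x in U, (∫⁻ t in Ioc (0 : ℝ) 1, G (y + t • (x - y)) ^ 2) ∂μ := by
        refine setLIntegral_mono (Measurable.lintegral_prod_right' (f := fun p : E × ℝ =>
          G (y + p.2 • (p.1 - y)) ^ 2) (hG2.comp (by fun_prop))) fun x hx => ?_
        refine enorm_sub_taylorAt_sq_le hU hc hf N hx hy (G := fun t => G (y + t • (x - y)))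
          (hG.comp (by fun_prop)) fun t ht => ?_
        exact h x hx y hy _ (hc.add_smul_sub_mem hy hx ⟨ht.1.le, ht.2⟩)
    _ ≤ _ := hle
    _ = (μ U)⁻¹ * ∫⁻ y in U, ∫⁻ x in U, (∫⁻ t in Ioc (0 : ℝ) 1,
          G (y + t • (x - y)) ^ 2) ∂μ ∂μ := by rw [setLAverage_eq, ENNReal.div_eq_inv_mul]
    _ ≤ (μ U)⁻¹ * (μ U * (2 ^ Module.finrank ℝ E * ∫⁻ x in U, G x ^ 2 ∂μ)) := by
        gcongr
        exact lintegral_lintegral_segment_le μ hU.measurableSet hc hG2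
    _ = _ := by rw [← mul_assoc, ENNReal.inv_mul_cancel hpos hfin, one_mul]

end Averaging

end

section

/-! ### Iterated partial derivatives -/

section ListDeriv

variable {d : ℕ} {F : Type*} [NormedAddCommGroup F] [NormedSpace ℝ F]

/-- The iterated partial derivative along a list of directions. -/
def listDeriv (L : List (Fin d)) (f : Sp d → F) : Sp d → F := L.foldr partialDeriv f

theorem listDeriv_cons (i : Fin d) (L : List (Fin d)) (f : Sp d → F) :
    listDeriv (i :: L) f = partialDeriv i (listDeriv L f) := rfl

theorem listDeriv_replicate (i : Fin d) (m : ℕ) (f : Sp d → F) :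
    listDeriv (List.replicate m i) f = (partialDeriv i)^[m] f := by
  induction m with
  | zero => rfl
  | succ m ih => rw [List.replicate_succ, listDeriv_cons, ih, Function.iterate_succ_apply']

theorem listDeriv_append (L L' : List (Fin d)) (f : Sp d → F) :
    listDeriv (L ++ L') f = listDeriv L (listDeriv L' f) := by
  simp [listDeriv]

/-- The list of directions, in increasing order, of the derivative `D^α`. -/
def multiList (α : Fin d → ℕ) : List (Fin d) :=
  (List.finRange d).flatMap fun i => List.replicate (α i) i

theorem multiDeriv_eq_listDeriv (α : Fin d → ℕ) (f : Sp d → F) :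
    multiDeriv α f = listDeriv (multiList α) f := by
  unfold multiDeriv multiList
  induction List.finRange d with
  | nil => rfl
  | cons i l ih =>
    rw [List.foldr_cons, ih, List.flatMap_cons, listDeriv_append, listDeriv_replicate]

theorem count_multiList (α : Fin d → ℕ) (i : Fin d) : (multiList α).count i = α i := by
  rw [multiList, List.count_flatMap]
  have e : (fun j => (List.count i ∘ fun i => List.replicate (α i) i) j) =
      fun j => if j = i then α i else 0 := by
    ext j
    by_cases h : j = i
    · subst h; simp
    · simp [List.count_replicate, h]
  have := congrArg (fun g => (List.map g (List.finRange d)).sum) e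
  refine this.trans ?_
  rw [← List.ofFn_eq_map, List.sum_ofFn]
  simp

theorem length_multiList (α : Fin d → ℕ) : (multiList α).length = ∑ i, α i := by
  rw [multiList, List.length_flatMap]
  simp only [List.length_replicate]
  rw [← List.ofFn_eq_map, List.sum_ofFn]

variable {U : Set (Sp d)}

theorem eqOn_partialDeriv (hU : IsOpen U) {f g : Sp d → F} (h : EqOn f g U) (i : Fin d) :
    EqOn (partialDeriv i f) (partialDeriv i g) U := fun x hx => by
  have : f =ᶠ[nhds x] g := by
    filter_upwards [hU.mem_nhds hx] with y hy using h hy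
  simp [partialDeriv, this.fderiv_eq]

theorem contDiffOn_listDeriv (hU : IsOpen U) {f : Sp d → F} (hf : ContDiffOn ℝ ∞ f U)
    (L : List (Fin d)) : ContDiffOn ℝ ∞ (listDeriv L f) U := by
  induction L with
  | nil => exact hf
  | cons i L ih => exact ContDiffOn.dirDeriv hU ih _

theorem partialDeriv_comm (hU : IsOpen U) {f : Sp d → F} (hf : ContDiffOn ℝ ∞ f U)
    (i j : Fin d) {x : Sp d} (hx : x ∈ U) :
    partialDeriv i (partialDeriv j f) x = partialDeriv j (partialDeriv i f) x := by
  have hd : DifferentiableAt ℝ (fderiv ℝ f) x :=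
    ((hf.fderiv_of_isOpen hU (m := ∞) (by simp)).contDiffAt (hU.mem_nhds hx)).differentiableAt
      (by simp)
  have key : ∀ i j : Fin d, partialDeriv i (partialDeriv j f) x =
      fderiv ℝ (fderiv ℝ f) x (EuclideanSpace.single i 1) (EuclideanSpace.single j 1) := by
    intro i j
    unfold partialDeriv
    rw [fderiv_clm_apply hd (differentiableAt_const _)]
    simp
  rw [key, key]
  exact ((hf.contDiffAt (hU.mem_nhds hx)).isSymmSndFDerivAt (by
    simp only [minSmoothness_of_isRCLikeNormedField]
    exact WithTop.coe_le_coe.2 (le_top : (2 : ℕ∞) ≤ ⊤))) _ _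

theorem eqOn_listDeriv_of_perm (hU : IsOpen U) {f : Sp d → F} (hf : ContDiffOn ℝ ∞ f U)
    {L L' : List (Fin d)} (h : L.Perm L') : EqOn (listDeriv L f) (listDeriv L' f) U := by
  induction h with
  | nil => exact fun _ _ => rfl
  | cons i _ ih => exact eqOn_partialDeriv hU ih i
  | swap i j L => exact fun x hx => partialDeriv_comm hU (contDiffOn_listDeriv hU hf L) _ _ hx
  | trans _ _ ih1 ih2 => exact ih1.trans ih2

/-- Partial derivatives of a smooth function commute, so a list of directions matters only through
its counts. This links expansions indexed by tuples to the multi-indices in the hypotheses. -/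
theorem eqOn_listDeriv_multiDeriv (hU : IsOpen U) {f : Sp d → F} (hf : ContDiffOn ℝ ∞ f U)
    (L : List (Fin d)) : EqOn (listDeriv L f) (multiDeriv (fun i => L.count i) f) U := by
  rw [multiDeriv_eq_listDeriv]
  refine eqOn_listDeriv_of_perm hU hf (List.perm_iff_count.2 fun i => ?_)
  rw [count_multiList]

theorem sum_count_eq_length (L : List (Fin d)) : ∑ i, L.count i = L.length := by
  induction L with
  | nil => simp
  | cons a l ih => simp [List.count_cons, Finset.sum_add_distrib, ih]

theorem multiDeriv_single (hU : IsOpen U) {f : Sp d → F} (hf : ContDiffOn ℝ ∞ f U)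
    (i : Fin d) (m : ℕ) {x : Sp d} (hx : x ∈ U) :
    multiDeriv (Pi.single i m) f x = (dirDeriv (EuclideanSpace.single i 1))^[m] f x := by
  have h := eqOn_listDeriv_multiDeriv hU hf (List.replicate m i) hx
  have e : (fun j => (List.replicate m i).count j) = Pi.single i m := by
    ext j
    by_cases hj : j = i
    · subst hj; simp
    · simp [List.count_replicate, hj, Ne.symm hj]
  rw [e, listDeriv_replicate] at h
  exact h.symm

theorem dirDeriv_eq_sum (z : Sp d) (g : Sp d → F) (x : Sp d) :
    dirDeriv z g x = ∑ i, z i • partialDeriv i g x := by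
  have hz : z = ∑ i, z i • EuclideanSpace.single i (1 : ℝ) := by
    ext j
    simp [Finset.sum_apply, Pi.single_apply]
  unfold dirDeriv partialDeriv
  conv_lhs => rw [hz]
  simp

theorem sum_finCons {k : ℕ} {M : Type*} [AddCommMonoid M] (g : (Fin (k + 1) → Fin d) → M) :
    ∑ I, g I = ∑ i : Fin d, ∑ I : Fin k → Fin d, g (Fin.cons i I) := by
  rw [← Fintype.sum_prod_type', ← (Fin.consEquiv fun _ => Fin d).sum_comp]
  rfl

theorem listDeriv_ofFn_cons {k : ℕ} (i : Fin d) (I : Fin k → Fin d) (f : Sp d → F) :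
    listDeriv (List.ofFn (Fin.cons i I : Fin (k + 1) → Fin d)) f =
      partialDeriv i (listDeriv (List.ofFn I) f) := by
  rw [List.ofFn_succ, listDeriv_cons]
  simp

/-- Multinomial expansion of `(z · ∇)^k`, summed over ordered tuples so that no multinomial
coefficients appear. -/
theorem iterate_dirDeriv_eq_sum (hU : IsOpen U) {f : Sp d → F} (hf : ContDiffOn ℝ ∞ f U)
    (z : Sp d) (k : ℕ) : ∀ x ∈ U, (dirDeriv z)^[k] f x =
      ∑ I : Fin k → Fin d, (∏ j, z (I j)) • listDeriv (List.ofFn I) f x := by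
  induction k with
  | zero => intro x _; simp [listDeriv]
  | succ k ih =>
    intro x hx
    have e : (dirDeriv z)^[k] f =ᶠ[nhds x]
        fun x => ∑ I : Fin k → Fin d, (∏ j, z (I j)) • listDeriv (List.ofFn I) f x := by
      filter_upwards [hU.mem_nhds hx] with y hy using ih y hy
    have hd : ∀ I : Fin k → Fin d, DifferentiableAt ℝ (listDeriv (List.ofFn I) f) x := fun I =>
      ((contDiffOn_listDeriv hU hf _).contDiffAt (hU.mem_nhds hx)).differentiableAt (by simp)
    rw [Function.iterate_succ_apply', dirDeriv, e.fderiv_eq,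
      fderiv_fun_sum fun I _ => (hd I).fun_const_smul _, sum_apply]
    have : ∀ I : Fin k → Fin d,
        fderiv ℝ (fun x => (∏ j, z (I j)) • listDeriv (List.ofFn I) f x) x z =
        ∑ i, (∏ j, z ((Fin.cons i I : Fin (k + 1) → Fin d) j)) •
          listDeriv (List.ofFn (Fin.cons i I : Fin (k + 1) → Fin d)) f x := by
      intro I
      rw [fderiv_fun_const_smul (hd I), smul_apply]
      change _ • dirDeriv z _ x = _
      rw [dirDeriv_eq_sum, Finset.smul_sum]
      refine Finset.sum_congr rfl fun i _ => ?_
      rw [listDeriv_ofFn_cons, Fin.prod_univ_succ, smul_smul]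
      simp [mul_comm]
    rw [Finset.sum_congr rfl fun I _ => this I, Finset.sum_comm, sum_finCons]

theorem iteratedFDeriv_single_eq {f : Sp d → F} (hf : ContDiff ℝ ∞ f) (k : ℕ)
    (I : Fin k → Fin d) (x : Sp d) :
    iteratedFDeriv ℝ k f x (fun j => EuclideanSpace.single (I j) 1) =
      listDeriv (List.ofFn I) f x := by
  induction k generalizing x with
  | zero => simp [listDeriv]
  | succ k ih =>
    obtain ⟨i, I, rfl⟩ : ∃ i J, I = Fin.cons i J := ⟨I 0, Fin.tail I, (Fin.cons_self_tail I).symm⟩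
    rw [iteratedFDeriv_succ_apply_left, listDeriv_ofFn_cons]
    have hd : DifferentiableAt ℝ (iteratedFDeriv ℝ k f) x :=
      (hf.differentiable_iteratedFDeriv (by exact_mod_cast WithTop.coe_lt_top k)).differentiableAt
    have e : listDeriv (List.ofFn I) f = fun x =>
        iteratedFDeriv ℝ k f x (fun j => EuclideanSpace.single (I j) 1) := by
      ext x; exact (ih I x).symm
    rw [e, partialDeriv, fderiv_continuousMultilinear_apply_const_apply hd]
    rfl

theorem norm_iteratedFDeriv_le_sum {f : Sp d → F} (hf : ContDiff ℝ ∞ f) (k : ℕ) (x : Sp d) :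
    ‖iteratedFDeriv ℝ k f x‖ ≤ ∑ I : Fin k → Fin d, ‖listDeriv (List.ofFn I) f x‖ := by
  refine ContinuousMultilinearMap.opNorm_le_bound (Finset.sum_nonneg fun _ _ => norm_nonneg _)
    fun m => ?_
  have hm : m = fun j => ∑ i, (m j) i • EuclideanSpace.single i (1 : ℝ) := by
    ext j l
    simp [Finset.sum_apply, Pi.single_apply]
  conv_lhs => rw [hm]
  rw [ContinuousMultilinearMap.map_sum, Finset.sum_mul]
  refine (norm_sum_le _ _).trans (Finset.sum_le_sum fun I _ => ?_)
  rw [ContinuousMultilinearMap.map_smul_univ, iteratedFDeriv_single_eq hf, norm_smul, mul_comm,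
    norm_prod]
  gcongr with j
  exact PiLp.norm_apply_le (m j) (I j)

end ListDeriv

/-! ### Leibniz and chain rule bounds, and Taylor polynomials as polynomials. -/

section Chain

variable {d : ℕ}

/-- The sum of the norms of the derivatives of order at most `n`. -/
def derivSum (n : ℕ) (w : Sp d → ℝ) (x : Sp d) : ℝ :=
  ∑ k ∈ Finset.range (n + 1), ‖iteratedFDeriv ℝ k w x‖

theorem derivSum_nonneg (n : ℕ) (w : Sp d → ℝ) (x : Sp d) : 0 ≤ derivSum n w x :=
  Finset.sum_nonneg fun _ _ => norm_nonneg _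

theorem norm_iteratedFDeriv_le_derivSum {n k : ℕ} (hk : k ≤ n) (w : Sp d → ℝ) (x : Sp d) :
    ‖iteratedFDeriv ℝ k w x‖ ≤ derivSum n w x :=
  Finset.single_le_sum (f := fun k => ‖iteratedFDeriv ℝ k w x‖) (fun _ _ => norm_nonneg _)
    (Finset.mem_range.2 (by omega))

theorem abs_le_derivSum (n : ℕ) (w : Sp d → ℝ) (x : Sp d) : |w x| ≤ derivSum n w x := by
  have := norm_iteratedFDeriv_le_derivSum (Nat.zero_le n) w x
  rwa [norm_iteratedFDeriv_zero] at this

theorem continuous_derivSum (n : ℕ) {w : Sp d → ℝ} (hw : ContDiff ℝ ∞ w) :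
    Continuous (derivSum n w) :=
  continuous_finsetSum _ fun k _ =>
    (hw.continuous_iteratedFDeriv (by exact_mod_cast le_top)).norm

/-- Leibniz' rule: `n + 1` orders, at most `n + 1` terms in each, and binomial coefficients at most
`2^n`. -/
theorem derivSum_mul_le (n : ℕ) {v w : Sp d → ℝ} (hv : ContDiff ℝ ∞ v) (hw : ContDiff ℝ ∞ w)
    (x : Sp d) : derivSum n (fun y => v y * w y) x ≤
      ((n + 1) ^ 2 * 2 ^ n : ℕ) * (derivSum n v x * derivSum n w x) := by
  have key : ∀ k ∈ Finset.range (n + 1), ‖iteratedFDeriv ℝ k (fun y => v y * w y) x‖ ≤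
      ((n + 1) * 2 ^ n : ℕ) * (derivSum n v x * derivSum n w x) := by
    intro k hk
    have hk' : k ≤ n := by simpa [Nat.lt_succ_iff] using hk
    refine (norm_iteratedFDeriv_mul_le hv hw x (n := k) (by exact_mod_cast le_top)).trans ?_
    calc _ ≤ ∑ i ∈ Finset.range (k + 1), (2 ^ n : ℕ) * (derivSum n v x * derivSum n w x) := by
          refine Finset.sum_le_sum fun i hi => ?_
          rw [mul_assoc]
          have hi' : i ≤ k := by simpa [Nat.lt_succ_iff] using hi
          have h1 : k.choose i ≤ 2 ^ n :=
            (Nat.choose_le_two_pow k i).trans (Nat.pow_le_pow_right (by norm_num) hk')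
          have h2 : (k.choose i : ℝ) ≤ (2 ^ n : ℕ) := by exact_mod_cast h1
          have h3 := norm_iteratedFDeriv_le_derivSum (hi'.trans hk') v x
          have h4 := norm_iteratedFDeriv_le_derivSum ((Nat.sub_le k i).trans hk') w x
          have := derivSum_nonneg n v x
          gcongr
      _ = ((k + 1) * 2 ^ n : ℕ) * (derivSum n v x * derivSum n w x) := by
          rw [Finset.sum_const, Finset.card_range, nsmul_eq_mul]
          push_cast
          ring
      _ ≤ _ := by
          have := mul_nonneg (derivSum_nonneg n v x) (derivSum_nonneg n w x)
          gcongr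
  refine (Finset.sum_le_sum key).trans (le_of_eq ?_)
  rw [Finset.sum_const, Finset.card_range, nsmul_eq_mul]
  push_cast
  ring

/-- Directional derivatives of a composition, by the formula of Faà di Bruno. -/
theorem norm_iterate_dirDeriv_comp_le {U : Set (Sp d)} (hU : IsOpen U) {Φ : Sp d → Sp d}
    (hΦ : ContDiffOn ℝ ∞ Φ U) {w : Sp d → ℝ} (hw : ContDiff ℝ ∞ w) {z p : Sp d} (hp : p ∈ U)
    {n : ℕ} {D : ℝ} (hD : ∀ k, 1 ≤ k → k ≤ n → ‖(dirDeriv z)^[k] Φ p‖ ≤ D ^ k) :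
    ‖(dirDeriv z)^[n] (fun x => w (Φ x)) p‖ ≤ n.factorial * derivSum n w (Φ p) * D ^ n := by
  set V : Set ℝ := (fun t : ℝ => p + t • z) ⁻¹' U with hVdef
  have hV : IsOpen V := hU.preimage (by fun_prop)
  have h0 : (0 : ℝ) ∈ V := by simpa [hVdef] using hp
  have hc : ContDiffOn ℝ ∞ (fun t : ℝ => Φ (p + t • z)) V :=
    hΦ.comp (by fun_prop) (mapsTo_preimage _ _)
  -- The inner map is the curve `t ↦ Φ(p + t z)`, so only derivatives of `Φ` in the single direction
  -- `z` occur. For a coordinate direction these are pure derivatives, as the square requires.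
  have h := norm_iteratedFDerivWithin_comp_le (n := n) (N := ∞) (x := (0 : ℝ)) hw.contDiffOn hc
    (by exact_mod_cast le_top)
    uniqueDiffOn_univ hV.uniqueDiffOn (mapsTo_univ _ _) h0 (C := derivSum n w (Φ p)) (D := D)
    (fun k hk => by
      rw [iteratedFDerivWithin_univ]
      simpa using norm_iteratedFDeriv_le_derivSum hk w (Φ p))
    (fun k h1 h2 => by
      rw [iteratedFDerivWithin_of_isOpen k hV h0, norm_iteratedFDeriv_eq_norm_iteratedDeriv,
        iteratedDeriv_comp_line hU hΦ p z k 0 h0]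
      simpa using hD k h1 h2)
  rw [iteratedFDerivWithin_of_isOpen n hV h0, norm_iteratedFDeriv_eq_norm_iteratedDeriv] at h
  have e := iteratedDeriv_comp_line hU (f := fun x => w (Φ x)) (hw.comp_contDiffOn hΦ) p z n 0 h0
  rw [zero_smul, add_zero] at e
  rw [← e]
  exact h

/-- There are `d^k` ordered tuples, and each product of coordinates of `z` is at most `‖z‖^k`. -/
theorem norm_iterate_dirDeriv_le {U : Set (Sp d)} (hU : IsOpen U) {Φ : Sp d → Sp d}
    (hΦ : ContDiffOn ℝ ∞ Φ U) {z p : Sp d} (hp : p ∈ U) {k : ℕ} {B : ℝ}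
    (hB : ∀ α : Fin d → ℕ, ∑ i, α i = k → ‖multiDeriv α Φ p‖ ≤ B) :
    ‖(dirDeriv z)^[k] Φ p‖ ≤ (d * ‖z‖) ^ k * B := by
  rw [iterate_dirDeriv_eq_sum hU hΦ z k p hp]
  refine (norm_sum_le _ _).trans ?_
  calc _ ≤ ∑ _I : Fin k → Fin d, ‖z‖ ^ k * B := by
        refine Finset.sum_le_sum fun I _ => ?_
        rw [norm_smul, eqOn_listDeriv_multiDeriv hU hΦ _ hp, norm_prod]
        refine mul_le_mul ?_ (hB _ ?_) (norm_nonneg _) (by positivity)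
        · calc ∏ j, ‖z (I j)‖ ≤ ∏ _j : Fin k, ‖z‖ :=
                Finset.prod_le_prod (fun _ _ => norm_nonneg _) fun j _ =>
                  PiLp.norm_apply_le z (I j)
            _ = ‖z‖ ^ k := by simp
        · rw [sum_count_eq_length, List.length_ofFn]
    _ = _ := by
        simp only [Finset.sum_const, Finset.card_univ, Fintype.card_fun, Fintype.card_fin,
          nsmul_eq_mul]
        push_cast
        ring

/-- The Taylor polynomial is a polynomial. -/
theorem exists_polyEval_eq_taylorAt {U : Set (Sp d)} (hU : IsOpen U) {f : Sp d → ℝ}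
    (hf : ContDiffOn ℝ ∞ f U) (N : ℕ) {y : Sp d} (hy : y ∈ U) :
    ∃ p ∈ MvPolynomial.restrictTotalDegree (Fin d) ℝ N, ∀ x, polyEval p x = taylorAt N f y x := by
  refine ⟨∑ k ∈ Finset.range (N + 1), ∑ I : Fin k → Fin d,
    ((k.factorial : ℝ)⁻¹ * listDeriv (List.ofFn I) f y) •
      ∏ j, (MvPolynomial.X (I j) - MvPolynomial.C (y (I j))), ?_, fun x => ?_⟩
  · refine Submodule.sum_mem _ fun k hk => Submodule.sum_mem _ fun I _ =>
      Submodule.smul_mem _ _ ?_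
    rw [MvPolynomial.mem_restrictTotalDegree]
    refine (MvPolynomial.totalDegree_finsetProd _ _).trans ?_
    calc _ ≤ ∑ _j : Fin k, 1 := Finset.sum_le_sum fun j _ => by
          refine (MvPolynomial.totalDegree_sub_C_le _ _).trans ?_
          simp
      _ ≤ N := by
          simpa [Nat.lt_succ_iff] using hk
  · rw [taylorAt]
    simp only [polyEval, map_sum]
    refine Finset.sum_congr rfl fun k _ => ?_
    rw [iterate_dirDeriv_eq_sum hU hf _ k y hy, Finset.smul_sum]
    refine Finset.sum_congr rfl fun I _ => ?_
    simp [MvPolynomial.smul_eval, map_prod]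
    ring

end Chain

end

/-! ### Reproducing kernels of polynomials on an interval -/

section Kernel

-- The Gram matrix of the monomials on `[-1, 1]` is invertible: a vector `c` in its kernel gives a
-- polynomial `p` with `∫ p² = ∑ c_j (L c)_j = 0`, hence `p = 0`. The dual family is read off from
-- preimages of the unit vectors.
open Polynomial in
theorem exists_dual_polynomials (N : ℕ) : ∃ ρ : ℕ → Polynomial ℝ, ∀ i ≤ N, ∀ j ≤ N,
    ∫ s in (-1 : ℝ)..1, (ρ i).eval s * s ^ j = if i = j then 1 else 0 := by
  have hint : ∀ (c : Fin (N + 1) → ℝ) (j : ℕ), IntervalIntegrable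
      (fun s : ℝ => (∑ i, c i * s ^ (i : ℕ)) * s ^ j) volume (-1) 1 := fun c j =>
    (by fun_prop : Continuous fun s : ℝ => (∑ i, c i * s ^ (i : ℕ)) * s ^ j).intervalIntegrable _ _
  let L : (Fin (N + 1) → ℝ) →ₗ[ℝ] (Fin (N + 1) → ℝ) :=
    { toFun := fun c j => ∫ s in (-1 : ℝ)..1, (∑ i, c i * s ^ (i : ℕ)) * s ^ (j : ℕ)
      map_add' := fun c c' => by
        ext j
        simp only [Pi.add_apply, add_mul, Finset.sum_add_distrib]
        exact intervalIntegral.integral_add (hint c j) (hint c' j)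
      map_smul' := fun a c => by
        ext j
        simp only [Pi.smul_apply, smul_eq_mul, mul_assoc, ← Finset.mul_sum, RingHom.id_apply]
        exact intervalIntegral.integral_const_mul _ _ }
  have hinj : Function.Injective L := by
    refine (injective_iff_map_eq_zero _).2 fun c hc => ?_
    set p : Polynomial ℝ := ∑ i : Fin (N + 1), C (c i) * X ^ (i : ℕ) with hp
    have hpe : ∀ s : ℝ, p.eval s = ∑ i : Fin (N + 1), c i * s ^ (i : ℕ) := fun s => by
      simp [hp, eval_finsetSum]
    have h0 : ∫ s in (-1 : ℝ)..1, p.eval s * p.eval s = 0 := by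
      have e : ∀ s : ℝ, p.eval s * p.eval s =
          ∑ j : Fin (N + 1), c j * ((∑ i : Fin (N + 1), c i * s ^ (i : ℕ)) * s ^ (j : ℕ)) := by
        intro s
        rw [hpe, Finset.mul_sum]
        refine Finset.sum_congr rfl fun j _ => by ring
      simp only [e]
      have hj : ∀ j ∈ (Finset.univ : Finset (Fin (N + 1))), IntervalIntegrable
          (fun s : ℝ => c j * ((∑ i : Fin (N + 1), c i * s ^ (i : ℕ)) * s ^ (j : ℕ))) volume
          (-1) 1 := fun j _ => (hint c j).const_mul _
      rw [intervalIntegral.integral_finsetSum hj]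
      refine Finset.sum_eq_zero fun j _ => ?_
      rw [intervalIntegral.integral_const_mul]
      have : (∫ s in (-1 : ℝ)..1, (∑ i, c i * s ^ (i : ℕ)) * s ^ (j : ℕ)) = 0 := congrFun hc j
      rw [this, mul_zero]
    have hcont : Continuous fun s : ℝ => p.eval s * p.eval s := by fun_prop
    have hzero : ∀ s ∈ Ioo (-1 : ℝ) 1, p.eval s = 0 := by
      intro s hs
      by_contra hne
      have : 0 < ∫ s in (-1 : ℝ)..1, p.eval s * p.eval s :=
        intervalIntegral.integral_pos (by norm_num) hcont.continuousOn
          (fun x _ => mul_self_nonneg _) ⟨s, Ioo_subset_Icc_self hs, mul_self_pos.2 hne⟩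
      exact this.ne' h0
    have hp0 : p = 0 := eq_zero_of_infinite_isRoot p
      ((Ioo_infinite (by norm_num : (-1 : ℝ) < 1)).mono hzero)
    ext j
    have := congrArg (fun q => q.coeff (j : ℕ)) hp0
    simpa [hp, finsetSum_coeff, coeff_C_mul, coeff_X_pow, Fin.val_inj] using this
  have hsurj : Function.Surjective L := LinearMap.injective_iff_surjective.1 hinj
  choose c hc using fun i : Fin (N + 1) => hsurj (Pi.single i 1)
  refine ⟨fun i => if h : i < N + 1 then ∑ l, C (c ⟨i, h⟩ l) * X ^ (l : ℕ) else 0,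
    fun i hi j hj => ?_⟩
  simp only [dif_pos (Nat.lt_succ_iff.2 hi)]
  have := congrFun (hc ⟨i, Nat.lt_succ_iff.2 hi⟩) ⟨j, Nat.lt_succ_iff.2 hj⟩
  simp only [eval_finsetSum, eval_mul, eval_C, eval_pow, eval_X]
  refine this.trans ?_
  simp [Pi.single_apply, eq_comm]

/-- The dual family on `(-1, 1)` is rescaled to `(-r, r)`. The scaling factors `r^(-(i+1))` are at
most `2^(N+1)` for `r ≥ 1/2` and `i ≤ N`, so one `M` serves all shrunken squares. -/
theorem exists_reproducing (N : ℕ) : ∃ M : ℝ, 0 ≤ M ∧ ∀ r ∈ Icc (1 / 2 : ℝ) 1,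
    ∃ ρ : ℕ → ℝ → ℝ, (∀ i, Continuous (ρ i)) ∧ (∀ i ≤ N, ∀ s ∈ Ioo (-r) r, |ρ i s| ≤ M) ∧
      ∀ T : Polynomial ℝ, T.natDegree ≤ N → ∀ a : ℝ,
        ∫ s in Ioo (-r) r, (∑ i ∈ Finset.range (N + 1), a ^ i * ρ i s) * T.eval s = T.eval a := by
  obtain ⟨ρ, hρ⟩ := exists_dual_polynomials N
  have hb : ∀ i, ∃ B : ℝ, ∀ s ∈ Icc (-1 : ℝ) 1, ‖(ρ i).eval s‖ ≤ B := fun i =>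
    isCompact_Icc.exists_bound_of_continuousOn (ρ i).continuous.continuousOn
  choose B hB using hb
  have hB0 : ∀ i, 0 ≤ B i := fun i => (norm_nonneg _).trans (hB i 0 (by simp))
  refine ⟨2 ^ (N + 1) * ∑ i ∈ Finset.range (N + 1), B i,
    mul_nonneg (by positivity) (Finset.sum_nonneg fun i _ => hB0 i), fun r hr => ?_⟩
  have hr0 : 0 < r := by linarith [hr.1]
  have hcont : ∀ i, Continuous fun s : ℝ => (r⁻¹) ^ (i + 1) * (ρ i).eval (s / r) := fun i =>
    continuous_const.mul ((ρ i).continuous.comp (by fun_prop))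
  refine ⟨fun i s => (r⁻¹) ^ (i + 1) * (ρ i).eval (s / r), hcont, fun i hi s hs => ?_,
    fun T hT a => ?_⟩
  · rw [abs_mul, abs_of_nonneg (by positivity)]
    refine mul_le_mul ?_ ?_ (abs_nonneg _) (by positivity)
    · calc (r⁻¹) ^ (i + 1) ≤ 2 ^ (i + 1) := pow_le_pow_left₀ (by positivity)
            (inv_le_of_inv_le₀ (by norm_num) (by linarith [hr.1])) _
        _ ≤ 2 ^ (N + 1) := pow_le_pow_right₀ (by norm_num) (by omega)
    · have : s / r ∈ Icc (-1 : ℝ) 1 := by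
        constructor
        · rw [le_div_iff₀ hr0]; linarith [hs.1]
        · rw [div_le_iff₀ hr0]; linarith [hs.2]
      exact (hB i _ this).trans (Finset.single_le_sum (f := B) (fun i _ => hB0 i)
        (Finset.mem_range.2 (by omega)))
  · have hmono : ∀ i ≤ N, ∀ j ≤ N,
        ∫ s in (-r)..r, (r⁻¹ ^ (i + 1) * (ρ i).eval (s / r)) * s ^ j = if i = j then 1 else 0 := by
      intro i hi j hj
      have e : ∀ s : ℝ, (r⁻¹ ^ (i + 1) * (ρ i).eval (s / r)) * s ^ j =
          r⁻¹ ^ (i + 1) * r ^ j * ((ρ i).eval (s / r) * (s / r) ^ j) := fun s => by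
        rw [div_pow]
        field_simp
      simp only [e]
      rw [intervalIntegral.integral_const_mul, intervalIntegral.integral_comp_div
        (fun s => (ρ i).eval s * s ^ j) hr0.ne', neg_div, div_self hr0.ne', hρ i hi j hj]
      split_ifs with h
      · subst h
        rw [smul_eq_mul, pow_succ, inv_pow]
        field_simp
      · simp
    rw [← integral_Ioc_eq_integral_Ioo,
      ← intervalIntegral.integral_of_le (by linarith : -r ≤ r)]
    have hTe : ∀ x, T.eval x = ∑ j ∈ Finset.range (N + 1), T.coeff j * x ^ j := fun x =>
      Polynomial.eval_eq_sum_range' (Nat.lt_succ_iff.2 hT) x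
    have e : ∀ s : ℝ, (∑ i ∈ Finset.range (N + 1), a ^ i * (r⁻¹ ^ (i + 1) * (ρ i).eval (s / r))) *
        T.eval s = ∑ i ∈ Finset.range (N + 1), ∑ j ∈ Finset.range (N + 1), (a ^ i * T.coeff j) *
          ((r⁻¹ ^ (i + 1) * (ρ i).eval (s / r)) * s ^ j) := fun s => by
      rw [hTe, Finset.sum_mul_sum]
      refine Finset.sum_congr rfl fun i _ => Finset.sum_congr rfl fun j _ => by ring
    simp only [e]
    have hii : ∀ i j, IntervalIntegrable (fun s : ℝ => (a ^ i * T.coeff j) *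
        ((r⁻¹ ^ (i + 1) * (ρ i).eval (s / r)) * s ^ j)) volume (-r) r := fun i j =>
      (continuous_const.mul ((hcont i).mul (by fun_prop))).intervalIntegrable _ _
    have hi2 : ∀ i ∈ Finset.range (N + 1), IntervalIntegrable (fun s : ℝ =>
        ∑ j ∈ Finset.range (N + 1), (a ^ i * T.coeff j) *
        ((r⁻¹ ^ (i + 1) * (ρ i).eval (s / r)) * s ^ j)) volume (-r) r := fun i _ =>
      (continuous_finsetSum _ fun j _ => continuous_const.mul
        ((hcont i).mul (by fun_prop))).intervalIntegrable _ _
    rw [intervalIntegral.integral_finsetSum hi2, hTe]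
    refine Finset.sum_congr rfl fun i hi => ?_
    rw [intervalIntegral.integral_finsetSum fun j _ => hii i j]
    have hi' : i ≤ N := by simpa [Nat.lt_succ_iff] using hi
    rw [Finset.sum_eq_single i]
    · rw [intervalIntegral.integral_const_mul, hmono i hi' i hi', if_pos rfl]
      ring
    · intro j hj hne
      have hj' : j ≤ N := by simpa [Nat.lt_succ_iff] using hj
      rw [intervalIntegral.integral_const_mul, hmono i hi' j hj', if_neg hne.symm, mul_zero]
    · exact fun h => (h hi).elim

end Kernel

section

/-! ### Tensor product approximation on a square -/

section Tensor

theorem enn_add_sq_le (a b : ℝ≥0∞) : (a + b) ^ 2 ≤ 4 * (a ^ 2 + b ^ 2) := by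
  have h : a + b ≤ 2 * max a b := by
    rw [two_mul]
    exact add_le_add (le_max_left _ _) (le_max_right _ _)
  calc (a + b) ^ 2 ≤ (2 * max a b) ^ 2 := by gcongr
    _ = 4 * (max a b) ^ 2 := by rw [mul_pow]; norm_num
    _ ≤ _ := by
      gcongr
      rcases max_cases a b with ⟨h, _⟩ | ⟨h, _⟩ <;> rw [h]
      · exact le_self_add
      · exact le_add_self

/-- The kernel `∑ aⁱ ρᵢ(s)`. -/
def polyKernel (N : ℕ) (ρ : ℕ → ℝ → ℝ) (a s : ℝ) : ℝ :=
  ∑ i ∈ Finset.range (N + 1), a ^ i * ρ i s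

/-- `ρ` is dual to the monomials of degree at most `N` on `(-r, r)`, and bounded by `M`. -/
structure IsDualFamily (N : ℕ) (r M : ℝ) (ρ : ℕ → ℝ → ℝ) : Prop where
  le_one : r ≤ 1
  nonneg : 0 ≤ M
  continuous : ∀ i, Continuous (ρ i)
  bound : ∀ i ≤ N, ∀ s ∈ Ioo (-r) r, |ρ i s| ≤ M
  reproducing : ∀ T : Polynomial ℝ, T.natDegree ≤ N → ∀ a : ℝ,
    ∫ s in Ioo (-r) r, polyKernel N ρ a s * T.eval s = T.eval a

variable {N : ℕ} {r M : ℝ} {ρ : ℕ → ℝ → ℝ}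

namespace IsDualFamily

theorem continuous_kernel (h : IsDualFamily N r M ρ) :
    Continuous fun p : ℝ × ℝ => polyKernel N ρ p.1 p.2 :=
  continuous_finsetSum _ fun i _ => (by fun_prop : Continuous fun p : ℝ × ℝ => p.1 ^ i).mul
    ((h.continuous i).comp continuous_snd)

theorem abs_kernel_le (h : IsDualFamily N r M ρ) {a s : ℝ} (ha : a ∈ Ioo (-r) r)
    (hs : s ∈ Ioo (-r) r) : |polyKernel N ρ a s| ≤ (N + 1) * M := by
  refine (Finset.abs_sum_le_sum_abs _ _).trans ?_
  calc _ ≤ ∑ _i ∈ Finset.range (N + 1), M := by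
        refine Finset.sum_le_sum fun i hi => ?_
        rw [abs_mul, abs_pow]
        have h1 : |a| ^ i ≤ 1 := pow_le_one₀ (abs_nonneg _)
          ((abs_lt.2 ha).le.trans h.le_one)
        calc |a| ^ i * |ρ i s| ≤ 1 * M := mul_le_mul h1
              (h.bound i (by simpa [Nat.lt_succ_iff] using hi) s hs) (abs_nonneg _) zero_le_one
          _ = M := one_mul M
    _ = _ := by simp

theorem volume_le (h : IsDualFamily N r M ρ) : volume (Ioo (-r) r) ≤ 2 := by
  rw [Real.volume_Ioo]
  calc ENNReal.ofReal (r - -r) ≤ ENNReal.ofReal 2 :=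
        ENNReal.ofReal_le_ofReal (by linarith [h.le_one])
    _ = 2 := by norm_num

theorem integrable_mul (h : IsDualFamily N r M ρ) {g : ℝ → ℝ} (hg : Measurable g)
    (hb : ∃ B, ∀ s, |g s| ≤ B) {i : ℕ} (hi : i ≤ N) :
    Integrable (fun s => ρ i s * g s) (volume.restrict (Ioo (-r) r)) := by
  obtain ⟨B, hB⟩ := hb
  refine Integrable.of_bound ((h.continuous i).measurable.mul hg).aestronglyMeasurable (M * B) ?_
  filter_upwards [ae_restrict_mem measurableSet_Ioo] with s hs
  rw [norm_mul]
  exact mul_le_mul (h.bound i hi s hs) (hB s) (norm_nonneg _) h.nonneg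

theorem integrable_kernel_mul (h : IsDualFamily N r M ρ) {g : ℝ → ℝ} (hg : Measurable g)
    (hb : ∃ B, ∀ s, |g s| ≤ B) (a : ℝ) :
    Integrable (fun s => polyKernel N ρ a s * g s) (volume.restrict (Ioo (-r) r)) := by
  simp only [polyKernel, Finset.sum_mul, mul_assoc]
  exact integrable_finsetSum _ fun i hi =>
    (h.integrable_mul hg hb (by simpa [Nat.lt_succ_iff] using hi)).const_mul _

theorem integral_kernel_mul (h : IsDualFamily N r M ρ) {g : ℝ → ℝ} (hg : Measurable g)
    (hb : ∃ B, ∀ s, |g s| ≤ B) (a : ℝ) :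
    ∫ s in Ioo (-r) r, polyKernel N ρ a s * g s =
      ∑ i ∈ Finset.range (N + 1), a ^ i * ∫ s in Ioo (-r) r, ρ i s * g s := by
  simp only [polyKernel, Finset.sum_mul, mul_assoc]
  rw [integral_finsetSum]
  · simp only [integral_const_mul]
  · exact fun i hi => (h.integrable_mul hg hb (by simpa [Nat.lt_succ_iff] using hi)).const_mul _

theorem enorm_integral_kernel_sq_le (h : IsDualFamily N r M ρ) {g : ℝ → ℝ} (hg : Measurable g)
    {a : ℝ} (ha : a ∈ Ioo (-r) r) :
    ‖∫ s in Ioo (-r) r, polyKernel N ρ a s * g s‖ₑ ^ 2 ≤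
      2 * ENNReal.ofReal ((N + 1) * M) ^ 2 * ∫⁻ s in Ioo (-r) r, ‖g s‖ₑ ^ 2 := by
  have h1 : ‖∫ s in Ioo (-r) r, polyKernel N ρ a s * g s‖ₑ ≤
      ENNReal.ofReal ((N + 1) * M) * ∫⁻ s in Ioo (-r) r, ‖g s‖ₑ := by
    refine (enorm_integral_le_lintegral_enorm _).trans ?_
    rw [← lintegral_const_mul _ hg.enorm]
    refine setLIntegral_mono (hg.enorm.const_mul _) fun s hs => ?_
    rw [enorm_mul]
    gcongr
    rw [Real.enorm_eq_ofReal_abs]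
    exact ENNReal.ofReal_le_ofReal (h.abs_kernel_le ha hs)
  calc _ ≤ (ENNReal.ofReal ((N + 1) * M) * ∫⁻ s in Ioo (-r) r, ‖g s‖ₑ) ^ 2 := by gcongr
    _ = ENNReal.ofReal ((N + 1) * M) ^ 2 * (∫⁻ s in Ioo (-r) r, ‖g s‖ₑ) ^ 2 := mul_pow _ _ _
    _ ≤ ENNReal.ofReal ((N + 1) * M) ^ 2 * (2 * ∫⁻ s in Ioo (-r) r, ‖g s‖ₑ ^ 2) := by
        gcongr
        refine (sq_lintegral_le _ hg.enorm.aemeasurable).trans ?_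
        rw [Measure.restrict_apply_univ]
        gcongr
        exact h.volume_le
    _ = _ := by ring

/-- The stability constant of the kernel operator. -/
def const (N : ℕ) (M : ℝ) : ℝ≥0∞ := 4 * (1 + 4 * ENNReal.ofReal ((N + 1) * M) ^ 2)

/-- The kernel operator `P` reproduces `T`, so `u - Pu = (u - T) - P(u - T)`, and `P` is bounded in
`L²`. Thus `P`, a fixed linear operator, is as good as any `T` up to a constant. -/
theorem lintegral_sub_kernel_le (h : IsDualFamily N r M ρ) {u : ℝ → ℝ} (hu : Measurable u)
    (hb : ∃ B, ∀ s, |u s| ≤ B) {T : Polynomial ℝ} (hT : T.natDegree ≤ N) :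
    ∫⁻ a in Ioo (-r) r, ‖u a - ∫ s in Ioo (-r) r, polyKernel N ρ a s * u s‖ₑ ^ 2 ≤
      const N M * ∫⁻ a in Ioo (-r) r, ‖u a - T.eval a‖ₑ ^ 2 := by
  set X := ∫⁻ a in Ioo (-r) r, ‖u a - T.eval a‖ₑ ^ 2 with hX
  have hTm : Measurable fun s => T.eval s := T.continuous.measurable
  have hTi : ∀ a, Integrable (fun s => polyKernel N ρ a s * T.eval s)
      (volume.restrict (Ioo (-r) r)) := fun a =>
    ((((h.continuous_kernel.comp (by fun_prop : Continuous fun s : ℝ => (a, s))).mul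
      T.continuous).continuousOn).integrableOn_Icc).mono_set Ioo_subset_Icc_self
  have key : ∀ a ∈ Ioo (-r) r,
      ‖u a - ∫ s in Ioo (-r) r, polyKernel N ρ a s * u s‖ₑ ^ 2 ≤
        4 * (‖u a - T.eval a‖ₑ ^ 2 + 2 * ENNReal.ofReal ((N + 1) * M) ^ 2 * X) := by
    intro a ha
    have e : u a - ∫ s in Ioo (-r) r, polyKernel N ρ a s * u s =
        (u a - T.eval a) - ∫ s in Ioo (-r) r, polyKernel N ρ a s * (u s - T.eval s) := by
      simp only [mul_sub]
      rw [integral_sub (h.integrable_kernel_mul hu hb a) (hTi a), h.reproducing T hT a]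
      ring
    rw [e]
    calc _ ≤ (‖u a - T.eval a‖ₑ +
          ‖∫ s in Ioo (-r) r, polyKernel N ρ a s * (u s - T.eval s)‖ₑ) ^ 2 := by
          gcongr; exact enorm_sub_le
      _ ≤ _ := enn_add_sq_le _ _
      _ ≤ _ := by
          gcongr
          exact h.enorm_integral_kernel_sq_le (hu.sub hTm) ha
  have hm : Measurable fun a => ‖u a - T.eval a‖ₑ ^ 2 := (hu.sub hTm).enorm.pow_const 2
  calc _ ≤ ∫⁻ a in Ioo (-r) r,
        4 * (‖u a - T.eval a‖ₑ ^ 2 + 2 * ENNReal.ofReal ((N + 1) * M) ^ 2 * X) :=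
        setLIntegral_mono ((hm.add_const _).const_mul _) key
    _ = 4 * (X + 2 * ENNReal.ofReal ((N + 1) * M) ^ 2 * X * volume (Ioo (-r) r)) := by
        rw [lintegral_const_mul _ (hm.add_const _), lintegral_add_left hm, setLIntegral_const]
    _ ≤ 4 * (X + 2 * ENNReal.ofReal ((N + 1) * M) ^ 2 * X * 2) := by
        gcongr
        exact h.volume_le
    _ = _ := by rw [const]; ring

/-- With `P_a`, `P_b` the kernel operators in the two variables, `v - P_a P_b v = (v - P_a v) +
P_a(v - P_b v)`. Each term is controlled by one-variable approximation on slices, and no mixed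
derivative is needed. -/
theorem exists_tensor_approx (h : IsDualFamily N r M ρ) {v : ℝ × ℝ → ℝ} (hv : Measurable v)
    (hb : ∃ B, ∀ p, |v p| ≤ B) {X Y : ℝ → ℝ≥0∞} (hX : Measurable X) (hY : Measurable Y)
    (h1 : ∀ b ∈ Ioo (-r) r, ∃ T : Polynomial ℝ, T.natDegree ≤ N ∧
      ∫⁻ a in Ioo (-r) r, ‖v (a, b) - T.eval a‖ₑ ^ 2 ≤ X b)
    (h2 : ∀ a ∈ Ioo (-r) r, ∃ T : Polynomial ℝ, T.natDegree ≤ N ∧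
      ∫⁻ b in Ioo (-r) r, ‖v (a, b) - T.eval b‖ₑ ^ 2 ≤ Y a) :
    ∃ c : ℕ → ℕ → ℝ, ∫⁻ b in Ioo (-r) r, ∫⁻ a in Ioo (-r) r,
      ‖v (a, b) - ∑ i ∈ Finset.range (N + 1), ∑ j ∈ Finset.range (N + 1),
        c i j * (a ^ i * b ^ j)‖ₑ ^ 2 ≤
      const N M ^ 2 * ((∫⁻ b in Ioo (-r) r, X b) + ∫⁻ a in Ioo (-r) r, Y a) := by
  obtain ⟨B, hB⟩ := hb
  have hB0 : 0 ≤ B := (abs_nonneg _).trans (hB (0, 0))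
  set I := Ioo (-r) r with hI
  have hva : ∀ b, Measurable fun a => v (a, b) := fun b => hv.comp (by fun_prop)
  have hvb : ∀ a, Measurable fun b => v (a, b) := fun a => hv.comp (by fun_prop)
  have hm : ∀ j, Measurable fun a => ∫ t in I, ρ j t * v (a, t) := fun j =>
    (StronglyMeasurable.integral_prod_right' (f := fun p : ℝ × ℝ => ρ j p.2 * v p)
      (((h.continuous j).measurable.comp measurable_snd).mul hv).stronglyMeasurable).measurable
  have hbd : ∀ j ≤ N, ∀ a, |∫ t in I, ρ j t * v (a, t)| ≤ M * B * volume.real I := by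
    intro j hj a
    have h0 : volume I < ⊤ := measure_Ioo_lt_top
    rw [← Real.norm_eq_abs]
    refine norm_setIntegral_le_of_norm_le_const h0 fun t ht => ?_
    rw [norm_mul]
    exact mul_le_mul (h.bound j hj t ht) (hB _) (norm_nonneg _) h.nonneg
  -- These are the coefficients of `P_a P_b v`, which has degree at most `N` in each variable;
  -- below, `g = v - P_b v`.
  refine ⟨fun i j => ∫ s in I, ρ i s * ∫ t in I, ρ j t * v (s, t), ?_⟩
  set g : ℝ × ℝ → ℝ := fun p => v p - ∫ t in I, polyKernel N ρ p.2 t * v (p.1, t) with hg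
  have hEe : ∀ a b, ∫ t in I, polyKernel N ρ b t * v (a, t) =
      ∑ j ∈ Finset.range (N + 1), b ^ j * ∫ t in I, ρ j t * v (a, t) := fun a b =>
    h.integral_kernel_mul (hvb a) ⟨B, fun t => hB _⟩ b
  have hgm : Measurable g := by
    simp only [hg, hEe]
    refine hv.sub (Finset.measurable_sum _ fun j _ => ?_)
    exact (measurable_snd.pow_const j).mul ((hm j).comp measurable_fst)
  have hga : ∀ b, Measurable fun s => g (s, b) := fun b => hgm.comp (by fun_prop)
  have hEm : ∀ b, Measurable fun s => ∫ t in I, polyKernel N ρ b t * v (s, t) := fun b => by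
    simp only [hEe]
    exact Finset.measurable_sum _ fun j _ => (hm j).const_mul _
  have hEb : ∀ b, ∃ B', ∀ s, |∫ t in I, polyKernel N ρ b t * v (s, t)| ≤ B' := fun b => by
    refine ⟨∑ j ∈ Finset.range (N + 1), |b| ^ j * (M * B * volume.real I), fun s => ?_⟩
    rw [hEe]
    refine (Finset.abs_sum_le_sum_abs _ _).trans (Finset.sum_le_sum fun j hj => ?_)
    rw [abs_mul, abs_pow]
    gcongr
    exact hbd j (by simpa [Nat.lt_succ_iff] using hj) s
  have hsplit : ∀ a b, v (a, b) - ∑ i ∈ Finset.range (N + 1), ∑ j ∈ Finset.range (N + 1),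
      (∫ s in I, ρ i s * ∫ t in I, ρ j t * v (s, t)) * (a ^ i * b ^ j) =
      (v (a, b) - ∫ s in I, polyKernel N ρ a s * v (s, b)) +
        ∫ s in I, polyKernel N ρ a s * g (s, b) := by
    intro a b
    have e1 : ∫ s in I, polyKernel N ρ a s * g (s, b) =
        (∫ s in I, polyKernel N ρ a s * v (s, b)) -
          ∫ s in I, polyKernel N ρ a s * ∫ t in I, polyKernel N ρ b t * v (s, t) := by
      simp only [hg, mul_sub]
      exact integral_sub (h.integrable_kernel_mul (hva b) ⟨B, fun t => hB _⟩ a)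
        (h.integrable_kernel_mul (hEm b) (hEb b) a)
    rw [e1, h.integral_kernel_mul (hEm b) (hEb b) a]
    have e2 : ∀ i ∈ Finset.range (N + 1), a ^ i * ∫ s in I, ρ i s *
        ∫ t in I, polyKernel N ρ b t * v (s, t) = ∑ j ∈ Finset.range (N + 1),
        (∫ s in I, ρ i s * ∫ t in I, ρ j t * v (s, t)) * (a ^ i * b ^ j) := by
      intro i hi
      simp only [hEe, Finset.mul_sum]
      have hii : ∀ j ∈ Finset.range (N + 1), Integrable
          (fun s => ρ i s * (b ^ j * ∫ t in I, ρ j t * v (s, t))) (volume.restrict I) := by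
        intro j hj
        refine h.integrable_mul ((hm j).const_mul _) ⟨|b| ^ j * (M * B * volume.real I),
          fun s => ?_⟩ (by simpa [Nat.lt_succ_iff] using hi)
        rw [abs_mul, abs_pow]
        gcongr
        exact hbd j (by simpa [Nat.lt_succ_iff] using hj) s
      rw [integral_finsetSum _ hii, Finset.mul_sum]
      refine Finset.sum_congr rfl fun j _ => ?_
      have e3 : ∀ s, ρ i s * (b ^ j * ∫ t in I, ρ j t * v (s, t)) =
        b ^ j * (ρ i s * ∫ t in I, ρ j t * v (s, t)) := fun s => by ring
      simp only [e3]
      rw [integral_const_mul]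
      ring
    rw [Finset.sum_congr rfl e2]
    ring
  have hmE : Measurable fun p : ℝ × ℝ =>
      ‖v (p.2, p.1) - ∫ s in I, polyKernel N ρ p.2 s * v (s, p.1)‖ₑ ^ 2 := by
    refine Measurable.pow_const (Measurable.enorm ?_) 2
    refine (hv.comp measurable_swap).sub ?_
    refine (StronglyMeasurable.integral_prod_right' (f := fun p : (ℝ × ℝ) × ℝ =>
      polyKernel N ρ p.1.2 p.2 * v (p.2, p.1.1)) (Measurable.stronglyMeasurable ?_)).measurable
    exact (h.continuous_kernel.measurable.comp (by fun_prop : Measurable fun p : (ℝ × ℝ) × ℝ =>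
      (p.1.2, p.2))).mul (hv.comp (by fun_prop))
  set κ := ENNReal.ofReal ((N + 1) * M) ^ 2 with hκ
  have hfirst : ∀ b ∈ I, ∫⁻ a in I,
      ‖v (a, b) - ∫ s in I, polyKernel N ρ a s * v (s, b)‖ₑ ^ 2 ≤ const N M * X b := by
    intro b hb
    obtain ⟨T, hT, hTX⟩ := h1 b hb
    exact (h.lintegral_sub_kernel_le (hva b) ⟨B, fun t => hB _⟩ hT).trans (by gcongr)
  have hsecond : ∀ a ∈ I, ∫⁻ b in I, ‖g (a, b)‖ₑ ^ 2 ≤ const N M * Y a := by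
    intro a ha
    obtain ⟨T, hT, hTX⟩ := h2 a ha
    exact (h.lintegral_sub_kernel_le (hvb a) ⟨B, fun t => hB _⟩ hT).trans (by gcongr)
  have hgsq : Measurable fun p : ℝ × ℝ => ‖g p‖ₑ ^ 2 := hgm.enorm.pow_const 2
  have hZ : Measurable fun b => ∫⁻ s in I, ‖g (s, b)‖ₑ ^ 2 :=
    Measurable.lintegral_prod_right' (f := fun p : ℝ × ℝ => ‖g (p.2, p.1)‖ₑ ^ 2)
      (hgsq.comp measurable_swap)
  calc _ ≤ ∫⁻ b in I, 4 * (const N M * X b + 2 * κ * (∫⁻ s in I, ‖g (s, b)‖ₑ ^ 2) * 2) := by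
        refine setLIntegral_mono (((hX.const_mul _).add ((hZ.const_mul _).mul_const _)).const_mul _)
          fun b hb => ?_
        have hmb : Measurable fun a =>
            ‖v (a, b) - ∫ s in I, polyKernel N ρ a s * v (s, b)‖ₑ ^ 2 :=
          hmE.comp (by fun_prop : Measurable fun a : ℝ => (b, a))
        calc _ ≤ ∫⁻ a in I, 4 * (‖v (a, b) - ∫ s in I, polyKernel N ρ a s * v (s, b)‖ₑ ^ 2 +
              2 * κ * ∫⁻ s in I, ‖g (s, b)‖ₑ ^ 2) := by
              refine setLIntegral_mono ((hmb.add_const _).const_mul _) fun a ha => ?_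
              rw [hsplit]
              calc _ ≤ (_ + _) ^ 2 := by gcongr; exact enorm_add_le _ _
                _ ≤ _ := enn_add_sq_le _ _
                _ ≤ _ := by
                  gcongr
                  exact h.enorm_integral_kernel_sq_le (hga b) ha
          _ = 4 * ((∫⁻ a in I, ‖v (a, b) - ∫ s in I, polyKernel N ρ a s * v (s, b)‖ₑ ^ 2) +
              2 * κ * (∫⁻ s in I, ‖g (s, b)‖ₑ ^ 2) * volume I) := by
              rw [lintegral_const_mul _ (hmb.add_const _), lintegral_add_left hmb,
                setLIntegral_const]
          _ ≤ _ := by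
              gcongr
              · exact hfirst b hb
              · exact h.volume_le
    _ = 4 * (const N M * (∫⁻ b in I, X b) +
          2 * κ * (∫⁻ b in I, ∫⁻ s in I, ‖g (s, b)‖ₑ ^ 2) * 2) := by
        rw [← lintegral_const_mul _ hX, ← lintegral_const_mul _ hZ,
          ← lintegral_mul_const _ (hZ.const_mul _), ← lintegral_add_left (hX.const_mul _),
          ← lintegral_const_mul]
        exact (hX.const_mul _).add ((hZ.const_mul _).mul_const _)
    _ ≤ 4 * (const N M * (∫⁻ b in I, X b) +
          2 * κ * (∫⁻ s in I, const N M * Y s) * 2) := by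
        rw [lintegral_lintegral_swap (f := fun b s => ‖g (s, b)‖ₑ ^ 2)
          (hgsq.comp measurable_swap).aemeasurable]
        gcongr 4 * (_ + 2 * κ * ?_ * 2)
        exact setLIntegral_mono (hY.const_mul _) hsecond
    _ = 4 * (const N M * (∫⁻ b in I, X b) + 4 * κ * (const N M * ∫⁻ s in I, Y s)) := by
        rw [lintegral_const_mul _ hY]; ring
    _ ≤ 4 * ((1 + 4 * κ) * (const N M * (∫⁻ b in I, X b)) +
          (1 + 4 * κ) * (const N M * ∫⁻ s in I, Y s)) := by
        refine mul_le_mul' le_rfl (add_le_add ?_ ?_)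
        · exact le_mul_of_one_le_left' le_self_add
        · exact mul_le_mul' le_add_self le_rfl
    _ = _ := by rw [const]; ring

end IsDualFamily

end Tensor

end

section

/-! ### Approximation of compositions with the element map -/

theorem eLpNorm_two_sq {α E : Type*} [MeasurableSpace α] [NormedAddCommGroup E] {μ : Measure α}
    (f : α → E) : eLpNorm f 2 μ ^ 2 = ∫⁻ x, ‖f x‖ₑ ^ 2 ∂μ := by
  rw [eLpNorm_eq_lintegral_rpow_enorm_toReal (by norm_num) (by norm_num), ← ENNReal.rpow_natCast,
    ← ENNReal.rpow_mul]
  norm_num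

theorem eLpNorm_two_le_of_lintegral_sq_le {α E F : Type*} [MeasurableSpace α]
    [NormedAddCommGroup E] [NormedAddCommGroup F] {μ : Measure α} {ν : Measure α} {f : α → E}
    {g : α → F} {c : ℝ≥0∞} (h : ∫⁻ x, ‖f x‖ₑ ^ 2 ∂μ ≤ c ^ 2 * ∫⁻ x, ‖g x‖ₑ ^ 2 ∂ν) :
    eLpNorm f 2 μ ≤ c * eLpNorm g 2 ν := by
  rw [← eLpNorm_two_sq, ← eLpNorm_two_sq, ← mul_pow] at h
  exact (ENNReal.pow_right_strictMono two_ne_zero).le_iff_le.1 h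

theorem measurable_indicator_of_continuousOn {E F : Type*} [TopologicalSpace E]
    [MeasurableSpace E] [BorelSpace E] [TopologicalSpace F] [MeasurableSpace F] [BorelSpace F]
    [Zero F] {U : Set E} (hU : IsOpen U) {f : E → F} (hf : ContinuousOn f U) :
    Measurable (U.indicator f) := by
  classical
  rw [← piecewise_eq_indicator]
  exact hf.measurable_piecewise continuousOn_const hU.measurableSet

theorem iterate_dirDeriv_real (z : ℝ) (φ : ℝ → ℝ) (k : ℕ) :
    (dirDeriv z)^[k] φ = fun x => z ^ k * iteratedDeriv k φ x := by
  induction k with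
  | zero => simp
  | succ k ih =>
    rw [Function.iterate_succ_apply', ih]
    ext x
    rw [dirDeriv, fderiv_eq_smul_deriv, deriv_const_mul_field, iteratedDeriv_succ, smul_eq_mul]
    ring

/-- Bramble–Hilbert in dimension one. The factor `2^(N+1)` bounds `|x - y|^(N+1)` on an interval of
length at most two. -/
theorem exists_polynomial_approx {r : ℝ} (hr0 : 0 < r) (hr : r ≤ 1) {φ : ℝ → ℝ}
    (hφ : ContDiffOn ℝ ∞ φ (Ioo (-r) r)) (N : ℕ) {G : ℝ → ℝ≥0∞} (hG : Measurable G)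
    (h : ∀ p ∈ Ioo (-r) r, ENNReal.ofReal (2 ^ (N + 1) * |iteratedDeriv (N + 1) φ p|) ≤ G p) :
    ∃ T : Polynomial ℝ, T.natDegree ≤ N ∧
      ∫⁻ a in Ioo (-r) r, ‖φ a - T.eval a‖ₑ ^ 2 ≤ 2 * ∫⁻ a in Ioo (-r) r, G a ^ 2 := by
  obtain ⟨y, -, hy⟩ := exists_lintegral_sub_taylorAt_le volume isOpen_Ioo (convex_Ioo (-r) r)
    ⟨0, by simpa using hr0⟩ measure_Ioo_lt_top.ne hφ N hG (fun x hx y hy p hp => by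
      refine le_trans ?_ (h p hp)
      rw [iterate_dirDeriv_real, Real.enorm_eq_ofReal_abs, abs_mul, abs_pow]
      refine ENNReal.ofReal_le_ofReal ?_
      gcongr
      rw [abs_le]
      constructor <;> linarith [hx.1, hx.2, hy.1, hy.2])
  refine ⟨∑ k ∈ Finset.range (N + 1),
    Polynomial.C ((k.factorial : ℝ)⁻¹ * iteratedDeriv k φ y) *
      (Polynomial.X - Polynomial.C y) ^ k, ?_, ?_⟩
  · refine Polynomial.natDegree_sum_le_of_forall_le _ _ fun k hk => ?_
    refine (Polynomial.natDegree_C_mul_le _ _).trans ?_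
    rw [Polynomial.natDegree_pow, Polynomial.natDegree_X_sub_C]
    simpa [Nat.lt_succ_iff] using hk
  · refine le_trans (le_of_eq ?_) (hy.trans (le_of_eq (by simp)))
    refine lintegral_congr fun x => ?_
    congr 3
    rw [taylorAt, Polynomial.eval_finsetSum]
    refine Finset.sum_congr rfl fun k _ => ?_
    rw [iterate_dirDeriv_real]
    simp
    ring

/-! ### The shrunken square as a product of intervals. -/

section Quad

/-- The measurable equivalence of `ℝ × ℝ` with the Euclidean plane. -/
def planeEquiv : ℝ × ℝ ≃ᵐ Sp 2 :=
  MeasurableEquiv.finTwoArrow.symm.trans (MeasurableEquiv.toLp 2 (Fin 2 → ℝ))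

theorem planeEquiv_apply (p : ℝ × ℝ) : planeEquiv p = !₂[p.1, p.2] := rfl

theorem measurePreserving_planeEquiv : MeasurePreserving planeEquiv :=
  (PiLp.volume_preserving_toLp (Fin 2)).comp (volume_preserving_finTwoArrow ℝ).symm

theorem mem_shrink_quad {δ a b : ℝ} :
    !₂[a, b] ∈ RefElement.quad.shrink δ ↔
      a ∈ Ioo (-(1 - δ)) (1 - δ) ∧ b ∈ Ioo (-(1 - δ)) (1 - δ) := by
  simp only [RefElement.shrink, Set.mem_ofPred_eq, Fin.forall_fin_two, mem_Ioo, neg_sub]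
  simp only [Matrix.cons_val_zero, Matrix.cons_val_one]
  rw [show -1 + δ = δ - 1 by ring]
  tauto

theorem lintegral_shrink_quad (δ : ℝ) {H : Sp 2 → ℝ≥0∞} (hH : Measurable H) :
    ∫⁻ x in RefElement.quad.shrink δ, H x =
      ∫⁻ b in Ioo (-(1 - δ)) (1 - δ), ∫⁻ a in Ioo (-(1 - δ)) (1 - δ), H !₂[a, b] := by
  rw [← measurePreserving_planeEquiv.setLIntegral_comp_preimage_emb
    planeEquiv.measurableEmbedding]
  have : planeEquiv ⁻¹' RefElement.quad.shrink δ =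
      Ioo (-(1 - δ)) (1 - δ) ×ˢ Ioo (-(1 - δ)) (1 - δ) := by
    ext ⟨a, b⟩
    rw [mem_preimage, planeEquiv_apply, mem_shrink_quad, mem_prod]
  rw [this, Measure.volume_eq_prod, ← Measure.prod_restrict, lintegral_prod_symm]
  · rfl
  · exact (hH.comp planeEquiv.measurable).aemeasurable

end Quad

/-! ### Approximation of `w ∘ Φ` on shrunken reference elements. -/

section BrambleHilbert

variable {d : ℕ}

/-- The bounds on the derivatives of the element map, as in `IsQuasiRegular`. -/
def DerivBound (K : RefElement d) (m : ℕ) (γ h : ℝ) (Φ : Sp d → Sp d) : Prop :=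
  ∀ α : Fin d → ℕ, K.IsControlled α → 1 ≤ ∑ i, α i → ∑ i, α i ≤ m →
    ∀ y ∈ K.domain, ‖multiDeriv α Φ y‖ ≤ γ * h ^ (∑ i, α i)

/-- Brings the quasi-regularity bounds to the geometric form `D^k` required by the chain rule
estimate. -/
theorem mul_pow_le_mul_pow {γ h : ℝ} (hγ : 1 ≤ γ) (hh : 0 ≤ h) {k : ℕ} (hk : 1 ≤ k) :
    γ * h ^ k ≤ (γ * h) ^ k := by
  rw [mul_pow]
  gcongr
  exact le_self_pow₀ hγ (by omega)

/-- The Bramble–Hilbert majorant must be measurable on the whole space, whereas `Φ` is regular only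
on the domain; cutting off by an indicator repairs this. -/
theorem lintegral_indicator_sq {U : Set (Sp d)} (hU : IsOpen U) (B : ℝ≥0∞) {g : Sp d → ℝ}
    (hg : ContinuousOn g U) :
    Measurable (U.indicator fun p => B * ‖g p‖ₑ) ∧
    ∫⁻ x in U, (U.indicator fun p => B * ‖g p‖ₑ) x ^ 2 = B ^ 2 * ∫⁻ x in U, ‖g x‖ₑ ^ 2 := by
  have hm : Measurable (U.indicator fun p => ‖g p‖ₑ) :=
    measurable_indicator_of_continuousOn hU hg.enorm
  have e : (U.indicator fun p => B * ‖g p‖ₑ) = fun p => B * U.indicator (fun p => ‖g p‖ₑ) p := by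
    ext p
    by_cases hp : p ∈ U <;> simp [hp]
  refine ⟨e ▸ hm.const_mul B, ?_⟩
  simp only [e, mul_pow]
  rw [lintegral_const_mul _ (hm.pow_const 2)]
  congr 1
  exact setLIntegral_congr_fun hU.measurableSet fun x hx => by simp [hx]

theorem exists_approx_simplex (K : RefElement d) (hK : ∀ α, K.IsControlled α) (N : ℕ) {γ : ℝ}
    (hγ : 1 ≤ γ) : ∃ C : ℝ≥0, ∀ (Φ : Sp d → Sp d) (h : ℝ), ContDiffOn ℝ ∞ Φ K.domain → 0 ≤ h →
      DerivBound K (N + 1) γ h Φ → ∀ w : Sp d → ℝ, ContDiff ℝ ∞ w → ∀ δ : ℝ, 0 < δ → δ ≤ 1 / 8 →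
      ∃ p ∈ K.polySpace N, eLpNorm (fun y => w (Φ y) - polyEval p y) 2
        (volume.restrict (K.shrink δ)) ≤ C * ENNReal.ofReal h ^ (N + 1) *
          eLpNorm (fun y => derivSum (N + 1) w (Φ y)) 2 (volume.restrict (K.shrink δ)) := by
  -- Bramble–Hilbert costs `2^d` in the squared norm; the same factor is kept in the norm, which is
  -- cruder but avoids a square root.
  refine ⟨2 ^ d * Real.toNNReal ((N + 1).factorial * (2 * d ^ 2 * γ) ^ (N + 1)),
    fun Φ h hΦ hh hb w hw δ hδ hδ' => ?_⟩
  set U := K.shrink δ with hUdef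
  have hU : IsOpen U := K.isOpen_shrink δ
  have hUK : U ⊆ K.domain := K.shrink_subset_domain hδ
  have hUb : U ⊆ Metric.closedBall 0 d := hUK.trans K.domain_subset_closedBall
  have hΦU := hΦ.mono hUK
  set B : ℝ := (N + 1).factorial * (2 * d ^ 2 * γ * h) ^ (N + 1) with hB
  have hcont : ContinuousOn (fun y => derivSum (N + 1) w (Φ y)) U :=
    (continuous_derivSum (N + 1) hw).comp_continuousOn hΦU.continuousOn
  obtain ⟨hGm, hG⟩ := lintegral_indicator_sq hU (ENNReal.ofReal B) hcont
  obtain ⟨y, hy, hle⟩ := exists_lintegral_sub_taylorAt_le volume hU (K.convex_shrink δ)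
    (K.shrink_nonempty hδ') ((measure_mono hUb).trans_lt measure_closedBall_lt_top).ne
    (hw.comp_contDiffOn hΦU) N hGm (fun x hx y hy p hp => by
      rw [indicator_of_mem hp, Real.enorm_eq_ofReal_abs, Real.enorm_eq_ofReal_abs,
        ← ENNReal.ofReal_mul (by positivity)]
      refine ENNReal.ofReal_le_ofReal ?_
      have hxy : ‖x - y‖ ≤ 2 * d := by
        have h1 := mem_closedBall_zero_iff.1 (hUb hx)
        have h2 := mem_closedBall_zero_iff.1 (hUb hy)
        linarith [norm_sub_le x y]
      -- The constant `2 d² γ h` collects `‖x - y‖ ≤ 2d`, a factor `d` from the expansion into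
      -- coordinates, and the bound on `Φ`.
      have := norm_iterate_dirDeriv_comp_le hU hΦU hw (z := x - y) hp (n := N + 1)
        (D := 2 * d ^ 2 * γ * h) (fun k hk1 hk2 => by
          refine (norm_iterate_dirDeriv_le hU hΦU hp (B := γ * h ^ k) fun α hα => ?_).trans ?_
          · have := hb α (hK α) (hα ▸ hk1) (hα ▸ hk2) p (hUK hp)
            rwa [hα] at this
          · calc _ ≤ (d * (2 * d)) ^ k * (γ * h) ^ k := by
                  gcongr
                  exact mul_pow_le_mul_pow hγ hh hk1
              _ = _ := by rw [← mul_pow]; congr 1; ring)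
      rw [Real.norm_eq_abs] at this
      refine this.trans (le_of_eq ?_)
      rw [abs_of_nonneg (derivSum_nonneg _ _ _), hB]
      ring)
  obtain ⟨p, hp, hpe⟩ := exists_polyEval_eq_taylorAt hU (hw.comp_contDiffOn hΦU) N hy
  refine ⟨p, K.restrictTotalDegree_le N hp, eLpNorm_two_le_of_lintegral_sq_le ?_⟩
  have e : ((2 ^ d * Real.toNNReal ((N + 1).factorial * (2 * d ^ 2 * γ) ^ (N + 1)) : ℝ≥0) : ℝ≥0∞) *
      ENNReal.ofReal h ^ (N + 1) = 2 ^ d * ENNReal.ofReal B := by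
    push_cast
    rw [mul_assoc, ← ENNReal.ofReal_pow hh]
    change _ * (ENNReal.ofReal _ * _) = _
    rw [← ENNReal.ofReal_mul (by positivity), hB]
    congr 2
    ring
  rw [e]
  simp only [hpe]
  refine hle.trans ?_
  rw [hG, finrank_euclideanSpace, Fintype.card_fin, mul_pow, mul_assoc]
  refine mul_le_mul' ?_ le_rfl
  exact le_self_pow (one_le_pow₀ (by norm_num)) two_ne_zero

theorem exists_approx_quad (N : ℕ) {γ : ℝ} (hγ : 1 ≤ γ) :
    ∃ C : ℝ≥0, ∀ (Φ : Sp 2 → Sp 2) (h : ℝ), ContDiffOn ℝ ∞ Φ RefElement.quad.domain → 0 ≤ h →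
      DerivBound RefElement.quad (N + 1) γ h Φ → ∀ w : Sp 2 → ℝ, ContDiff ℝ ∞ w →
      ∀ δ : ℝ, 0 < δ → δ ≤ 1 / 8 →
      ∃ p ∈ RefElement.quad.polySpace N, eLpNorm (fun y => w (Φ y) - polyEval p y) 2
        (volume.restrict (RefElement.quad.shrink δ)) ≤ C * ENNReal.ofReal h ^ (N + 1) *
          eLpNorm (fun y => derivSum (N + 1) w (Φ y)) 2
            (volume.restrict (RefElement.quad.shrink δ)) := by
  obtain ⟨M, hM, hker⟩ := exists_reproducing N
  -- The squared error is at most `const² · (2 + 2) B² ∫ |derivSum w ∘ Φ|²`, one `2` per coordinate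
  -- direction, hence the leading factor `2 = √4`.
  refine ⟨2 * Real.toNNReal (4 * (1 + 4 * ((N + 1) * M) ^ 2)) *
    Real.toNNReal (2 ^ (N + 1) * ((N + 1).factorial * γ ^ (N + 1))),
    fun Φ h hΦ hh hb w hw δ hδ hδ' => ?_⟩
  set K := RefElement.quad
  set U := K.shrink δ with hUdef
  have hU : IsOpen U := K.isOpen_shrink δ
  have hUK : U ⊆ K.domain := K.shrink_subset_domain hδ
  have hΦU := hΦ.mono hUK
  set r := 1 - δ with hr
  have hr0 : 0 < r := by linarith
  have hr1 : r ≤ 1 := by linarith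
  obtain ⟨ρ, hρ1, hρ2, hρ3⟩ := hker r ⟨by linarith, hr1⟩
  have hdual : IsDualFamily N r M ρ := ⟨hr1, hM, hρ1, hρ2, hρ3⟩
  set B : ℝ := 2 ^ (N + 1) * ((N + 1).factorial * (γ * h) ^ (N + 1)) with hB
  have hcont : ContinuousOn (fun y => derivSum (N + 1) w (Φ y)) U :=
    (continuous_derivSum (N + 1) hw).comp_continuousOn hΦU.continuousOn
  obtain ⟨hGm, hG⟩ := lintegral_indicator_sq hU (ENNReal.ofReal B) hcont
  set G := U.indicator fun p => ENNReal.ofReal B * ‖derivSum (N + 1) w (Φ p)‖ₑ with hGdef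
  set f : Sp 2 → ℝ := fun y => w (Φ y) with hf
  have hfU : ContDiffOn ℝ ∞ f U := hw.comp_contDiffOn hΦU
  -- The only derivatives of `Φ` used for the square are the pure ones, along the coordinate axes.
  have hpure : ∀ i : Fin 2, ∀ p ∈ U, ENNReal.ofReal (2 ^ (N + 1) *
      |(dirDeriv (EuclideanSpace.single i 1))^[N + 1] f p|) ≤ G p := by
    intro i p hp
    rw [hGdef, indicator_of_mem hp, Real.enorm_eq_ofReal_abs, ← ENNReal.ofReal_mul (by positivity)]
    refine ENNReal.ofReal_le_ofReal ?_
    have := norm_iterate_dirDeriv_comp_le hU hΦU hw (z := EuclideanSpace.single i 1) hp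
      (n := N + 1) (D := γ * h) (fun k hk1 hk2 => by
        rw [← multiDeriv_single hU hΦU i k hp]
        have hs : ∑ j, (Pi.single i k : Fin 2 → ℕ) j = k := by simp
        have := hb (Pi.single i k) ⟨i, k, rfl⟩ (hs.symm ▸ hk1) (hs.symm ▸ hk2) p (hUK hp)
        rw [hs] at this
        exact this.trans (mul_pow_le_mul_pow hγ hh hk1))
    rw [Real.norm_eq_abs] at this
    rw [abs_of_nonneg (derivSum_nonneg _ _ _), hB]
    calc _ ≤ 2 ^ (N + 1) *
          ((N + 1).factorial * derivSum (N + 1) w (Φ p) * (γ * h) ^ (N + 1)) := by gcongr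
      _ = _ := by ring
  have hlinea : ∀ b a : ℝ, !₂[a, b] = !₂[0, b] + a • EuclideanSpace.single (0 : Fin 2) (1 : ℝ) := by
    intro b a
    ext i
    fin_cases i <;> simp
  have hlineb : ∀ a b : ℝ, !₂[a, b] = !₂[a, 0] + b • EuclideanSpace.single (1 : Fin 2) (1 : ℝ) := by
    intro a b
    ext i
    fin_cases i <;> simp
  have hmeas1 : Measurable fun p : ℝ × ℝ => (!₂[p.1, p.2] : Sp 2) := planeEquiv.measurable
  have hpa : ∀ b, Measurable fun a : ℝ => (!₂[a, b] : Sp 2) := fun b =>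
    hmeas1.comp (by fun_prop : Measurable fun a : ℝ => (a, b))
  have hpb : ∀ a, Measurable fun b : ℝ => (!₂[a, b] : Sp 2) := fun a =>
    hmeas1.comp (by fun_prop : Measurable fun b : ℝ => (a, b))
  -- the truncated function is bounded and measurable
  have hvm : Measurable (U.indicator f) := measurable_indicator_of_continuousOn hU hfU.continuousOn
  have hvb : ∃ A, ∀ p : ℝ × ℝ, |U.indicator f !₂[p.1, p.2]| ≤ A := by
    obtain ⟨A, hA⟩ := (K.isCompact_closedShrink hδ.le).exists_bound_of_continuousOn
      ((hw.continuous.comp_continuousOn hΦ.continuousOn).mono (K.closedShrink_subset_domain hδ))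
    refine ⟨max A 0, fun p => ?_⟩
    by_cases hp : !₂[p.1, p.2] ∈ U
    · rw [indicator_of_mem hp]
      exact (hA _ (K.shrink_subset_closedShrink δ hp)).trans (le_max_left _ _)
    · rw [indicator_of_notMem hp, abs_zero]
      exact le_max_right _ _
  obtain ⟨c, hc⟩ := hdual.exists_tensor_approx (v := fun p => U.indicator f !₂[p.1, p.2])
    (X := fun b => 2 * ∫⁻ a in Ioo (-r) r, G !₂[a, b] ^ 2)
    (Y := fun a => 2 * ∫⁻ b in Ioo (-r) r, G !₂[a, b] ^ 2)
    (hvm.comp hmeas1) hvb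
    ((Measurable.lintegral_prod_right' (f := fun p : ℝ × ℝ => G !₂[p.2, p.1] ^ 2)
      ((hGm.pow_const 2).comp (hmeas1.comp measurable_swap))).const_mul 2)
    ((Measurable.lintegral_prod_right' (f := fun p : ℝ × ℝ => G !₂[p.1, p.2] ^ 2)
      ((hGm.pow_const 2).comp hmeas1)).const_mul 2)
    (fun b hb => by
      have hmem : ∀ a ∈ Ioo (-r) r, !₂[0, b] + a • EuclideanSpace.single (0 : Fin 2) (1 : ℝ) ∈ U :=
        fun a ha => hlinea b a ▸ mem_shrink_quad.2 ⟨ha, hb⟩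
      have hs : ContDiffOn ℝ ∞ (fun a : ℝ => f (!₂[0, b] + a • EuclideanSpace.single 0 1))
          (Ioo (-r) r) := hfU.comp (by fun_prop) hmem
      obtain ⟨T, hT, hTle⟩ := exists_polynomial_approx hr0 hr1 hs N
        (G := fun a => G !₂[a, b]) (hGm.comp (hpa b)) (fun p hp => by
          rw [iteratedDeriv_comp_line hU hfU _ _ _ _ (hmem p hp), hlinea b p]
          exact hpure 0 _ (hmem p hp))
      refine ⟨T, hT, le_trans (le_of_eq ?_) hTle⟩
      refine setLIntegral_congr_fun measurableSet_Ioo fun a ha => ?_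
      simp only
      rw [hlinea b a, indicator_of_mem (hmem a ha)])
    (fun a ha => by
      have hmem : ∀ b ∈ Ioo (-r) r, !₂[a, 0] + b • EuclideanSpace.single (1 : Fin 2) (1 : ℝ) ∈ U :=
        fun b hb => hlineb a b ▸ mem_shrink_quad.2 ⟨ha, hb⟩
      have hs : ContDiffOn ℝ ∞ (fun b : ℝ => f (!₂[a, 0] + b • EuclideanSpace.single 1 1))
          (Ioo (-r) r) := hfU.comp (by fun_prop) hmem
      obtain ⟨T, hT, hTle⟩ := exists_polynomial_approx hr0 hr1 hs N
        (G := fun b => G !₂[a, b]) (hGm.comp (hpb a)) (fun p hp => by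
          rw [iteratedDeriv_comp_line hU hfU _ _ _ _ (hmem p hp), hlineb a p]
          exact hpure 1 _ (hmem p hp))
      refine ⟨T, hT, le_trans (le_of_eq ?_) hTle⟩
      refine setLIntegral_congr_fun measurableSet_Ioo fun b hb => ?_
      simp only
      rw [hlineb a b, indicator_of_mem (hmem b hb)])
  refine ⟨∑ i ∈ Finset.range (N + 1), ∑ j ∈ Finset.range (N + 1),
    MvPolynomial.monomial (Finsupp.equivFunOnFinite.symm ![i, j]) (c i j), ?_, ?_⟩
  · refine Submodule.sum_mem _ fun i hi => Submodule.sum_mem _ fun j hj => ?_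
    refine (MvPolynomial.monomial_mem_restrictSupport ℝ).2 (Or.inl fun l => ?_)
    rw [Finset.mem_range, Nat.lt_succ_iff] at hi hj
    fin_cases l <;> simpa
  set P : MvPolynomial (Fin 2) ℝ := ∑ i ∈ Finset.range (N + 1), ∑ j ∈ Finset.range (N + 1),
    MvPolynomial.monomial (Finsupp.equivFunOnFinite.symm ![i, j]) (c i j) with hP
  have hPe : ∀ a b : ℝ, polyEval P !₂[a, b] = ∑ i ∈ Finset.range (N + 1),
      ∑ j ∈ Finset.range (N + 1), c i j * (a ^ i * b ^ j) := by
    intro a b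
    simp only [polyEval, hP, map_sum]
    refine Finset.sum_congr rfl fun i _ => Finset.sum_congr rfl fun j _ => ?_
    rw [MvPolynomial.eval_monomial, Finsupp.prod_fintype _ _ (by simp), Fin.prod_univ_two]
    simp
  refine eLpNorm_two_le_of_lintegral_sq_le ?_
  have hconst : ((Real.toNNReal (4 * (1 + 4 * ((N + 1) * M) ^ 2)) : ℝ≥0) : ℝ≥0∞) =
      IsDualFamily.const N M := by
    change ENNReal.ofReal _ = _
    rw [IsDualFamily.const, ENNReal.ofReal_mul (by norm_num), ENNReal.ofReal_add (by norm_num)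
      (by positivity), ENNReal.ofReal_mul (by norm_num), ENNReal.ofReal_pow (by positivity)]
    norm_num
  have e : ((2 * Real.toNNReal (4 * (1 + 4 * ((N + 1) * M) ^ 2)) *
      Real.toNNReal (2 ^ (N + 1) * ((N + 1).factorial * γ ^ (N + 1))) : ℝ≥0) : ℝ≥0∞) *
      ENNReal.ofReal h ^ (N + 1) = 2 * IsDualFamily.const N M * ENNReal.ofReal B := by
    push_cast
    rw [hconst, mul_assoc, ← ENNReal.ofReal_pow hh]
    congr 1
    change (ENNReal.ofReal _ * _) = _
    rw [← ENNReal.ofReal_mul (by positivity), hB]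
    congr 1
    ring
  rw [e]
  have hGsq := hGm.pow_const 2
  have hX : ∫⁻ b in Ioo (-r) r, 2 * ∫⁻ a in Ioo (-r) r, G !₂[a, b] ^ 2 =
      2 * ∫⁻ x in U, G x ^ 2 := by
    rw [lintegral_shrink_quad δ hGsq, lintegral_const_mul]
    exact Measurable.lintegral_prod_right' (f := fun p : ℝ × ℝ => G !₂[p.2, p.1] ^ 2)
      (hGsq.comp (hmeas1.comp measurable_swap))
  have hY : ∫⁻ a in Ioo (-r) r, 2 * ∫⁻ b in Ioo (-r) r, G !₂[a, b] ^ 2 =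
      2 * ∫⁻ x in U, G x ^ 2 := by
    rw [lintegral_shrink_quad δ hGsq, lintegral_const_mul, lintegral_lintegral_swap]
    · exact (hGsq.comp hmeas1).aemeasurable
    · exact Measurable.lintegral_prod_right' (f := fun p : ℝ × ℝ => G !₂[p.1, p.2] ^ 2)
        (hGsq.comp hmeas1)
  calc ∫⁻ x in U, ‖f x - polyEval P x‖ₑ ^ 2
      = ∫⁻ x in U, ‖U.indicator f x - polyEval P x‖ₑ ^ 2 :=
        setLIntegral_congr_fun hU.measurableSet fun x hx => by simp only [indicator_of_mem hx]
    _ = _ := lintegral_shrink_quad δ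
        ((hvm.sub (continuous_polyEval P).measurable).enorm.pow_const 2)
    _ ≤ _ := by
        simp only [hPe]
        exact hc
    _ = (2 * IsDualFamily.const N M * ENNReal.ofReal B) ^ 2 *
          ∫⁻ x in U, ‖derivSum (N + 1) w (Φ x)‖ₑ ^ 2 := by
        rw [hX, hY, hG]
        ring

/-- Approximation of a smooth function composed with the element map, away from the boundary. -/
theorem exists_approx (K : RefElement d) (N : ℕ) {γ : ℝ}
    (hγ : 1 ≤ γ) : ∃ C : ℝ≥0, ∀ (Φ : Sp d → Sp d) (h : ℝ), ContDiffOn ℝ ∞ Φ K.domain → 0 ≤ h →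
      DerivBound K (N + 1) γ h Φ → ∀ w : Sp d → ℝ, ContDiff ℝ ∞ w → ∀ δ : ℝ, 0 < δ → δ ≤ 1 / 8 →
      ∃ p ∈ K.polySpace N, eLpNorm (fun y => w (Φ y) - polyEval p y) 2
        (volume.restrict (K.shrink δ)) ≤ C * ENNReal.ofReal h ^ (N + 1) *
          eLpNorm (fun y => derivSum (N + 1) w (Φ y)) 2 (volume.restrict (K.shrink δ)) := by
  cases K
  · exact exists_approx_quad N hγ
  · exact exists_approx_simplex .tri (fun _ => trivial) N hγ
  · exact exists_approx_simplex .tet (fun _ => trivial) N hγ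

end BrambleHilbert

end

section

/-! ### Mollification of Sobolev functions -/

variable {d : ℕ}

/-! ### Uniqueness of weak derivatives. -/

section WeakDeriv

/-- The fundamental lemma of the calculus of variations. It is needed because `weakDeriv` is an
arbitrary choice, possibly different from the representative known to lie in `L^p`. -/
theorem HasWeakDeriv.ae_eq {Ω : Set (Sp d)} (hΩ : IsOpen Ω) {α : Fin d → ℕ} {u g g' : Sp d → ℝ}
    (h : HasWeakDeriv Ω α u g) (h' : HasWeakDeriv Ω α u g') : g =ᵐ[volume.restrict Ω] g' := by
  have hint : ∀ {f : Sp d → ℝ}, LocallyIntegrableOn f Ω → ∀ φ : Sp d → ℝ, Continuous φ →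
      HasCompactSupport φ → tsupport φ ⊆ Ω → Integrable (fun x => f x * φ x) := by
    intro f hf φ hφ hc hs
    have h1 : IntegrableOn (fun x => f x * φ x) (tsupport φ) :=
      (hf.integrableOn_compact_subset hs hc).mul_continuousOn hφ.continuousOn hc
    refine h1.integrable_of_forall_notMem_eq_zero fun x hx => ?_
    rw [image_eq_zero_of_notMem_tsupport hx, mul_zero]
  have key := hΩ.ae_eq_zero_of_integral_contDiff_smul_eq_zero (μ := volume)
    (h.locallyIntegrableOn_deriv.sub h'.locallyIntegrableOn_deriv) fun φ hφ hc hs => by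
      have e1 := h.integral_eq φ hφ hc hs
      rw [h'.integral_eq φ hφ hc hs] at e1
      have e2 := mul_left_cancel₀ (pow_ne_zero _ (by norm_num)) e1
      have hset : ∀ f : Sp d → ℝ, ∫ x in Ω, f x * φ x = ∫ x, f x * φ x := fun f =>
        setIntegral_eq_integral_of_forall_compl_eq_zero fun x hx => by
          rw [image_eq_zero_of_notMem_tsupport fun h => hx (hs h), mul_zero]
      rw [hset, hset] at e2
      calc ∫ x, φ x • (g - g') x = ∫ x, (g x * φ x - g' x * φ x) := by
            refine integral_congr_ae (ae_of_all _ fun x => ?_)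
            simp only [Pi.sub_apply, smul_eq_mul]
            ring
        _ = 0 := by
            rw [integral_sub (hint h.locallyIntegrableOn_deriv φ hφ.continuous hc hs)
              (hint h'.locallyIntegrableOn_deriv φ hφ.continuous hc hs), e2, sub_self]
  rw [Filter.EventuallyEq, ae_restrict_iff' hΩ.measurableSet]
  filter_upwards [key] with x hx hxΩ
  exact sub_eq_zero.1 (hx hxΩ)

theorem hasWeakDeriv_weakDeriv {Ω : Set (Sp d)} {α : Fin d → ℕ} {u : Sp d → ℝ}
    (h : ∃ g, HasWeakDeriv Ω α u g) : HasWeakDeriv Ω α u (weakDeriv Ω α u) := by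
  rw [weakDeriv, dif_pos h]
  exact h.choose_spec

theorem hasWeakDeriv_zero {Ω : Set (Sp d)} {u : Sp d → ℝ} (h : LocallyIntegrableOn u Ω) :
    HasWeakDeriv Ω 0 u u := by
  refine ⟨h, h, fun φ _ _ _ => ?_⟩
  have : multiDeriv 0 φ = φ := by
    rw [multiDeriv_eq_listDeriv]
    have : multiList (0 : Fin d → ℕ) = [] :=
      List.eq_nil_of_length_eq_zero (by rw [length_multiList]; simp)
    rw [this]
    rfl
  simp [this]

end WeakDeriv

/-! ### Mollifiers: derivatives, norm bounds, convergence. -/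

section Convolution

open scoped Convolution

open ContinuousLinearMap in
theorem partialDeriv_convolution {ψ V : Sp d → ℝ} (hψ : ContDiff ℝ ∞ ψ)
    (hc : HasCompactSupport ψ) (hV : LocallyIntegrable V) (i : Fin d) :
    partialDeriv i (ψ ⋆[lsmul ℝ ℝ, volume] V) = (partialDeriv i ψ) ⋆[lsmul ℝ ℝ, volume] V := by
  ext x
  have h1 : ContDiff ℝ 1 ψ := hψ.of_le (by exact_mod_cast le_top)
  have hex := (hc.fderiv (𝕜 := ℝ)).convolutionExists_left ((lsmul ℝ ℝ).precompL (Sp d))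
    (h1.continuous_fderiv one_ne_zero) hV x
  rw [partialDeriv, (hc.hasFDerivAt_convolution_left (lsmul ℝ ℝ) h1 hV x).fderiv, convolution_def,
    ContinuousLinearMap.integral_apply hex.integrable]
  rfl

theorem contDiff_listDeriv {F : Type*} [NormedAddCommGroup F] [NormedSpace ℝ F] {ψ : Sp d → F}
    (hψ : ContDiff ℝ ∞ ψ) (L : List (Fin d)) : ContDiff ℝ ∞ (listDeriv L ψ) :=
  contDiffOn_univ.1 (contDiffOn_listDeriv isOpen_univ hψ.contDiffOn L)

theorem hasCompactSupport_listDeriv {ψ : Sp d → ℝ} (hc : HasCompactSupport ψ)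
    (L : List (Fin d)) : HasCompactSupport (listDeriv L ψ) := by
  induction L with
  | nil => exact hc
  | cons i L ih => exact ih.fderiv_apply (𝕜 := ℝ) (EuclideanSpace.single i 1)

open ContinuousLinearMap in
theorem listDeriv_convolution {ψ V : Sp d → ℝ} (hψ : ContDiff ℝ ∞ ψ)
    (hc : HasCompactSupport ψ) (hV : LocallyIntegrable V) (L : List (Fin d)) :
    listDeriv L (ψ ⋆[lsmul ℝ ℝ, volume] V) = (listDeriv L ψ) ⋆[lsmul ℝ ℝ, volume] V := by
  induction L with
  | nil => rfl
  | cons i L ih =>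
    rw [listDeriv_cons, ih, partialDeriv_convolution (contDiff_listDeriv hψ L)
      (hasCompactSupport_listDeriv hc L) hV, listDeriv_cons]

theorem listDeriv_const_sub {ψ : Sp d → ℝ} (hψ : ContDiff ℝ ∞ ψ) (x : Sp d) (L : List (Fin d)) :
    listDeriv L (fun y => ψ (x - y)) = fun y => (-1) ^ L.length * listDeriv L ψ (x - y) := by
  induction L with
  | nil => simp [listDeriv]
  | cons i L ih =>
    ext y
    have hd : HasFDerivAt (listDeriv L ψ) (fderiv ℝ (listDeriv L ψ) (x - y)) (x - y) :=
      ((contDiff_listDeriv hψ L).differentiable (by simp) _).hasFDerivAt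
    have hs : HasFDerivAt (fun y : Sp d => x - y) (-ContinuousLinearMap.id ℝ (Sp d)) y :=
      (hasFDerivAt_id y).const_sub x
    have := ((hd.comp y hs).const_mul ((-1) ^ L.length)).fderiv
    rw [listDeriv_cons, ih, partialDeriv]
    refine (congrArg (fun T => T (EuclideanSpace.single i 1)) this).trans ?_
    simp [listDeriv_cons, partialDeriv, pow_succ]

variable (η : ContDiffBump (0 : Sp d)) (Ω : Set (Sp d)) (u : Sp d → ℝ)

/-- The mollification of the restriction of `u` to `Ω`. -/
def mollify : Sp d → ℝ :=
  (η.normed volume) ⋆[ContinuousLinearMap.lsmul ℝ ℝ, volume] (Ω.indicator u)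

theorem mollify_apply (x : Sp d) : mollify η Ω u x =
    ∫ t, η.normed volume (x - t) * Ω.indicator u t := convolution_lsmul_swap (𝕜 := ℝ)

variable {Ω u}

theorem contDiff_mollify (hΩ : MeasurableSet Ω) (hu : IntegrableOn u Ω) :
    ContDiff ℝ ∞ (mollify η Ω u) :=
  η.hasCompactSupport_normed.contDiff_convolution_left _ η.contDiff_normed
    (hu.integrable_indicator hΩ).locallyIntegrable

/-- Derivatives fall on the kernel, and `y ↦ η(x - y)` is an admissible test function because its
support lies in the ball around `x`, hence in `Ω`. The sign from reflecting the kernel cancels the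
sign in the definition of a weak derivative. -/
theorem multiDeriv_mollify (hΩ : MeasurableSet Ω) (hu : IntegrableOn u Ω) {α : Fin d → ℕ}
    {g : Sp d → ℝ} (h : HasWeakDeriv Ω α u g) {x : Sp d}
    (hx : Metric.closedBall x η.rOut ⊆ Ω) :
    multiDeriv α (mollify η Ω u) x = mollify η Ω g x := by
  have hη : ContDiff ℝ ∞ (η.normed volume) := η.contDiff_normed
  set φ : Sp d → ℝ := fun y => η.normed volume (x - y) with hφ
  have hφs : ContDiff ℝ ∞ φ := hη.comp (by fun_prop)
  have hsupp : tsupport φ ⊆ Metric.closedBall x η.rOut := by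
    refine closure_minimal (fun y hy => ?_) Metric.isClosed_closedBall
    have : x - y ∈ Function.support (η.normed volume) := hy
    rw [η.support_normed_eq, mem_ball_zero_iff] at this
    rw [Metric.mem_closedBall, dist_comm, dist_eq_norm]
    exact this.le
  have hφc : HasCompactSupport φ :=
    (isCompact_closedBall x η.rOut).of_isClosed_subset (isClosed_tsupport φ) hsupp
  have key := h.integral_eq φ hφs hφc (hsupp.trans hx)
  rw [multiDeriv_eq_listDeriv, hφ, listDeriv_const_sub hη, length_multiList] at key
  have e : ∀ t, u t * ((-1) ^ (∑ i, α i) * listDeriv (multiList α) (η.normed volume) (x - t)) =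
      (-1) ^ (∑ i, α i) * (listDeriv (multiList α) (η.normed volume) (x - t) * u t) := fun t => by
    ring
  simp only [e] at key
  rw [integral_const_mul] at key
  have key2 := mul_left_cancel₀ (pow_ne_zero _ (by norm_num)) key
  rw [multiDeriv_eq_listDeriv, mollify, listDeriv_convolution hη η.hasCompactSupport_normed
    (hu.integrable_indicator hΩ).locallyIntegrable, convolution_lsmul_swap, mollify_apply]
  have hind : ∀ k f : Sp d → ℝ, ∫ t, k t * Ω.indicator f t = ∫ t in Ω, k t * f t := by
    intro k f
    rw [← integral_indicator hΩ]
    congr 1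
    ext t
    by_cases ht : t ∈ Ω <;> simp [ht]
  simp only [smul_eq_mul]
  rw [hind, hind, key2]
  exact integral_congr_ae (ae_of_all _ fun t => mul_comm _ _)

theorem lintegral_enorm_normed : ∫⁻ t, ‖η.normed volume t‖ₑ = 1 := by
  have h := ofReal_integral_eq_lintegral_ofReal (η.integrable_normed (μ := volume))
    (ae_of_all _ η.nonneg_normed)
  rw [η.integral_normed, ENNReal.ofReal_one] at h
  rw [h]
  refine lintegral_congr fun t => ?_
  rw [Real.enorm_of_nonneg (η.nonneg_normed t)]

theorem lintegral_enorm_normed_sub_left (x : Sp d) :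
    ∫⁻ t, ‖η.normed volume (x - t)‖ₑ = 1 := by
  rw [← lintegral_enorm_normed η]
  exact lintegral_sub_left_eq_self (fun t => ‖η.normed volume t‖ₑ) x

theorem lintegral_enorm_normed_sub_right (t : Sp d) :
    ∫⁻ x, ‖η.normed volume (x - t)‖ₑ = 1 := by
  rw [← lintegral_enorm_normed η]
  exact lintegral_sub_right_eq_self (fun t => ‖η.normed volume t‖ₑ) t

theorem enorm_mollify_le (x : Sp d) : ‖mollify η Ω u x‖ₑ ≤
    ∫⁻ t, ‖η.normed volume (x - t)‖ₑ * ‖Ω.indicator u t‖ₑ := by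
  rw [mollify_apply]
  refine (enorm_integral_le_lintegral_enorm _).trans (le_of_eq ?_)
  simp only [enorm_mul]

theorem eLpNorm_top_indicator (hΩ : MeasurableSet Ω) (p : ℝ≥0∞) :
    eLpNorm (Ω.indicator u) p volume = eLpNorm u p (volume.restrict Ω) :=
  eLpNorm_indicator_eq_eLpNorm_restrict hΩ

theorem enorm_mollify_le_eLpNorm_top (hΩ : MeasurableSet Ω) (x : Sp d) :
    ‖mollify η Ω u x‖ₑ ≤ eLpNorm u ⊤ (volume.restrict Ω) := by
  have hk : Measurable fun t => ‖η.normed volume (x - t)‖ₑ :=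
    (η.continuous_normed.measurable.comp (measurable_const.sub measurable_id)).enorm
  calc _ ≤ ∫⁻ t, ‖η.normed volume (x - t)‖ₑ * ‖Ω.indicator u t‖ₑ := enorm_mollify_le η x
    _ ≤ ∫⁻ t, ‖η.normed volume (x - t)‖ₑ * eLpNorm (Ω.indicator u) ⊤ volume := by
        refine lintegral_mono_ae ?_
        rw [eLpNorm_exponent_top]
        filter_upwards [ae_le_eLpNormEssSup (f := Ω.indicator u) (μ := volume)] with t ht
        gcongr
    _ = eLpNorm u ⊤ (volume.restrict Ω) := by
        rw [lintegral_mul_const _ hk, lintegral_enorm_normed_sub_left, one_mul,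
          eLpNorm_top_indicator hΩ]

/-- Jensen's inequality for the square, as Cauchy–Schwarz for the probability measure with density
`k`. -/
theorem sq_lintegral_mul_le {α : Type*} [MeasurableSpace α] (μ : Measure α) {k g : α → ℝ≥0∞}
    (hk : Measurable k) (h1 : ∫⁻ t, k t ∂μ = 1) (hg : AEMeasurable g μ) :
    (∫⁻ t, k t * g t ∂μ) ^ 2 ≤ ∫⁻ t, k t * g t ^ 2 ∂μ := by
  have e : ∀ f : α → ℝ≥0∞, AEMeasurable f μ →
      ∫⁻ t, f t ∂(μ.withDensity k) = ∫⁻ t, k t * f t ∂μ := fun f hf =>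
    lintegral_withDensity_eq_lintegral_mul₀ hk.aemeasurable hf
  rw [← e _ hg, ← e _ (hg.pow_const 2)]
  refine (sq_lintegral_le _ (hg.mono_ac (withDensity_absolutelyContinuous _ _))).trans ?_
  rw [withDensity_apply _ MeasurableSet.univ, Measure.restrict_univ, h1, one_mul]

/-- Young's inequality for a kernel of mass one: Jensen pointwise, then Tonelli. -/
theorem eLpNorm_mollify_le (hΩ : MeasurableSet Ω)
    (hu : AEStronglyMeasurable u (volume.restrict Ω)) :
    eLpNorm (mollify η Ω u) 2 volume ≤ eLpNorm u 2 (volume.restrict Ω) := by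
  set V := Ω.indicator u with hV
  have hVm : AEMeasurable (fun t => ‖V t‖ₑ) volume :=
    ((aestronglyMeasurable_indicator_iff hΩ).2 hu).enorm
  have hk2 : Measurable fun p : Sp d × Sp d => ‖η.normed volume (p.1 - p.2)‖ₑ :=
    (η.continuous_normed.measurable.comp (measurable_fst.sub measurable_snd)).enorm
  have hk : ∀ x, Measurable fun t => ‖η.normed volume (x - t)‖ₑ := fun x =>
    (η.continuous_normed.measurable.comp (measurable_const.sub measurable_id)).enorm
  have h1 : ∀ x, ‖mollify η Ω u x‖ₑ ^ 2 ≤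
      ∫⁻ t, ‖η.normed volume (x - t)‖ₑ * ‖V t‖ₑ ^ 2 := by
    intro x
    refine le_trans ?_ (sq_lintegral_mul_le volume (hk x) (lintegral_enorm_normed_sub_left η x) hVm)
    gcongr
    exact enorm_mollify_le η x
  rw [← eLpNorm_top_indicator hΩ, ← one_mul (eLpNorm V 2 volume)]
  refine eLpNorm_two_le_of_lintegral_sq_le ?_
  rw [one_pow, one_mul]
  calc _ ≤ ∫⁻ x, ∫⁻ t, ‖η.normed volume (x - t)‖ₑ * ‖V t‖ₑ ^ 2 := lintegral_mono h1
    _ = ∫⁻ t, ∫⁻ x, ‖η.normed volume (x - t)‖ₑ * ‖V t‖ₑ ^ 2 := by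
        rw [lintegral_lintegral_swap]
        exact hk2.aemeasurable.mul (hVm.pow_const 2).comp_snd
    _ = ∫⁻ t, ‖V t‖ₑ ^ 2 := by
        refine lintegral_congr fun t => ?_
        rw [lintegral_mul_const, lintegral_enorm_normed_sub_right, one_mul]
        exact (η.continuous_normed.measurable.comp (measurable_id.sub measurable_const)).enorm

/-- The mollifiers of radius `1 / (n + 1)`. -/
def bump (d n : ℕ) : ContDiffBump (0 : Sp d) where
  rIn := 1 / (2 * (n + 1))
  rOut := 1 / (n + 1)
  rIn_pos := by positivity
  rIn_lt_rOut := by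
    rw [div_lt_div_iff₀ (by positivity) (by positivity)]
    have : (0 : ℝ) ≤ n := Nat.cast_nonneg n
    linarith

theorem tendsto_mollify (hΩ : MeasurableSet Ω) (hu : IntegrableOn u Ω) :
    ∀ᵐ x ∂volume.restrict Ω,
      Filter.Tendsto (fun n => mollify (bump d n) Ω u x) Filter.atTop (nhds (u x)) := by
  -- Almost everywhere convergence is Lebesgue differentiation, which needs a bounded ratio of outer
  -- to inner radius; for `bump` it is exactly `2`.
  have h := ContDiffBump.ae_convolution_tendsto_right_of_locallyIntegrable (μ := volume)
    (φ := bump d) (l := Filter.atTop) (K := 2) tendsto_one_div_add_atTop_nhds_zero_nat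
    (Filter.Eventually.of_forall fun n => by
      have : (0 : ℝ) < n + 1 := by positivity
      simp only [bump]
      field_simp
      norm_num) (hu.integrable_indicator hΩ).locallyIntegrable
  filter_upwards [ae_restrict_of_ae h, ae_restrict_mem hΩ] with x hx hxΩ
  rwa [indicator_of_mem hxΩ] at hx

end Convolution

/-! ### Derivatives of mollified functions in terms of Sobolev norms. -/

section SobolevBounds

theorem derivSum_le_sum {w : Sp d → ℝ} (hw : ContDiff ℝ ∞ w) (s : ℕ) (x : Sp d) :
    derivSum s w x ≤ ∑ k ∈ Finset.range (s + 1), ∑ I : Fin k → Fin d,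
      ‖multiDeriv (fun i => (List.ofFn I).count i) w x‖ := by
  refine Finset.sum_le_sum fun k _ => (norm_iteratedFDeriv_le_sum hw k x).trans (le_of_eq ?_)
  refine Finset.sum_congr rfl fun I _ => ?_
  rw [eqOn_listDeriv_multiDeriv isOpen_univ hw.contDiffOn _ (mem_univ x)]

theorem count_mem_multiIndices {s k : ℕ} (hk : k ∈ Finset.range (s + 1)) (I : Fin k → Fin d) :
    (fun i => (List.ofFn I).count i) ∈ multiIndices d s := by
  have hsum : ∑ i, (List.ofFn I).count i = k := by rw [sum_count_eq_length, List.length_ofFn]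
  rw [Finset.mem_range] at hk
  rw [multiIndices, Finset.mem_filter, Fintype.mem_piFinset]
  refine ⟨fun i => ?_, by rw [hsum]; omega⟩
  have := Finset.single_le_sum (f := fun i => (List.ofFn I).count i) (fun _ _ => Nat.zero_le _)
    (Finset.mem_univ i)
  rw [Finset.mem_range]
  omega

/-- The number of derivatives of order at most `s`, counted with repetitions. -/
def numDerivs (d s : ℕ) : ℕ := ∑ k ∈ Finset.range (s + 1), d ^ k

theorem sum_const_eq (s : ℕ) (c : ℝ≥0∞) :
    ∑ k ∈ Finset.range (s + 1), ∑ _I : Fin k → Fin d, c = numDerivs d s * c := by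
  simp [numDerivs, Finset.sum_mul]

variable {Ω : Set (Sp d)} {u : Sp d → ℝ} {s : ℕ}

theorem eLpNorm_weakDeriv_le_two (h : MemSobolev Ω s 2 u) {α : Fin d → ℕ}
    (hα : α ∈ multiIndices d s) :
    eLpNorm (weakDeriv Ω α u) 2 (volume.restrict Ω) ≤ sobolevENorm Ω s 2 u := by
  rw [sobolevENorm, if_pos h, if_neg (by norm_num)]
  have : (eLpNorm (weakDeriv Ω α u) 2 (volume.restrict Ω) ^ (2 : ℝ≥0∞).toReal) ≤
      ∑ α ∈ multiIndices d s, eLpNorm (weakDeriv Ω α u) 2 (volume.restrict Ω) ^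
        (2 : ℝ≥0∞).toReal :=
    Finset.single_le_sum (f := fun α => eLpNorm (weakDeriv Ω α u) 2 (volume.restrict Ω) ^
        (2 : ℝ≥0∞).toReal) (fun _ _ => zero_le) hα
  refine le_trans (le_of_eq ?_) (ENNReal.rpow_le_rpow this (by simp))
  rw [← ENNReal.rpow_mul]
  simp

theorem eLpNorm_weakDeriv_le_top (h : MemSobolev Ω s ⊤ u) {α : Fin d → ℕ}
    (hα : α ∈ multiIndices d s) :
    eLpNorm (weakDeriv Ω α u) ⊤ (volume.restrict Ω) ≤ sobolevENorm Ω s ⊤ u := by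
  rw [sobolevENorm, if_pos h, if_pos rfl]
  exact Finset.le_sup (f := fun α => eLpNorm (weakDeriv Ω α u) ⊤ (volume.restrict Ω)) hα

/-- The version for `J`: averaging does not increase essential suprema. The bound is pointwise so
that it can multiply the `L²` bound for `u`. -/
theorem enorm_derivSum_mollify_le (hΩ : MeasurableSet Ω) (hu : IntegrableOn u Ω)
    (h : MemSobolev Ω s ⊤ u) (η : ContDiffBump (0 : Sp d)) {x : Sp d}
    (hx : Metric.closedBall x η.rOut ⊆ Ω) :
    ‖derivSum s (mollify η Ω u) x‖ₑ ≤ numDerivs d s * sobolevENorm Ω s ⊤ u := by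
  rw [← sum_const_eq, Real.enorm_of_nonneg (derivSum_nonneg _ _ _)]
  refine (ENNReal.ofReal_le_ofReal (derivSum_le_sum (contDiff_mollify η hΩ hu) s x)).trans ?_
  rw [ENNReal.ofReal_sum_of_nonneg fun _ _ => Finset.sum_nonneg fun _ _ => norm_nonneg _]
  refine Finset.sum_le_sum fun k hk => ?_
  rw [ENNReal.ofReal_sum_of_nonneg fun _ _ => norm_nonneg _]
  refine Finset.sum_le_sum fun I _ => ?_
  have hmem := count_mem_multiIndices (d := d) hk I
  obtain ⟨g, hg, -⟩ := h.2 _ hmem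
  rw [multiDeriv_mollify η hΩ hu (hasWeakDeriv_weakDeriv ⟨g, hg⟩) hx, ofReal_norm]
  exact (enorm_mollify_le_eLpNorm_top η hΩ x).trans (eLpNorm_weakDeriv_le_top h hmem)

theorem eLpNorm_derivSum_mollify_le (hΩ : MeasurableSet Ω) (hu : IntegrableOn u Ω)
    (h : MemSobolev Ω s 2 u) (η : ContDiffBump (0 : Sp d)) {A : Set (Sp d)}
    (hA : MeasurableSet A) (hx : ∀ x ∈ A, Metric.closedBall x η.rOut ⊆ Ω) :
    eLpNorm (derivSum s (mollify η Ω u)) 2 (volume.restrict A) ≤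
      numDerivs d s * sobolevENorm Ω s 2 u := by
  have hw := contDiff_mollify η hΩ hu
  have hm : ∀ α : Fin d → ℕ, AEStronglyMeasurable (fun x => ‖multiDeriv α (mollify η Ω u) x‖)
      (volume.restrict A) := fun α => by
    rw [multiDeriv_eq_listDeriv]
    exact (contDiff_listDeriv hw _).continuous.norm.aestronglyMeasurable
  calc _ ≤ eLpNorm (∑ k ∈ Finset.range (s + 1), ∑ I : Fin k → Fin d,
        fun x => ‖multiDeriv (fun i => (List.ofFn I).count i) (mollify η Ω u) x‖) 2
          (volume.restrict A) := by
        refine eLpNorm_mono fun x => ?_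
        rw [Real.norm_of_nonneg (derivSum_nonneg _ _ _)]
        refine (derivSum_le_sum hw s x).trans ((le_of_eq ?_).trans (le_abs_self _))
        simp
    _ ≤ ∑ k ∈ Finset.range (s + 1), eLpNorm (∑ I : Fin k → Fin d,
        fun x => ‖multiDeriv (fun i => (List.ofFn I).count i) (mollify η Ω u) x‖) 2
          (volume.restrict A) :=
        eLpNorm_sum_le (fun k _ => Finset.aestronglyMeasurable_sum _ fun I _ => hm _) (by norm_num)
    _ ≤ ∑ k ∈ Finset.range (s + 1), ∑ I : Fin k → Fin d, sobolevENorm Ω s 2 u := by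
        refine Finset.sum_le_sum fun k hk => ?_
        refine (eLpNorm_sum_le (fun I _ => hm _) (by norm_num)).trans ?_
        refine Finset.sum_le_sum fun I _ => ?_
        have hmem := count_mem_multiIndices (d := d) hk I
        obtain ⟨g, hg, -⟩ := h.2 _ hmem
        have hwd := hasWeakDeriv_weakDeriv ⟨g, hg⟩
        rw [eLpNorm_norm]
        calc _ = eLpNorm (mollify η Ω (weakDeriv Ω _ u)) 2 (volume.restrict A) := by
              refine eLpNorm_congr_ae ?_
              filter_upwards [ae_restrict_mem hA] with x hxA
              exact multiDeriv_mollify η hΩ hu hwd (hx x hxA)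
          _ ≤ eLpNorm (mollify η Ω (weakDeriv Ω _ u)) 2 volume :=
              eLpNorm_mono_measure _ Measure.restrict_le_self
          _ ≤ _ := eLpNorm_mollify_le η hΩ hwd.locallyIntegrableOn_deriv.aestronglyMeasurable
          _ ≤ _ := eLpNorm_weakDeriv_le_two h hmem
    _ = _ := sum_const_eq s _

end SobolevBounds

end

section

variable {d : ℕ}

/-! ### Lower semicontinuity of polynomial approximation -/

section Limit

open Filter Topology

variable (K : RefElement d) (N : ℕ)

/-- Equivalence of norms in finite dimension: the map from coefficients to `L²(U)` is injective,
hence bounded below. A bound on one fixed small set therefore controls the whole polynomial. -/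
theorem exists_coordinates {U : Set (Sp d)} (hU : IsOpen U) (hne : U.Nonempty)
    (hUK : U ⊆ K.domain) :
    ∃ (m : ℕ) (b : Fin m → MvPolynomial (Fin d) ℝ) (L : ℝ), 0 ≤ L ∧ (∀ i, b i ∈ K.polySpace N) ∧
      ∀ p ∈ K.polySpace N, ∃ c : Fin m → ℝ, p = ∑ i, c i • b i ∧
        ‖c‖ ≤ L * (eLpNorm (polyEval p) 2 (volume.restrict U)).toReal := by
  let B := Module.finBasis ℝ (K.polySpace N)
  have hmem : ∀ p : MvPolynomial (Fin d) ℝ, MemLp (polyEval p) 2 (volume.restrict U) := fun p =>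
    (memLp_polyEval K p 2).mono_measure (Measure.restrict_mono hUK le_rfl)
  let T : (Fin (Module.finrank ℝ (K.polySpace N)) → ℝ) →ₗ[ℝ] Lp ℝ 2 (volume.restrict U) :=
    { toFun := fun c => (hmem (∑ i, c i • (B i : MvPolynomial (Fin d) ℝ))).toLp
      map_add' := fun c c' => by
        rw [← MemLp.toLp_add]
        refine MemLp.toLp_congr _ _ (ae_of_all _ fun x => ?_)
        rw [Pi.add_apply, ← polyEval_add, ← Finset.sum_add_distrib]
        simp only [Pi.add_apply, add_smul]
      map_smul' := fun a c => by
        rw [RingHom.id_apply, ← MemLp.toLp_const_smul]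
        refine MemLp.toLp_congr _ _ (ae_of_all _ fun x => ?_)
        rw [Pi.smul_apply, smul_eq_mul, ← polyEval_smul, Finset.smul_sum]
        simp only [Pi.smul_apply, smul_eq_mul, mul_smul] }
  have hker : T.ker = ⊥ := by
    refine LinearMap.ker_eq_bot'.2 fun c hc => ?_
    have h0 : polyEval (∑ i, c i • (B i : MvPolynomial (Fin d) ℝ)) =ᵐ[volume.restrict U] 0 :=
      (MemLp.toLp_eq_toLp_iff (hmem _) MemLp.zero).1 (hc.trans (MemLp.toLp_zero _).symm)
    have h1 := eq_zero_of_polyEval_ae_eq hU hne h0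
    have h2 : ∑ i, c i • B i = 0 := Subtype.ext (by simpa using h1)
    ext i
    exact Fintype.linearIndependent_iff.1 B.linearIndependent c h2 i
  obtain ⟨L, -, hL⟩ := LinearMap.exists_antilipschitzWith T hker
  refine ⟨_, fun i => B i, L, L.2, fun i => (B i).2, fun p hp => ?_⟩
  have hsum : p = ∑ i, B.repr ⟨p, hp⟩ i • (B i : MvPolynomial (Fin d) ℝ) := by
    have := congrArg Subtype.val (B.sum_repr ⟨p, hp⟩)
    rw [AddSubmonoidClass.coe_finsetSum] at this
    exact this.symm
  refine ⟨fun i => B.repr ⟨p, hp⟩ i, hsum, ?_⟩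
  have h3 := hL.le_mul_dist (fun i => B.repr ⟨p, hp⟩ i) 0
  rw [dist_zero_right, map_zero, dist_zero_right] at h3
  have h4 : ‖T (fun i => B.repr ⟨p, hp⟩ i)‖ = (eLpNorm (polyEval (∑ i, B.repr ⟨p, hp⟩ i •
      (B i : MvPolynomial (Fin d) ℝ))) 2 (volume.restrict U)).toReal := Lp.norm_toLp _ (hmem _)
  rw [h4, ← hsum] at h3
  exact h3

variable {K N}

/-- The bounds `M` and `M'` confine the polynomials on the smallest set `K.shrink (δ 0)`, so a
subsequence of coefficient vectors converges. Fatou's lemma then transfers `M` to the limit on the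
full domain without loss. -/
theorem exists_eLpNorm_sub_le_of_tendsto {f : ℕ → Sp d → ℝ} {F : Sp d → ℝ} {δ : ℕ → ℝ}
    (hδ0 : ∀ n, 0 < δ n) (hδ8 : δ 0 ≤ 1 / 8) (hδa : Antitone δ) (hδ : Tendsto δ atTop (𝓝 0))
    (hf : ∀ n, AEStronglyMeasurable (f n) (volume.restrict (K.shrink (δ n))))
    (hlim : ∀ᵐ x ∂volume.restrict K.domain, Tendsto (fun n => f n x) atTop (𝓝 (F x)))
    {M M' : ℝ≥0∞} (hM : M ≠ ⊤) (hM' : M' ≠ ⊤)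
    (h : ∀ n, ∃ p ∈ K.polySpace N, eLpNorm (fun x => f n x - polyEval p x) 2
      (volume.restrict (K.shrink (δ n))) ≤ M)
    (h' : ∀ n, eLpNorm (f n) 2 (volume.restrict (K.shrink (δ n))) ≤ M') :
    ∃ p ∈ K.polySpace N, eLpNorm (fun x => F x - polyEval p x) 2
      (volume.restrict K.domain) ≤ M := by
  set U := K.shrink (δ 0) with hU
  have hUn : ∀ n, U ⊆ K.shrink (δ n) := fun n => K.shrink_anti (hδa (Nat.zero_le n))
  obtain ⟨m, b, L, hL0, hb, hL⟩ := exists_coordinates K N (K.isOpen_shrink (δ 0))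
    (K.shrink_nonempty hδ8) (K.shrink_subset_domain (hδ0 0))
  choose p hp hpM using h
  choose c hc hcL using fun n => hL (p n) (hp n)
  have hbound : ∀ n, ‖c n‖ ≤ L * (M + M').toReal := by
    intro n
    refine (hcL n).trans ?_
    gcongr
    · exact ENNReal.add_ne_top.2 ⟨hM, hM'⟩
    have hres : volume.restrict U ≤ volume.restrict (K.shrink (δ n)) :=
      Measure.restrict_mono (hUn n) le_rfl
    have hfU := (hf n).mono_measure hres
    calc eLpNorm (polyEval (p n)) 2 (volume.restrict U)
        = eLpNorm (f n - fun x => f n x - polyEval (p n) x) 2 (volume.restrict U) := by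
          congr 1
          ext x
          simp
      _ ≤ eLpNorm (f n) 2 (volume.restrict U) +
          eLpNorm (fun x => f n x - polyEval (p n) x) 2 (volume.restrict U) :=
          eLpNorm_sub_le hfU (hfU.sub (continuous_polyEval _).aestronglyMeasurable) (by norm_num)
      _ ≤ M' + M := add_le_add ((eLpNorm_mono_measure _ hres).trans (h' n))
          ((eLpNorm_mono_measure _ hres).trans (hpM n))
      _ = M + M' := add_comm _ _
  obtain ⟨a, -, φ, hφ, ha⟩ := tendsto_subseq_of_bounded (Metric.isBounded_closedBall
    (x := (0 : Fin m → ℝ)) (r := L * (M + M').toReal)) (x := c)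
    (fun n => mem_closedBall_zero_iff.2 (hbound n))
  refine ⟨∑ i, a i • b i, Submodule.sum_mem _ fun i _ => Submodule.smul_mem _ _ (hb i), ?_⟩
  have heval : ∀ (e : Fin m → ℝ) x, polyEval (∑ i, e i • b i) x = ∑ i, e i * polyEval (b i) x :=
    fun e x => by simp [polyEval, MvPolynomial.smul_eval]
  have hpt : ∀ x, Tendsto (fun n => polyEval (p (φ n)) x) atTop
      (𝓝 (polyEval (∑ i, a i • b i) x)) := by
    intro x
    simp only [hc, heval]
    exact tendsto_finsetSum _ fun i _ => ((tendsto_pi_nhds.1 ha) i).mul_const _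
  -- The indicators place all the errors on one domain; at each point they are eventually `1`, since
  -- the shrunken elements exhaust it.
  set g : ℕ → Sp d → ℝ≥0∞ := fun n => (K.shrink (δ (φ n))).indicator
    fun x => ‖f (φ n) x - polyEval (p (φ n)) x‖ₑ ^ 2 with hg
  have hgm : ∀ n, AEMeasurable (g n) (volume.restrict K.domain) := by
    intro n
    exact ((aemeasurable_indicator_iff (K.isOpen_shrink _).measurableSet).2
      (((hf _).sub (continuous_polyEval _).aestronglyMeasurable).enorm.pow_const 2)).restrict
  have hgi : ∀ n, ∫⁻ x in K.domain, g n x ≤ M ^ 2 := by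
    intro n
    rw [hg, lintegral_indicator (K.isOpen_shrink _).measurableSet, Measure.restrict_restrict
      (K.isOpen_shrink _).measurableSet, inter_eq_left.2 (K.shrink_subset_domain (hδ0 _)),
      ← eLpNorm_two_sq]
    gcongr
    exact hpM (φ n)
  have hglim : ∀ᵐ x ∂volume.restrict K.domain, Tendsto (fun n => g n x) atTop
      (𝓝 (‖F x - polyEval (∑ i, a i • b i) x‖ₑ ^ 2)) := by
    filter_upwards [hlim, ae_restrict_mem K.measurableSet_domain] with x hx hxK
    obtain ⟨ε, hε, hxε⟩ := K.exists_mem_shrink hxK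
    have hev : ∀ᶠ n in atTop, δ (φ n) < ε :=
      (hδ.comp hφ.tendsto_atTop).eventually_lt_const hε
    have h1 : Tendsto (fun n => ‖f (φ n) x - polyEval (p (φ n)) x‖ₑ ^ 2) atTop
        (𝓝 (‖F x - polyEval (∑ i, a i • b i) x‖ₑ ^ 2)) :=
      ((ENNReal.continuous_pow 2).tendsto _).comp
        (((hx.comp hφ.tendsto_atTop).sub (hpt x)).enorm)
    refine h1.congr' ?_
    filter_upwards [hev] with n hn
    rw [hg]
    simp only
    rw [indicator_of_mem (K.shrink_anti hn.le hxε)]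
  refine (ENNReal.pow_right_strictMono two_ne_zero).le_iff_le.1 ?_
  rw [eLpNorm_two_sq]
  calc ∫⁻ x in K.domain, ‖F x - polyEval (∑ i, a i • b i) x‖ₑ ^ 2
      = ∫⁻ x in K.domain, liminf (fun n => g n x) atTop := by
        refine lintegral_congr_ae ?_
        filter_upwards [hglim] with x hx
        exact hx.liminf_eq.symm
    _ ≤ liminf (fun n => ∫⁻ x in K.domain, g n x) atTop := lintegral_liminf_le' hgm
    _ ≤ liminf (fun _ : ℕ => M ^ 2) atTop := liminf_le_liminf (Eventually.of_forall hgi)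
    _ = M ^ 2 := liminf_const _

end Limit

/-! ### Change of variables -/

section ElementMap

variable {K : RefElement d} {Φ : Sp d → Sp d}

theorem IsElementMap.hasFDerivAt (hΦ : IsElementMap K Φ) {y : Sp d} (hy : y ∈ K.domain) :
    HasStrictFDerivAt Φ (fderiv ℝ Φ y) y :=
  (hΦ.contDiffOn.contDiffAt (K.isOpen_domain.mem_nhds hy)).hasStrictFDerivAt (by simp)

theorem IsElementMap.isOpen_image (hΦ : IsElementMap K Φ) {s : Set (Sp d)} (hs : IsOpen s)
    (hsK : s ⊆ K.domain) : IsOpen (Φ '' s) := by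
  rw [isOpen_iff_mem_nhds]
  rintro _ ⟨y, hy, rfl⟩
  have hdet : (fderiv ℝ Φ y).det ≠ 0 := (hΦ.jac_pos y (hsK hy)).ne'
  have h := hΦ.hasFDerivAt (hsK hy)
  rw [← (fderiv ℝ Φ y).coe_toContinuousLinearEquivOfDetNeZero hdet] at h
  rw [← h.map_nhds_eq_of_equiv]
  exact Filter.image_mem_map (hs.mem_nhds hy)

theorem IsElementMap.isOpen_element (hΦ : IsElementMap K Φ) : IsOpen (element K Φ) :=
  hΦ.isOpen_image K.isOpen_domain subset_rfl

theorem IsElementMap.elementInv_apply (hΦ : IsElementMap K Φ) {y : Sp d} (hy : y ∈ K.domain) :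
    elementInv K Φ (Φ y) = y :=
  hΦ.injOn.leftInvOn_invFunOn hy

theorem IsElementMap.jac_apply (hΦ : IsElementMap K Φ) {y : Sp d} (hy : y ∈ K.domain) :
    jac K Φ (Φ y) = refJac Φ y := by
  rw [jac, hΦ.elementInv_apply hy]

theorem IsElementMap.continuousOn_refJac (hΦ : IsElementMap K Φ) :
    ContinuousOn (refJac Φ) K.domain :=
  ContinuousLinearMap.continuous_det.comp_continuousOn
    (hΦ.contDiffOn.continuousOn_fderiv_of_isOpen K.isOpen_domain (by simp))

theorem IsElementMap.lintegral_image (hΦ : IsElementMap K Φ) {s : Set (Sp d)}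
    (hs : MeasurableSet s) (hsK : s ⊆ K.domain) (g : Sp d → ℝ≥0∞) :
    ∫⁻ x in Φ '' s, g x = ∫⁻ y in s, ENNReal.ofReal (refJac Φ y) * g (Φ y) := by
  rw [lintegral_image_eq_lintegral_abs_det_fderiv_mul volume hs
    (fun y hy => (hΦ.hasFDerivAt (hsK hy)).hasFDerivAt.hasFDerivWithinAt) (hΦ.injOn.mono hsK)]
  refine setLIntegral_congr_fun hs fun y hy => ?_
  rw [refJac, abs_of_pos (show 0 < (fderiv ℝ Φ y).det from hΦ.jac_pos y (hsK hy))]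

theorem IsElementMap.eLpNorm_image_le (hΦ : IsElementMap K Φ) {b : ℝ}
    (hb : ∀ y ∈ K.domain, refJac Φ y ≤ b) (f : Sp d → ℝ) :
    eLpNorm f 2 (volume.restrict (element K Φ)) ≤
      ENNReal.ofReal (√b) * eLpNorm (fun y => f (Φ y)) 2 (volume.restrict K.domain) := by
  refine (ENNReal.pow_right_strictMono two_ne_zero).le_iff_le.1 ?_
  obtain ⟨y0, hy0⟩ := K.domain_nonempty
  have hb0 : 0 ≤ b := (hΦ.jac_pos y0 hy0).le.trans (hb y0 hy0)
  rw [mul_pow, eLpNorm_two_sq, eLpNorm_two_sq, element,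
    hΦ.lintegral_image K.measurableSet_domain subset_rfl, ← ENNReal.ofReal_pow (Real.sqrt_nonneg _),
    Real.sq_sqrt hb0, ← lintegral_const_mul' _ _ ENNReal.ofReal_ne_top]
  refine setLIntegral_mono' K.measurableSet_domain fun y hy => ?_
  gcongr
  exact hb y hy

theorem IsElementMap.eLpNorm_comp_le (hΦ : IsElementMap K Φ) {a : ℝ} (ha : 0 < a)
    (hb : ∀ y ∈ K.domain, a ≤ refJac Φ y) {s : Set (Sp d)}
    (hs : MeasurableSet s) (hsK : s ⊆ K.domain) (f : Sp d → ℝ) :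
    eLpNorm (fun y => f (Φ y)) 2 (volume.restrict s) ≤
      ENNReal.ofReal (√(1 / a)) * eLpNorm f 2 (volume.restrict (Φ '' s)) := by
  refine (ENNReal.pow_right_strictMono two_ne_zero).le_iff_le.1 ?_
  rw [mul_pow, eLpNorm_two_sq, eLpNorm_two_sq, hΦ.lintegral_image hs hsK,
    ← ENNReal.ofReal_pow (Real.sqrt_nonneg _), Real.sq_sqrt (by positivity),
    ← lintegral_const_mul' _ _ ENNReal.ofReal_ne_top]
  refine setLIntegral_mono' hs fun y hy => ?_
  rw [← mul_assoc, ← ENNReal.ofReal_mul (by positivity)]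
  refine le_mul_of_one_le_left' ?_
  rw [← ENNReal.ofReal_one]
  refine ENNReal.ofReal_le_ofReal ?_
  rw [one_div, inv_mul_eq_div, one_le_div ha]
  exact hb y (hsK hy)

/-- Since `J ≥ a > 0`, a set has measure at most `1/a` times that of its image, so null sets of `D`
pull back to null sets. -/
theorem IsElementMap.absolutelyContinuous_map (hΦ : IsElementMap K Φ) {a : ℝ} (ha : 0 < a)
    (hb : ∀ y ∈ K.domain, a ≤ refJac Φ y) :
    (volume.restrict K.domain).map Φ ≪ volume.restrict (element K Φ) := by
  have hΦm : AEMeasurable Φ (volume.restrict K.domain) :=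
    hΦ.contDiffOn.continuousOn.aemeasurable K.measurableSet_domain
  refine Measure.AbsolutelyContinuous.mk fun t ht h0 => ?_
  rw [Measure.map_apply_of_aemeasurable hΦm ht]
  have hm : MeasurableSet (K.domain ∩ Φ ⁻¹' t) := by
    have h1 := measurable_indicator_of_continuousOn K.isOpen_domain hΦ.contDiffOn.continuousOn
    have h2 : K.domain ∩ Φ ⁻¹' t = K.domain ∩ (K.domain.indicator Φ) ⁻¹' t := by
      ext y
      refine and_congr_right fun hy => ?_
      rw [mem_preimage, mem_preimage, indicator_of_mem hy]
    rw [h2]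
    exact K.measurableSet_domain.inter (h1 ht)
  rw [Measure.restrict_apply' K.measurableSet_domain, inter_comm]
  have h1 : volume (Φ '' (K.domain ∩ Φ ⁻¹' t)) = 0 := by
    refine measure_mono_null ?_ (Measure.restrict_apply ht ▸ h0)
    rintro _ ⟨y, hy, rfl⟩
    exact ⟨hy.2, mem_image_of_mem Φ hy.1⟩
  have h2 := hΦ.lintegral_image hm inter_subset_left fun _ => 1
  rw [setLIntegral_one, h1] at h2
  have h3 : ENNReal.ofReal a * volume (K.domain ∩ Φ ⁻¹' t) ≤ 0 := by
    rw [h2, ← setLIntegral_const]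
    refine setLIntegral_mono' hm fun y hy => ?_
    rw [mul_one]
    exact ENNReal.ofReal_le_ofReal (hb y hy.1)
  rcases mul_eq_zero.1 (nonpos_iff_eq_zero.1 h3) with h | h
  · exact absurd h (by simpa using ha)
  · exact h

theorem IsElementMap.ae_comp (hΦ : IsElementMap K Φ) {a : ℝ} (ha : 0 < a)
    (hb : ∀ y ∈ K.domain, a ≤ refJac Φ y) {P : Sp d → Prop}
    (h : ∀ᵐ x ∂volume.restrict (element K Φ), P x) :
    ∀ᵐ y ∂volume.restrict K.domain, P (Φ y) :=
  ae_of_ae_map (hΦ.contDiffOn.continuousOn.aemeasurable K.measurableSet_domain)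
    ((hΦ.absolutelyContinuous_map ha hb).ae_le h)

theorem IsElementMap.aestronglyMeasurable_comp (hΦ : IsElementMap K Φ) {a : ℝ} (ha : 0 < a)
    (hb : ∀ y ∈ K.domain, a ≤ refJac Φ y) {f : Sp d → ℝ}
    (h : AEStronglyMeasurable f (volume.restrict (element K Φ))) :
    AEStronglyMeasurable (fun y => f (Φ y)) (volume.restrict K.domain) :=
  (h.mono_ac (hΦ.absolutelyContinuous_map ha hb)).comp_aemeasurable
    (hΦ.contDiffOn.continuousOn.aemeasurable K.measurableSet_domain)

end ElementMap

end

section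

/-! ### The error estimate -/

/-! ### Finiteness and definiteness of the Sobolev norm. -/

section Sobolev

variable {d s : ℕ} {Ω : Set (Sp d)} {p : ℝ≥0∞} {u : Sp d → ℝ}

theorem MemSobolev.eLpNorm_weakDeriv_lt_top (h : MemSobolev Ω s p u) (hΩ : IsOpen Ω)
    {α : Fin d → ℕ} (hα : α ∈ multiIndices d s) :
    eLpNorm (weakDeriv Ω α u) p (volume.restrict Ω) < ⊤ := by
  obtain ⟨g, hg, hgp⟩ := h.2 α hα
  rw [eLpNorm_congr_ae ((hasWeakDeriv_weakDeriv ⟨g, hg⟩).ae_eq hΩ hg)]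
  exact hgp.2

theorem MemSobolev.sobolevENorm_lt_top (h : MemSobolev Ω s p u) (hΩ : IsOpen Ω) :
    sobolevENorm Ω s p u < ⊤ := by
  rw [sobolevENorm, if_pos h]
  split_ifs with hp
  · subst hp
    exact (Finset.sup_lt_iff ENNReal.zero_lt_top).2 fun α hα => h.eLpNorm_weakDeriv_lt_top hΩ hα
  · refine ENNReal.rpow_lt_top_of_nonneg (by positivity) (ENNReal.sum_lt_top.2 fun α hα => ?_).ne
    exact ENNReal.rpow_lt_top_of_nonneg ENNReal.toReal_nonneg
      (h.eLpNorm_weakDeriv_lt_top hΩ hα).ne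

theorem MemSobolev.ae_eq_zero (h : MemSobolev Ω s 2 u) (hΩ : IsOpen Ω) (hu : IntegrableOn u Ω)
    (h0 : sobolevENorm Ω s 2 u = 0) : u =ᵐ[volume.restrict Ω] 0 := by
  have hmem : (0 : Fin d → ℕ) ∈ multiIndices d s := by
    simp [multiIndices]
  have hw := hasWeakDeriv_zero hu.locallyIntegrableOn
  have h1 := eLpNorm_weakDeriv_le_two h hmem
  have h2 := (hasWeakDeriv_weakDeriv ⟨u, hw⟩).ae_eq hΩ hw
  rw [h0, nonpos_iff_eq_zero, eLpNorm_congr_ae h2,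
    eLpNorm_eq_zero_iff h.1.1 two_ne_zero] at h1
  exact h1

end Sobolev

/-! ### Constants of the element map and passage to Sobolev functions. -/

section Main

open Filter Topology

variable {d : ℕ} {K : RefElement d} {N m : ℕ} {γ : ℝ} {Φ : Sp d → Sp d}

theorem IsQuasiRegular.one_le (hq : IsQuasiRegular K m γ Φ) (hΦ : IsElementMap K Φ) : 1 ≤ γ := by
  obtain ⟨y, hy⟩ := K.domain_nonempty
  exact le_of_mul_le_mul_right (by simpa using hq.jac_le y hy y hy) (hΦ.jac_pos y hy)

/-- If `h = 0`, the first-order bounds, which are pure and thus available on every element, force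
`DΦ = 0`, against `J > 0`. -/
theorem IsQuasiRegular.diam_pos (hq : IsQuasiRegular K (m + 1) γ Φ) (hΦ : IsElementMap K Φ) :
    0 < Metric.diam (element K Φ) := by
  refine Metric.diam_nonneg.lt_of_ne fun h0 => ?_
  obtain ⟨y, hy⟩ := K.domain_nonempty
  have hzero : ∀ i, fderiv ℝ Φ y (EuclideanSpace.single i 1) = 0 := by
    intro i
    have hc : K.IsControlled (Pi.single i 1) := by
      cases K
      · exact ⟨i, 1, rfl⟩
      · trivial
      · trivial
    have hs : ∑ j, (Pi.single i 1 : Fin d → ℕ) j = 1 := by simp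
    have h1 := hq.norm_multiDeriv_le _ hc hs.ge (by omega) y hy
    rw [hs, ← h0, pow_one, mul_zero, norm_le_zero_iff,
      multiDeriv_single K.isOpen_domain hΦ.contDiffOn i 1 hy] at h1
    exact h1
  have hf : fderiv ℝ Φ y = 0 := by
    refine ContinuousLinearMap.coe_injective ((EuclideanSpace.basisFun (Fin d) ℝ).toBasis.ext
      fun i => ?_)
    simpa using hzero i
  have hJ := hΦ.jac_pos y hy
  have hd : d ≠ 0 := by cases K <;> norm_num
  rw [refJac, hf, ContinuousLinearMap.det, ContinuousLinearMap.toLinearMap_zero, LinearMap.det_zero] at hJ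
  simp [hd] at hJ

theorem IsElementMap.isFiniteMeasure (hΦ : IsElementMap K Φ) {b : ℝ}
    (hb : ∀ y ∈ K.domain, refJac Φ y ≤ b) :
    IsFiniteMeasure (volume.restrict (element K Φ)) := by
  refine ⟨?_⟩
  rw [Measure.restrict_apply_univ, ← setLIntegral_one, element,
    hΦ.lintegral_image K.measurableSet_domain subset_rfl]
  calc ∫⁻ y in K.domain, ENNReal.ofReal (refJac Φ y) * 1
      ≤ ∫⁻ _ in K.domain, ENNReal.ofReal b :=
        setLIntegral_mono' K.measurableSet_domain fun y hy => by
          rw [mul_one]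
          exact ENNReal.ofReal_le_ofReal (hb y hy)
    _ < ⊤ := by
        rw [lintegral_const]
        exact ENNReal.mul_lt_top ENNReal.ofReal_lt_top (measure_lt_top _ _)

theorem IsElementMap.neBot_ae (hΦ : IsElementMap K Φ) :
    (ae (volume.restrict (element K Φ))).NeBot := by
  rw [ae_neBot]
  intro h
  rw [Measure.restrict_eq_zero] at h
  exact (hΦ.isOpen_element.measure_pos volume (K.domain_nonempty.image Φ)).ne' h

/-- Some point of `D` satisfies both essential bounds, and there `(1/√J) · √J = 1`. -/
theorem IsElementMap.one_le_jacConst (hΦ : IsElementMap K Φ) (N : ℕ) : 1 ≤ jacConst K N Φ := by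
  have := hΦ.neBot_ae
  refine le_trans ?_ (le_max_left _ _)
  rw [eLpNorm_exponent_top, eLpNorm_exponent_top]
  obtain ⟨x, ⟨h1, h2⟩, y, hy, rfl⟩ := ((ae_le_eLpNormEssSup
    (f := fun x => 1 / √(jac K Φ x)) (μ := volume.restrict (element K Φ))).and
    (ae_le_eLpNormEssSup (f := fun x => √(jac K Φ x)) (μ := volume.restrict (element K Φ))) |>.and
    (ae_restrict_mem hΦ.isOpen_element.measurableSet)).exists
  refine le_trans (le_of_eq ?_) (mul_le_mul' h1 h2)
  have hJ : 0 < √(jac K Φ (Φ y)) := by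
    rw [hΦ.jac_apply hy]
    exact Real.sqrt_pos.2 (hΦ.jac_pos y hy)
  rw [← enorm_mul, one_div_mul_cancel hJ.ne', enorm_one]

theorem IsElementMap.ofReal_mul_le_jacConst (hΦ : IsElementMap K Φ) (N : ℕ) {b : ℝ}
    (hb : ∀ y ∈ K.domain, refJac Φ y ≤ b) :
    ENNReal.ofReal (1 / b) * sobolevENorm (element K Φ) (N + 1) ⊤ (jac K Φ) ≤
      jacConst K N Φ := by
  have := hΦ.neBot_ae
  refine le_trans ?_ (le_max_right _ _)
  gcongr
  rw [eLpNorm_exponent_top]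
  obtain ⟨x, h1, y, hy, rfl⟩ := ((ae_le_eLpNormEssSup (f := fun x => 1 / jac K Φ x)
    (μ := volume.restrict (element K Φ))).and
    (ae_restrict_mem hΦ.isOpen_element.measurableSet)).exists
  refine le_trans ?_ h1
  have hJ := hΦ.jac_pos y hy
  rw [hΦ.jac_apply hy, Real.enorm_of_nonneg (by positivity)]
  exact ENNReal.ofReal_le_ofReal (one_div_le_one_div_of_le hJ (hb y hy))

theorem IsElementMap.jacConst_eq_top (hΦ : IsElementMap K Φ) {N : ℕ} {b : ℝ}
    (hb : ∀ y ∈ K.domain, refJac Φ y ≤ b)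
    (h : ¬ MemSobolev (element K Φ) (N + 1) ⊤ (jac K Φ)) : jacConst K N Φ = ⊤ := by
  obtain ⟨y, hy⟩ := K.domain_nonempty
  have hb0 : 0 < b := (hΦ.jac_pos y hy).trans_le (hb y hy)
  have h1 := hΦ.ofReal_mul_le_jacConst N hb
  rw [sobolevENorm, if_neg h, ENNReal.mul_top (by simpa using hb0)] at h1
  exact top_le_iff.1 h1

/-- Approximation by polynomials of the pullback of an almost everywhere limit of smooth functions
whose derivatives are bounded on compact subsets. -/
theorem IsElementMap.exists_approx_of_tendsto (hΦ : IsElementMap K Φ) {a : ℝ} (ha : 0 < a)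
    (hJa : ∀ y ∈ K.domain, a ≤ refJac Φ y) {E R : ℝ≥0∞} (hE : E ≠ ⊤) (hR : R ≠ ⊤)
    (happ : ∀ w : Sp d → ℝ, ContDiff ℝ ∞ w → ∀ δ : ℝ, 0 < δ → δ ≤ 1 / 8 →
      ∃ p ∈ K.polySpace N, eLpNorm (fun y => w (Φ y) - polyEval p y) 2
        (volume.restrict (K.shrink δ)) ≤ E *
          eLpNorm (fun y => derivSum m w (Φ y)) 2 (volume.restrict (K.shrink δ)))
    {w : ℕ → Sp d → ℝ} {W : Sp d → ℝ} (hw : ∀ n, ContDiff ℝ ∞ (w n))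
    (hlim : ∀ᵐ x ∂volume.restrict (element K Φ), Tendsto (fun n => w n x) atTop (𝓝 (W x)))
    (hbound : ∀ S ⊆ element K Φ, IsCompact S → ∀ᶠ n in atTop, ∀ A ⊆ S, MeasurableSet A →
      eLpNorm (derivSum m (w n)) 2 (volume.restrict A) ≤ R) :
    ∃ p ∈ K.polySpace N, eLpNorm (fun y => W (Φ y) - polyEval p y) 2
      (volume.restrict K.domain) ≤ E * (ENNReal.ofReal (√(1 / a)) * R) := by
  set δ : ℕ → ℝ := fun n => 1 / 8 * (1 / (n + 1)) with hδdef
  have hδ0 : ∀ n, 0 < δ n := fun n => by positivity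
  have hδ8 : ∀ n, δ n ≤ 1 / 8 := fun n => by
    have : 1 / ((n : ℝ) + 1) ≤ 1 := by
      rw [div_le_one (by positivity)]
      linarith [(Nat.cast_nonneg n : (0 : ℝ) ≤ n)]
    simp only [hδdef]
    linarith
  have hδa : Antitone δ := fun i j hij => by
    simp only [hδdef]
    gcongr
  have hδ : Tendsto δ atTop (𝓝 0) := by
    simpa only [mul_zero] using
      (tendsto_one_div_add_atTop_nhds_zero_nat (𝕜 := ℝ)).const_mul (1 / 8)
  -- The bounds on `w k` hold only eventually on each compact set, so the index `k` is chosen after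
  -- the shrunken element; `k ≥ n` preserves the limit.
  have hex : ∀ n, ∃ k, n ≤ k ∧ eLpNorm (derivSum m (w k)) 2
      (volume.restrict (Φ '' K.shrink (δ n))) ≤ R := by
    intro n
    have hsub := K.closedShrink_subset_domain (hδ0 n)
    have h1 := hbound (Φ '' K.closedShrink (δ n)) (image_mono hsub)
      ((K.isCompact_closedShrink (hδ0 n).le).image_of_continuousOn
        (hΦ.contDiffOn.continuousOn.mono hsub))
    obtain ⟨k, hk, hnk⟩ := (h1.and (eventually_ge_atTop n)).exists
    exact ⟨k, hnk, hk _ (image_mono (K.shrink_subset_closedShrink _))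
      (hΦ.isOpen_image (K.isOpen_shrink _) (K.shrink_subset_domain (hδ0 n))).measurableSet⟩
  choose k hnk hk using hex
  have hkt : Tendsto k atTop atTop := tendsto_atTop_mono hnk tendsto_id
  have hD : ∀ n, eLpNorm (fun y => derivSum m (w (k n)) (Φ y)) 2
      (volume.restrict (K.shrink (δ n))) ≤ ENNReal.ofReal (√(1 / a)) * R := fun n =>
    (hΦ.eLpNorm_comp_le ha hJa (K.isOpen_shrink _).measurableSet
      (K.shrink_subset_domain (hδ0 n)) _).trans (by gcongr; exact hk n)
  have hR' : ENNReal.ofReal (√(1 / a)) * R ≠ ⊤ := ENNReal.mul_ne_top ENNReal.ofReal_ne_top hR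
  refine exists_eLpNorm_sub_le_of_tendsto (f := fun n y => w (k n) (Φ y)) hδ0 (hδ8 0) hδa hδ
    (fun n => ?_) ?_ (ENNReal.mul_ne_top hE hR') hR' (fun n => ?_) (fun n => ?_)
  · exact ((hw _).continuous.comp_continuousOn (hΦ.contDiffOn.continuousOn.mono
      (K.shrink_subset_domain (hδ0 n)))).aestronglyMeasurable (K.isOpen_shrink _).measurableSet
  · filter_upwards [hΦ.ae_comp ha hJa hlim] with y hy
    exact hy.comp hkt
  · obtain ⟨p, hp, hle⟩ := happ (w (k n)) (hw _) (δ n) (hδ0 n) (hδ8 n)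
    exact ⟨p, hp, hle.trans (by gcongr; exact hD n)⟩
  · exact (eLpNorm_mono_real fun y => abs_le_derivSum m _ _).trans (hD n)

theorem eventually_closedBall_bump_subset {Ω S : Set (Sp d)} (hΩ : IsOpen Ω) (hS : IsCompact S)
    (hSΩ : S ⊆ Ω) :
    ∀ᶠ n in atTop, ∀ x ∈ S, Metric.closedBall x (bump d n).rOut ⊆ Ω := by
  obtain ⟨ε, hε, hsub⟩ := hS.exists_cthickening_subset_open hΩ hSΩ
  filter_upwards [(tendsto_one_div_add_atTop_nhds_zero_nat (𝕜 := ℝ)).eventually_lt_const hε]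
    with n hn x hx
  exact ((Metric.closedBall_subset_closedBall hn.le).trans
    (Metric.closedBall_subset_cthickening hx ε)).trans hsub

/-- An `L^∞`–`L²` Leibniz estimate, stated for smooth factors so that no product rule for weak
derivatives is required. -/
theorem eLpNorm_derivSum_mul_le {A : Set (Sp d)} (hA : MeasurableSet A) {v w : Sp d → ℝ}
    (hv : ContDiff ℝ ∞ v) (hw : ContDiff ℝ ∞ w) {R : ℝ≥0∞} (hR : R ≠ ⊤)
    (h : ∀ x ∈ A, ‖derivSum m v x‖ₑ ≤ R) :
    eLpNorm (derivSum m (v * w)) 2 (volume.restrict A) ≤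
      ((m + 1) ^ 2 * 2 ^ m : ℕ) * R * eLpNorm (derivSum m w) 2 (volume.restrict A) := by
  refine eLpNorm_two_le_of_lintegral_sq_le ?_
  rw [← lintegral_const_mul' _ _ (by finiteness)]
  refine setLIntegral_mono' hA fun x hx => ?_
  rw [← mul_pow]
  gcongr
  calc ‖derivSum m (v * w) x‖ₑ
      ≤ ‖(((m + 1) ^ 2 * 2 ^ m : ℕ) : ℝ) * (derivSum m v x * derivSum m w x)‖ₑ := by
        rw [Real.enorm_of_nonneg (derivSum_nonneg _ _ _), Real.enorm_of_nonneg]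
        · exact ENNReal.ofReal_le_ofReal (derivSum_mul_le m hv hw x)
        · exact mul_nonneg (Nat.cast_nonneg _)
            (mul_nonneg (derivSum_nonneg _ _ _) (derivSum_nonneg _ _ _))
    _ = ((m + 1) ^ 2 * 2 ^ m : ℕ) * (‖derivSum m v x‖ₑ * ‖derivSum m w x‖ₑ) := by
        rw [enorm_mul, enorm_mul, Real.enorm_natCast]
    _ ≤ _ := by
        rw [mul_assoc]
        gcongr
        exact h x hx

/-- The error of the pseudo-projection on `D` is bounded by best approximation errors on the
reference element. -/
theorem IsElementMap.eLpNorm_sub_pseudoProj_le (hΦ : IsElementMap K Φ) {a b : ℝ} (ha : 0 < a)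
    (hJa : ∀ y ∈ K.domain, a ≤ refJac Φ y) (hJb : ∀ y ∈ K.domain, refJac Φ y ≤ b)
    {u : Sp d → ℝ} (hu : MemLp u 2 (volume.restrict (element K Φ)))
    {p q : MvPolynomial (Fin d) ℝ} (hp : p ∈ K.polySpace N) (hq : q ∈ K.polySpace N) :
    eLpNorm (fun x => u x - pseudoProj K N Φ u x) 2 (volume.restrict (element K Φ)) ≤
      ENNReal.ofReal (√b) *
        (2 * eLpNorm (fun y => u (Φ y) - polyEval p y) 2 (volume.restrict K.domain) +
          ENNReal.ofReal (1 / a) * eLpNorm (fun y => u (Φ y) * jac K Φ (Φ y) - polyEval q y) 2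
            (volume.restrict K.domain)) := by
  have hj : AEStronglyMeasurable (refJac Φ) (volume.restrict K.domain) :=
    hΦ.continuousOn_refJac.aestronglyMeasurable K.measurableSet_domain
  have hf : MemLp (fun y => u (Φ y)) 2 (volume.restrict K.domain) :=
    ⟨hΦ.aestronglyMeasurable_comp ha hJa hu.1,
      (hΦ.eLpNorm_comp_le ha hJa K.measurableSet_domain subset_rfl u).trans_lt
        (ENNReal.mul_lt_top ENNReal.ofReal_lt_top hu.2)⟩
  have hfj : MemLp (fun y => u (Φ y) * refJac Φ y) 2 (volume.restrict K.domain) := by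
    refine hf.of_le_mul (c := b) (hf.1.mul hj) ?_
    filter_upwards [ae_restrict_mem K.measurableSet_domain] with y hy
    rw [norm_mul, mul_comm, Real.norm_of_nonneg (hΦ.jac_pos y hy).le]
    gcongr
    exact hJb y hy
  refine (hΦ.eLpNorm_image_le hJb _).trans ?_
  gcongr
  have h1 : eLpNorm (fun y => u (Φ y) - pseudoProj K N Φ u (Φ y)) 2 (volume.restrict K.domain) =
      eLpNorm (fun y => u (Φ y) - l2Proj K N (fun y => 1 / refJac Φ y *
        l2Proj K N (fun z => u (Φ z) * refJac Φ z) y) y) 2 (volume.restrict K.domain) := by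
    refine eLpNorm_congr_ae ?_
    filter_upwards [ae_restrict_mem K.measurableSet_domain] with y hy
    rw [pseudoProj, hΦ.elementInv_apply hy]
  have h2 : eLpNorm (fun y => u (Φ y) * jac K Φ (Φ y) - polyEval q y) 2
      (volume.restrict K.domain) = eLpNorm (fun y => u (Φ y) * refJac Φ y - polyEval q y) 2
        (volume.restrict K.domain) := by
    refine eLpNorm_congr_ae ?_
    filter_upwards [ae_restrict_mem K.measurableSet_domain] with y hy
    rw [hΦ.jac_apply hy]
  rw [h1, h2]
  exact eLpNorm_sub_l2Proj_div_le hf hfj hj hΦ.jac_pos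
    (fun y hy => one_div_le_one_div_of_le ha (hJa y hy)) hp hq

end Main

end

section

section Estimate

open Filter Topology

variable {d : ℕ} {K : RefElement d} {N : ℕ} {γ : ℝ} {Φ : Sp d → Sp d}

/-- The error estimate when `J ∈ W^{N+1,∞}(D)`. -/
theorem eLpNorm_sub_pseudoProj_le_of_memSobolev (hΦ : IsElementMap K Φ)
    {a b : ℝ} (ha : 0 < a) (hJa : ∀ y ∈ K.domain, a ≤ refJac Φ y)
    (hJb : ∀ y ∈ K.domain, refJac Φ y ≤ b) {E : ℝ≥0∞} (hE : E ≠ ⊤)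
    (happ : ∀ w : Sp d → ℝ, ContDiff ℝ ∞ w → ∀ δ : ℝ, 0 < δ → δ ≤ 1 / 8 →
      ∃ p ∈ K.polySpace N, eLpNorm (fun y => w (Φ y) - polyEval p y) 2
        (volume.restrict (K.shrink δ)) ≤ E *
          eLpNorm (fun y => derivSum (N + 1) w (Φ y)) 2 (volume.restrict (K.shrink δ)))
    (hJ : MemSobolev (element K Φ) (N + 1) ⊤ (jac K Φ))
    {u : Sp d → ℝ} (hu : MemSobolev (element K Φ) (N + 1) 2 u) :
    eLpNorm (fun x => u x - pseudoProj K N Φ u x) 2 (volume.restrict (element K Φ)) ≤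
      ENNReal.ofReal (√b) *
        (2 * (E * (ENNReal.ofReal (√(1 / a)) * (numDerivs d (N + 1) *
            sobolevENorm (element K Φ) (N + 1) 2 u))) +
          ENNReal.ofReal (1 / a) * (E * (ENNReal.ofReal (√(1 / a)) *
            ((((N + 1 : ℕ) + 1) ^ 2 * 2 ^ (N + 1) : ℕ) *
              (numDerivs d (N + 1) * sobolevENorm (element K Φ) (N + 1) ⊤ (jac K Φ)) *
              (numDerivs d (N + 1) * sobolevENorm (element K Φ) (N + 1) 2 u))))) := by
  have hD := hΦ.isOpen_element
  have hDm := hD.measurableSet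
  have := hΦ.isFiniteMeasure hJb
  have hui : IntegrableOn u (element K Φ) := hu.1.integrable (by norm_num)
  have hJi : IntegrableOn (jac K Φ) (element K Φ) := hJ.1.integrable le_top
  have hX := (hu.sobolevENorm_lt_top hD).ne
  have hY := (hJ.sobolevENorm_lt_top hD).ne
  have hcu := fun n => contDiff_mollify (bump d n) hDm hui
  have hcJ := fun n => contDiff_mollify (bump d n) hDm hJi
  obtain ⟨p, hp, hpe⟩ := hΦ.exists_approx_of_tendsto ha hJa hE
    (ENNReal.mul_ne_top (ENNReal.natCast_ne_top _) hX) happ hcu (tendsto_mollify hDm hui)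
    (fun S hSD hS => by
      filter_upwards [eventually_closedBall_bump_subset hD hS hSD] with n hn A hAS hA
      exact eLpNorm_derivSum_mollify_le hDm hui hu _ hA fun x hx => hn x (hAS hx))
  -- The approximants of `uJ` are products of the mollifications of `J` and `u`, not mollifications
  -- of the product.
  obtain ⟨q, hq, hqe⟩ := hΦ.exists_approx_of_tendsto (W := fun x => u x * jac K Φ x)
    (R := (((N + 1 : ℕ) + 1) ^ 2 * 2 ^ (N + 1) : ℕ) *
      (numDerivs d (N + 1) * sobolevENorm (element K Φ) (N + 1) ⊤ (jac K Φ)) *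
      (numDerivs d (N + 1) * sobolevENorm (element K Φ) (N + 1) 2 u)) ha hJa hE
    (by finiteness) happ (fun n => (hcJ n).mul (hcu n))
    (by
      filter_upwards [tendsto_mollify hDm hui, tendsto_mollify hDm hJi] with x hx hxJ
      rw [mul_comm (u x)]
      exact hxJ.mul hx)
    (fun S hSD hS => by
      filter_upwards [eventually_closedBall_bump_subset hD hS hSD] with n hn A hAS hA
      refine (eLpNorm_derivSum_mul_le hA (hcJ n) (hcu n) (by finiteness) fun x hx =>
        enorm_derivSum_mollify_le hDm hJi hJ _ (hn x (hAS hx))).trans ?_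
      gcongr
      exact eLpNorm_derivSum_mollify_le hDm hui hu _ hA fun x hx => hn x (hAS hx))
  exact (hΦ.eLpNorm_sub_pseudoProj_le ha hJa hJb hu.1 hp hq).trans (by gcongr)

theorem eLpNorm_sub_pseudoProj_eq_zero (hΦ : IsElementMap K Φ)
    {a b : ℝ} (ha : 0 < a) (hJa : ∀ y ∈ K.domain, a ≤ refJac Φ y)
    (hJb : ∀ y ∈ K.domain, refJac Φ y ≤ b) {u : Sp d → ℝ}
    (hu : u =ᵐ[volume.restrict (element K Φ)] 0) :
    eLpNorm (fun x => u x - pseudoProj K N Φ u x) 2 (volume.restrict (element K Φ)) = 0 := by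
  have hc := hΦ.ae_comp ha hJa hu
  refine nonpos_iff_eq_zero.1 ((hΦ.eLpNorm_sub_pseudoProj_le ha hJa hJb
    ((memLp_congr_ae hu).2 MemLp.zero) (Submodule.zero_mem _) (Submodule.zero_mem _)).trans
    (le_of_eq ?_))
  have h1 : eLpNorm (fun y => u (Φ y) - polyEval 0 y) 2 (volume.restrict K.domain) = 0 := by
    rw [eLpNorm_congr_ae (g := 0), eLpNorm_zero]
    filter_upwards [hc] with y hy
    simp [hy, polyEval]
  have h2 : eLpNorm (fun y => u (Φ y) * jac K Φ (Φ y) - polyEval 0 y) 2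
      (volume.restrict K.domain) = 0 := by
    rw [eLpNorm_congr_ae (g := 0), eLpNorm_zero]
    filter_upwards [hc] with y hy
    simp [hy, polyEval]
  rw [h1, h2, mul_zero, mul_zero, add_zero, mul_zero]

/-- To be read with `s = √b`, `t = √(1/a)`, `r = 1/a`, `b' = 1/b`, `G = γ`, `jc = C_J`, `hh =
h^(N+1)`, where `X` and `Y` are the Sobolev norms of `u` and `J`. The first summand is absorbed by
`1 ≤ jc`, the second by `b' Y ≤ jc`. -/
theorem constants_le {G C n c jc hh X Y s t r b' : ℝ≥0∞} (hst : s * t = G)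
    (hr : r = G ^ 2 * b') (h1 : 1 ≤ jc) (hY : b' * Y ≤ jc) :
    s * (2 * (C * hh * (t * (n * X))) + r * (C * hh * (t * (c * (n * Y) * (n * X))))) ≤
      (2 * G * C * n + G ^ 3 * C * c * n ^ 2 + 1) * jc * hh * X := by
  calc s * (2 * (C * hh * (t * (n * X))) + r * (C * hh * (t * (c * (n * Y) * (n * X)))))
      = 2 * G * C * n * 1 * hh * X + G ^ 3 * C * c * n ^ 2 * (b' * Y) * hh * X := by
        rw [hr, ← hst]
        ring
    _ ≤ 2 * G * C * n * jc * hh * X + G ^ 3 * C * c * n ^ 2 * jc * hh * X := by gcongr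
    _ = (2 * G * C * n + G ^ 3 * C * c * n ^ 2) * jc * hh * X := by ring
    _ ≤ _ := by
        refine mul_le_mul_left (mul_le_mul_left (mul_le_mul_left ?_ _) _) _
        exact le_self_add

end Estimate

end

/-- Error estimate for the weight-adjusted pseudo-projection. -/
theorem exists_eLpNorm_sub_pseudoProj_le {d : ℕ} (K : RefElement d) (N : ℕ) (γ : ℝ) :
    ∃ C : ℝ≥0, ∀ Φ : Sp d → Sp d,
      IsElementMap K Φ → IsQuasiRegular K (N + 1) γ Φ →
      ∀ u : Sp d → ℝ, MemSobolev (element K Φ) (N + 1) 2 u →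
        eLpNorm (fun x => u x - pseudoProj K N Φ u x) 2
            (volume.restrict (element K Φ)) ≤
          C * jacConst K N Φ *
            ENNReal.ofReal (Metric.diam (element K Φ)) ^ (N + 1) *
            sobolevENorm (element K Φ) (N + 1) 2 u := by
  by_cases hγ : 1 ≤ γ
  swap
  -- For `γ < 1` there is no quasi-regular element: comparing `J` with itself at one point forces `γ
  -- ≥ 1`.
  · exact ⟨0, fun Φ hΦ hq => absurd (hq.one_le hΦ) hγ⟩
  obtain ⟨C, hC⟩ := exists_approx K N hγ
  -- The final `+ 1` keeps the constant nonzero, so that its product with `C_J = ∞` is `∞`.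
  refine ⟨2 * γ.toNNReal * C * (numDerivs d (N + 1) : ℕ) + γ.toNNReal ^ 3 * C *
    (((N + 1 : ℕ) + 1) ^ 2 * 2 ^ (N + 1) : ℕ) * (numDerivs d (N + 1) : ℕ) ^ 2 + 1, fun Φ hΦ hq u hu => ?_⟩
  obtain ⟨y, hy⟩ := K.domain_nonempty
  have hγ0 : 0 < γ := by linarith
  have hJ0 := hΦ.jac_pos y hy
  -- The value of `J` at one point fixes the bounds `a = J(y)/γ` and `b = γ J(y)`, whence `√(b/a) =
  -- γ` and `1/a = γ²/b`.
  have ha : 0 < refJac Φ y / γ := by positivity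
  have hJa : ∀ z ∈ K.domain, refJac Φ y / γ ≤ refJac Φ z := fun z hz => by
    rw [div_le_iff₀ hγ0, mul_comm]
    exact hq.jac_le y hy z hz
  have hJb : ∀ z ∈ K.domain, refJac Φ z ≤ γ * refJac Φ y := fun z hz => hq.jac_le z hz y hy
  have hJ1 := hΦ.one_le_jacConst N
  rw [ENNReal.coe_add, ENNReal.coe_add]
  simp only [ENNReal.coe_mul, ENNReal.coe_pow, ENNReal.coe_natCast, ENNReal.coe_ofNat,
    ENNReal.coe_one]
  by_cases hJ : MemSobolev (element K Φ) (N + 1) ⊤ (jac K Φ)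
  · refine (eLpNorm_sub_pseudoProj_le_of_memSobolev hΦ ha hJa hJb
      (E := C * ENNReal.ofReal (Metric.diam (element K Φ)) ^ (N + 1)) (by finiteness)
      (hC Φ _ hΦ.contDiffOn Metric.diam_nonneg hq.norm_multiDeriv_le) hJ hu).trans ?_
    refine constants_le ?_ ?_ hJ1 (hΦ.ofReal_mul_le_jacConst N hJb)
    · rw [← ENNReal.ofReal_mul (Real.sqrt_nonneg _), ← Real.sqrt_mul (by positivity)]
      have : γ * refJac Φ y * (1 / (refJac Φ y / γ)) = γ ^ 2 := by field_simp
      rw [this, Real.sqrt_sq hγ0.le]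
      rfl
    · rw [show ((γ.toNNReal : ℝ≥0) : ℝ≥0∞) = ENNReal.ofReal γ from rfl,
        ← ENNReal.ofReal_pow hγ0.le, ← ENNReal.ofReal_mul (by positivity)]
      congr 1
      field_simp
  -- Here `C_J = ∞`. Since `h > 0`, the right side is `∞` unless `‖u‖ = 0`; then `∞ · 0 = 0`, but
  -- `u` vanishes almost everywhere and so does the error.
  · by_cases h0 : sobolevENorm (element K Φ) (N + 1) 2 u = 0
    · have := hΦ.isFiniteMeasure hJb
      rw [eLpNorm_sub_pseudoProj_eq_zero hΦ ha hJa hJb (hu.ae_eq_zero hΦ.isOpen_element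
        (hu.1.integrable (by norm_num)) h0)]
      exact zero_le
    · rw [hΦ.jacConst_eq_top hJb hJ, ENNReal.mul_top (by simp), ENNReal.top_mul
        (pow_ne_zero _ (by simpa using hq.diam_pos hΦ)), ENNReal.top_mul h0]
      exact le_top

end WADG

end

theorem mainTheorem1 {d : ℕ} (K : WADG.RefElement d) (N : ℕ) (γ : ℝ) :
    ∃ C : ℝ≥0, ∀ Φ : WADG.Sp d → WADG.Sp d,
      WADG.IsElementMap K Φ → WADG.IsQuasiRegular K (N + 1) γ Φ →
      ∀ u : WADG.Sp d → ℝ, WADG.MemSobolev (WADG.element K Φ) (N + 1) 2 u →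
        eLpNorm (fun x => u x - WADG.pseudoProj K N Φ u x) 2
            (volume.restrict (WADG.element K Φ)) ≤
          C * WADG.jacConst K N Φ *
            ENNReal.ofReal (Metric.diam (WADG.element K Φ)) ^ (N + 1) *
            WADG.sobolevENorm (WADG.element K Φ) (N + 1) 2 u :=
  WADG.exists_eLpNorm_sub_pseudoProj_le K N γ
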